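/- **Dynamics.** Let $(\sigma_t)_{t\ge 0}$ be the Markov process on $\{-1,+1\}^{\mathbb Z^2}$ whose generator acts on functions $f$ of finitely many spins by $(Lf)(\sigma)=\sum_{x\in\mathbb Z^2}c(x,\sigma)\,(f(\sigma^x)-f(\sigma))$. Here $\sigma^x$ is $\sigma$ with the spin at $x$ flipped, and $c(x,\sigma)$ equals $1$, $\tfrac12$ or $0$ according to whether more than two, exactly two, or fewer than two of the four neighbours of $x$ have a spin opposite to that of $x$. Write $\mathbb E_\sigma$ for expectation when the process starts from $\sigma$. **Discretisation.** For $N\ge 1$ and $x\in\mathbb Z^2$ let $\Lambda_{x/N}=\frac xN+[-\frac1{2N},\frac1{2N})^2$. For a bounded set $S\subset\mathbb R^2$ let $S_N$ be the union of the boxes $\Lambda_{x/N}$ that meet $S$. For a configuration $\sigma$ let $\mathcal A_N^\sigma$ be the union of the boxes $\Lambda_{x/N}$ with $\sigma(x)=+1$. Let $\mathrm{vol}$ denote planar Lebesgue measure and $B(x,\rho)$ the closed Euclidean ball. **Curve and initial configuration.** Let $\gamma$ be a Jordan curve in $\mathbb R^2$ with a regular parametrisation of class $C^2$, oriented counterclockwise,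 and let $\Omega$ be the compact connected set that it encloses, so that $\gamma=\partial\Omega$. For each $N$, let $\sigma=\sigma^{(N)}$ be the configuration with $\sigma(x)=+1$ if $\Lambda_{x/N}\cap\Omega\ne\emptyset$ and $\sigma(x)=-1$ otherwise. **Averaged drift.** Let $s\in\gamma$. For all sufficiently small $r>0$ the circle $\partial B(s,r)$ meets $\gamma$ in exactly two points $x_0,x_1$, labelled so that $x_0,s,x_1$ are in counterclockwise order along $\gamma$. For $\alpha_1,\alpha_2\ge 0$ put $\mathcal S=B(s,r)\cup B(x_0,\alpha_1)\cup B(x_1,\alpha_2)$ and $$L_N(s,r,\alpha_1,\alpha_2)=\lim_{t\downarrow 0}\frac1t\Big(\mathbb E_\sigma\big[\mathrm{vol}(\mathcal A_N^{\sigma_{tN^2}}\cap\mathcal S_N)\big]-\mathrm{vol}(\mathcal A_N^{\sigma}\cap\mathcal S_N)\Big),$$ and for $\delta>0$ $$\mathbf A_N(s,r,\delta)=\frac1{\delta^2}\int_0^\delta\!\!\int_0^\delta L_N(s,r,\alpha_1,\alpha_2)\,d\alpha_1\,d\alpha_2 .$$ **Claim.** The limit defining $L_N$ exists, $L_N$ is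 integrable in $(\alpha_1,\alpha_2)$ over $[0,\delta]^2$, and $$\lim_{r\to0}\lim_{\delta\to0}\liminf_{N\to\infty}\frac1{2r}\mathbf A_N(s,r,\delta)=\lim_{r\to0}\lim_{\delta\to0}\limsup_{N\to\infty}\frac1{2r}\mathbf A_N(s,r,\delta)=-\frac12\,|\cos2\theta|\,\xi_\gamma(s),$$ where all these limits exist (the inner ones for every sufficiently small $r$), $\theta$ is the angle between the horizontal axis and the tangent line to $\gamma$ at $s$, and $\xi_\gamma(s)=\dfrac{x'y''-x''y'}{(x'^2+y'^2)^{3/2}}$ is the signed curvature of $\gamma$ at $s$, computed in the counterclockwise parametrisation $(x,y)$. -/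

import Mathlib

open MeasureTheory ProbabilityTheory Filter Topology Set
open scoped NNReal

noncomputable section

/-! The plane `ℝ²` is `ℂ` with its Euclidean norm and Lebesgue measure: `(u₁, u₂) = u₁ + i u₂`. -/

/-! ### The zero-temperature Glauber dynamics on `ℤ²` -/

/-- Spin configurations on `ℤ²`; `true` is the spin `+1` and `false` is the spin `-1`. -/
abbrev Config : Type := ℤ × ℤ → Bool

/-- The four nearest neighbours of a site. -/
def neighbours (x : ℤ × ℤ) : Finset (ℤ × ℤ) :=
  {(x.1 + 1, x.2), (x.1 - 1, x.2), (x.1, x.2 + 1), (x.1, x.2 - 1)}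

/-- `s(σ, x)`: the number of neighbours of `x` whose spin is opposite to the spin of `x`. -/
def oppositeCount (σ : Config) (x : ℤ × ℤ) : ℕ :=
  ((neighbours x).filter fun y => σ y ≠ σ x).card

/-- The flip rate `c(x, σ)`, with parameter `α = 1/2` for two opposite neighbours. -/
def flipRate (x : ℤ × ℤ) (σ : Config) : ℝ :=
  if 2 < oppositeCount σ x then 1 else if oppositeCount σ x = 2 then 1 / 2 else 0

/-- `σ^x`: the configuration `σ` with the spin at `x` flipped. -/
def flipAt (σ : Config) (x : ℤ × ℤ) : Config := Function.update σ x (!σ x)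

/-- A local function depends on the spins of finitely many sites only. -/
def IsLocalFunction (f : Config → ℝ) : Prop :=
  ∃ Λ : Finset (ℤ × ℤ), DependsOn f (Λ : Set (ℤ × ℤ))

/-- The generator `(Lf)(σ) = ∑_x c(x, σ) (f(σ^x) - f(σ))`. For a local function `f` only finitely
many terms are nonzero. -/
def generator (f : Config → ℝ) (σ : Config) : ℝ :=
  ∑ᶠ x : ℤ × ℤ, flipRate x σ * (f (flipAt σ x) - f σ)

/-- The Markov process with generator `L` (acting on local functions), given by its family of laws
`(P_σ)`: for every starting configuration `σ`, the process `X` has càdlàg paths, starts from `σ`,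
and solves the martingale problem of `L` under the probability measure `P_σ`. -/
structure IsGlauberDynamics {W : Type*} [MeasurableSpace W]
    (X : ℝ≥0 → W → Config) (P : Config → Measure W) : Prop where
  isProbabilityMeasure : ∀ σ, IsProbabilityMeasure (P σ)
  right_continuous : ∀ w t, ContinuousWithinAt (fun u => X u w) (Ici t) t
  left_limits : ∀ w t, ∃ η : Config, Tendsto (fun u => X u w) (𝓝[<] t) (𝓝 η)
  start : ∀ σ, ∀ᵐ w ∂(P σ), X 0 w = σ
  martingale_problem : ∀ σ, ∃ ℱ : Filtration ℝ≥0 (inferInstance : MeasurableSpace W),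
    (∀ t, Measurable[ℱ t] (X t)) ∧
    ∀ f : Config → ℝ, IsLocalFunction f →
      Martingale (fun (t : ℝ≥0) w =>
        f (X t w) - ∫ u in (0 : ℝ)..(t : ℝ), generator f (X u.toNNReal w)) ℱ (P σ)

/-! ### Discretisation -/

/-- The half-open box `Λ_{x/N}` of side `1/N` centred at `x/N`. -/
def latticeBox (N : ℕ) (x : ℤ × ℤ) : Set ℂ :=
  {u | -(1 / (2 * (N : ℝ))) ≤ u.re - x.1 / N ∧ u.re - x.1 / N < 1 / (2 * (N : ℝ)) ∧
       -(1 / (2 * (N : ℝ))) ≤ u.im - x.2 / N ∧ u.im - x.2 / N < 1 / (2 * (N : ℝ))}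

/-- `S_N`: the union of the boxes that meet `S`. -/
def discretize (N : ℕ) (S : Set ℂ) : Set ℂ :=
  ⋃ x ∈ {x : ℤ × ℤ | (latticeBox N x ∩ S).Nonempty}, latticeBox N x

/-- `A_N^σ`: the union of the boxes of the plus sites. -/
def plusRegion (N : ℕ) (σ : Config) : Set ℂ :=
  ⋃ x ∈ {x : ℤ × ℤ | σ x = true}, latticeBox N x

open Classical in
/-- The deterministic initial configuration at step `N`: plus exactly at the sites whose box meets
the enclosed domain. -/
def initialConfig (D : Set ℂ) (N : ℕ) : Config :=
  fun x => if (latticeBox N x ∩ D).Nonempty then true else false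

/-! ### The initial volume drift and its average -/

section Drift

variable {W : Type*} [MeasurableSpace W] (X : ℝ≥0 → W → Config) (P : Config → Measure W)

/-- `(1/t) (E_σ vol(A_N^{σ_{tN²}} ∩ S_N) - vol(A_N^σ ∩ S_N))`. -/
def driftQuotient (N : ℕ) (σ : Config) (S : Set ℂ) (t : ℝ) : ℝ :=
  1 / t * ((∫ w, volume.real (plusRegion N (X (t * (N : ℝ) ^ 2).toNNReal w) ∩ discretize N S) ∂(P σ))
    - volume.real (plusRegion N σ ∩ discretize N S))

/-- The limit of `driftQuotient` as `t → 0`, `t > 0`. -/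
def volumeDrift (N : ℕ) (σ : Config) (S : Set ℂ) : ℝ :=
  limUnder (𝓝[>] (0 : ℝ)) (driftQuotient X P N σ S)

/-- `S(s, r, α₁, α₂) = B(s, r) ∪ B(x₀, α₁) ∪ B(x₁, α₂)`, with closed balls. -/
def threeBalls (s x₀ x₁ : ℂ) (r α₁ α₂ : ℝ) : Set ℂ :=
  Metric.closedBall s r ∪ Metric.closedBall x₀ α₁ ∪ Metric.closedBall x₁ α₂

/-- `A_N(s, r, δ)`: the average of the drift in `S(s, r, α₁, α₂)_N` over `α₁, α₂ ∈ [0, δ]`. -/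
def averagedDrift (N : ℕ) (σ : Config) (s x₀ x₁ : ℂ) (r δ : ℝ) : ℝ :=
  1 / δ ^ 2 * ∫ α₁ in (0 : ℝ)..δ, ∫ α₂ in (0 : ℝ)..δ,
    volumeDrift X P N σ (threeBalls s x₀ x₁ r α₁ α₂)

end Drift

/-! ### Jordan curves -/

/-- `γ` is a `T`-periodic regular `C²` parametrisation of a Jordan curve. -/
structure IsC2JordanCurve (γ : ℝ → ℂ) (T : ℝ) : Prop where
  period_pos : 0 < T
  periodic : Function.Periodic γ T
  injOn : InjOn γ (Ico 0 T)
  contDiff : ContDiff ℝ 2 γ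
  regular : ∀ t, deriv γ t ≠ 0

/-- The curve `γ` encloses the compact connected set `D`, with `γ = ∂D`
(the nonempty interior excludes the curve itself), and it runs counterclockwise: `D` lies
immediately to the left of `γ`. -/
structure EnclosesCounterclockwise (γ : ℝ → ℂ) (D : Set ℂ) : Prop where
  isCompact : IsCompact D
  isConnected : IsConnected D
  interior_nonempty : (interior D).Nonempty
  frontier_eq : frontier D = range γ
  left_mem : ∀ t, ∀ᶠ ε : ℝ in 𝓝[>] 0, γ t + ε * (Complex.I * deriv γ t) ∈ interior D

/-- The signed curvature `(x' y'' - x'' y') / (x'² + y'²)^{3/2}` at the parameter `t`. -/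
def curvature (γ : ℝ → ℂ) (t : ℝ) : ℝ :=
  ((deriv γ t).re * (deriv (deriv γ) t).im - (deriv (deriv γ) t).re * (deriv γ t).im)
    / ((deriv γ t).re ^ 2 + (deriv γ t).im ^ 2) ^ (3 / 2 : ℝ)

/-- `θ` is the angle between the horizontal axis and the tangent line of `γ` at the parameter `t`
(so `θ` is determined modulo `π`). -/
def IsTangentAngle (γ : ℝ → ℂ) (t θ : ℝ) : Prop :=
  ∃ c : ℝ, deriv γ t = c * Complex.exp (θ * Complex.I)

/-- The circle `∂B(γ(t), r)` meets the `T`-periodic curve in exactly two points `x₀ ≠ x₁`, and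
`x₀, γ(t), x₁` follow each other in this order along the oriented curve. -/
def IsCrossingPair (γ : ℝ → ℂ) (T t r : ℝ) (x₀ x₁ : ℂ) : Prop :=
  x₀ ≠ x₁ ∧ Metric.sphere (γ t) r ∩ range γ = {x₀, x₁} ∧
    ∃ a b : ℝ, a < t ∧ t < b ∧ b < a + T ∧ γ a = x₀ ∧ γ b = x₁

/-- `lim_{r → 0} lim_{δ → 0} F(r, δ) = c`, with `r, δ > 0`: the inner limit exists in `ℝ` for all
small `r`, and converges to `c`. -/
def HasIteratedLimit (F : ℝ → ℝ → EReal) (c : ℝ) : Prop :=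
  ∃ ℓ : ℝ → ℝ, (∀ᶠ r in 𝓝[>] (0 : ℝ), Tendsto (F r) (𝓝[>] 0) (𝓝 (ℓ r : EReal))) ∧
    Tendsto ℓ (𝓝[>] 0) (𝓝 c)

end

noncomputable section

/-! ### Boxes -/

/-! A flip changes the area by `1/N²` and time is accelerated by `N²`, so the drift of the area in
`S_N` is simply the sum of `flipDrift` over the sites whose box meets `S`. This follows from the
martingale problem and right continuity of the paths. Averaging over the two small radii replaces
the indicator of `S` by a weight `w` that is `1` along the curve inside `B(s, r)` and falls linearly
to `0` over a distance `δ` beyond each crossing point `x₀`, `x₁`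
(`IsGlauberDynamics.averagedDrift_eq`).

Near `s` the boundary of the plus region is the graph of a height `h` over lattice columns. If the
tangent at `s` is strictly within 45 degrees of an axis direction `u`, columns and rows are taken
along `u` and `iu` (`β = 0`), and `h` has steps in `{-1, 0, 1}`. If the tangent is diagonal, the
basis is `u`, `(i - 1)u` (`β = 1`): the columns are then diagonals of the lattice, the interface is
a monotone staircase, the steps of `h` lie in `{0, 1}`, and slope `1/2` is the diagonal direction.
For such interfaces the rates are linear enough that `Σ w · flipDrift` can be summed by parts into
half the sum, over the steps of `h`, of the step times the increment of `w` along it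
(`flipDrift_path_sum`). Where `w` is constant nothing remains, so the drift is carried by the two
ends.

At an end of slope `m` with tangent `V = (1, m)`, the tent covers about `δN/‖V‖` steps. On each of
them `w` changes by the component of the displacement along `V`, divided by `δN`, while the steps of
`h` have mean `m`. The product is a flux independent of `δ` and `N` (`end_flux`). For `β = 0` it is
`m/(1 + m²)`, that is `½ sin 2φ` with `φ` the angle from `u`. For `β = 1` and `m ≤ 1/2` it is again
`½ sin 2φ`. For `m > 1/2` the flat steps are the isolated ones; subtracting `1` from every step
leaves a telescoping sum, and the flux is `1 - ½ sin 2φ`. In every case its derivative in `φ` is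
`|cos 2φ|`, and `φ` differs from `θ` by a multiple of a right angle; this is the origin of the
absolute value.

Hence the averaged drift tends to minus one half of the difference of the fluxes at `x₁` and `x₀`
(`GraphChart.averagedDrift_limit`). Divided by `2r`, this difference becomes the derivative of the
flux along arc length, which is `|cos 2θ|` times the curvature
(`CurveChart.tendsto_crossing_quotient`, `CurveChart.endFlux_curvature`). The charts come from the
inverse function theorem (`exists_curveChart`), and a connectedness argument shows that the enclosed
set is locally an epigraph (`CurveChart.mem_iff`). -/

theorem mem_latticeBox_iff {N : ℕ} (hN : 0 < N) {x : ℤ × ℤ} {z : ℂ} :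
    z ∈ latticeBox N x ↔ ⌊(N : ℝ) * z.re + 1 / 2⌋ = x.1 ∧ ⌊(N : ℝ) * z.im + 1 / 2⌋ = x.2 := by
  have hN' : (0 : ℝ) < N := by exact_mod_cast hN
  have key : ∀ (a : ℝ) (m : ℤ), (-(1 / (2 * (N : ℝ))) ≤ a - m / N ∧ a - m / N < 1 / (2 * (N : ℝ))) ↔
      ⌊(N : ℝ) * a + 1 / 2⌋ = m := by
    intro a m
    rw [Int.floor_eq_iff]
    have e1 : a - m / N = (N * a - m) / N := by field_simp
    have e2 : 1 / (2 * (N : ℝ)) = (1 / 2) / N := by field_simp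
    rw [e1, e2, ← neg_div, div_le_div_iff_of_pos_right hN', div_lt_div_iff_of_pos_right hN']
    constructor <;> rintro ⟨h1, h2⟩ <;> constructor <;> linarith
  rw [← key, ← key]
  simp only [latticeBox, mem_ofPred_eq, and_assoc]

theorem latticeBox_disjoint {N : ℕ} (hN : 0 < N) {x y : ℤ × ℤ} (hxy : x ≠ y) :
    Disjoint (latticeBox N x) (latticeBox N y) := by
  rw [Set.disjoint_left]
  intro z hx hy
  rw [mem_latticeBox_iff hN] at hx hy
  exact hxy (Prod.ext (hx.1.symm.trans hy.1) (hx.2.symm.trans hy.2))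

theorem latticeBox_eq_preimage (N : ℕ) (x : ℤ × ℤ) :
    latticeBox N x = Complex.measurableEquivRealProd ⁻¹'
      (Ico ((x.1 : ℝ) / N - 1 / (2 * N)) (x.1 / N + 1 / (2 * N)) ×ˢ
        Ico ((x.2 : ℝ) / N - 1 / (2 * N)) (x.2 / N + 1 / (2 * N))) := by
  ext z
  simp only [latticeBox, mem_ofPred_eq, mem_preimage, Complex.measurableEquivRealProd_apply, mem_prod,
    mem_Ico]
  constructor
  · rintro ⟨h1, h2, h3, h4⟩
    exact ⟨⟨by linarith, by linarith⟩, by linarith, by linarith⟩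
  · rintro ⟨⟨h1, h2⟩, h3, h4⟩
    exact ⟨by linarith, by linarith, by linarith, by linarith⟩

theorem measurableSet_latticeBox (N : ℕ) (x : ℤ × ℤ) : MeasurableSet (latticeBox N x) := by
  rw [latticeBox_eq_preimage]
  exact Complex.measurableEquivRealProd.measurable (measurableSet_Ico.prod measurableSet_Ico)

theorem volume_latticeBox {N : ℕ} (hN : 0 < N) (x : ℤ × ℤ) :
    volume (latticeBox N x) = ENNReal.ofReal (1 / (N : ℝ) ^ 2) := by
  have hN' : (0 : ℝ) < N := by exact_mod_cast hN
  rw [latticeBox_eq_preimage, Complex.volume_preserving_equiv_real_prod.measure_preimage_equiv,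
    Measure.volume_eq_prod, Measure.prod_prod, Real.volume_Ico, Real.volume_Ico,
    ← ENNReal.ofReal_mul (by ring_nf; positivity)]
  congr 1
  field_simp
  ring

theorem finite_setOf_latticeBox_inter {N : ℕ} (hN : 0 < N) {S : Set ℂ}
    (hS : Bornology.IsBounded S) : {x : ℤ × ℤ | (latticeBox N x ∩ S).Nonempty}.Finite := by
  obtain ⟨R, hR⟩ := hS.exists_norm_le
  have hN' : (0 : ℝ) < N := by exact_mod_cast hN
  refine ((Set.finite_Icc (-(⌈N * R + 1⌉)) ⌈N * R + 1⌉).prod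
    (Set.finite_Icc (-(⌈N * R + 1⌉)) ⌈N * R + 1⌉)).subset ?_
  rintro x ⟨z, hz, hzS⟩
  rw [mem_latticeBox_iff hN] at hz
  have hzR := hR z hzS
  have key : ∀ (a : ℝ) (m : ℤ), |a| ≤ ‖z‖ → ⌊(N : ℝ) * a + 1 / 2⌋ = m →
      m ∈ Icc (-(⌈N * R + 1⌉)) ⌈N * R + 1⌉ := by
    intro a m ha hm
    have h1 := Int.le_ceil ((N : ℝ) * R + 1)
    rw [Int.floor_eq_iff] at hm
    have h2 := abs_le.1 (ha.trans hzR)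
    have h3 : (N : ℝ) * a ≤ N * R := by gcongr; exact h2.2
    have h4 : (N : ℝ) * (-R) ≤ N * a := by gcongr; exact h2.1
    constructor
    · have : -((⌈(N : ℝ) * R + 1⌉ : ℤ) : ℝ) ≤ m := by linarith [hm.2]
      exact_mod_cast this
    · have : (m : ℝ) ≤ (⌈(N : ℝ) * R + 1⌉ : ℤ) := by linarith [hm.1]
      exact_mod_cast this
  exact ⟨key _ _ (Complex.abs_re_le_norm z) hz.1, key _ _ (Complex.abs_im_le_norm z) hz.2⟩

/-! ### Volume drift of the dynamics -/

/-- The rate at which the flip at `x` changes the number of plus sites. -/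
def flipDrift (σ : Config) (x : ℤ × ℤ) : ℝ := flipRate x σ * (if σ x then -1 else 1)

theorem volume_plusRegion_inter {N : ℕ} (hN : 0 < N) (σ : Config) {S : Set ℂ}
    {F : Finset (ℤ × ℤ)} (hF : ∀ x, x ∈ F ↔ (latticeBox N x ∩ S).Nonempty) :
    volume.real (plusRegion N σ ∩ discretize N S) =
      ∑ x ∈ F, if σ x then 1 / (N : ℝ) ^ 2 else 0 := by
  have h : plusRegion N σ ∩ discretize N S =
      ⋃ x ∈ F.filter (fun x => σ x = true), latticeBox N x := by
    ext z
    simp only [plusRegion, discretize, mem_inter_iff, mem_iUnion, mem_ofPred_eq, exists_prop,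
      Finset.mem_filter, hF]
    constructor
    · rintro ⟨⟨x, hx, hzx⟩, y, hy, hzy⟩
      obtain rfl : x = y := by
        by_contra hne
        exact Set.disjoint_left.1 (latticeBox_disjoint hN hne) hzx hzy
      exact ⟨x, ⟨hy, hx⟩, hzx⟩
    · rintro ⟨x, ⟨hx, hx'⟩, hz⟩
      exact ⟨⟨x, hx', hz⟩, x, hx, hz⟩
  rw [h, measureReal_def, measure_biUnion_finset (fun x _ y _ hxy => latticeBox_disjoint hN hxy)
    (fun x _ => measurableSet_latticeBox N x), ENNReal.toReal_sum, Finset.sum_filter]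
  · refine Finset.sum_congr rfl fun x _ => ?_
    rw [volume_latticeBox hN, ENNReal.toReal_ofReal (by positivity)]
  · intro x _
    rw [volume_latticeBox hN]
    exact ENNReal.ofReal_ne_top

theorem dependsOn_oppositeCount {σ η : Config} {x : ℤ × ℤ} (hx : σ x = η x)
    (h : ∀ y ∈ neighbours x, σ y = η y) : oppositeCount σ x = oppositeCount η x := by
  unfold oppositeCount
  congr 1
  refine Finset.filter_congr fun y hy => ?_
  rw [h y hy, hx]

theorem flipDrift_congr {σ η : Config} {x : ℤ × ℤ} (hx : σ x = η x)
    (h : ∀ y ∈ neighbours x, σ y = η y) : flipDrift σ x = flipDrift η x := by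
  unfold flipDrift flipRate
  rw [dependsOn_oppositeCount hx h, hx]

theorem abs_flipDrift_le (σ : Config) (x : ℤ × ℤ) : |flipDrift σ x| ≤ 1 := by
  unfold flipDrift flipRate
  split_ifs <;> norm_num [abs_le]

theorem generator_count (F : Finset (ℤ × ℤ)) (c : ℝ) (σ : Config) :
    generator (fun η => ∑ x ∈ F, if η x then c else 0) σ = c * ∑ x ∈ F, flipDrift σ x := by
  have key : ∀ x, (∑ y ∈ F, if flipAt σ x y then c else 0) - (∑ y ∈ F, if σ y then c else 0) =
      if x ∈ F then c * (if σ x then -1 else 1) else 0 := by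
    intro x
    rw [← Finset.sum_sub_distrib, ← Finset.sum_ite_eq F x (fun x => c * (if σ x then (-1 : ℝ) else 1))]
    refine Finset.sum_congr rfl fun y _ => ?_
    by_cases hxy : x = y
    · subst hxy
      by_cases h : σ x <;> simp [flipAt, h]
    · simp [flipAt, Function.update_of_ne (Ne.symm hxy), hxy]
  unfold generator
  simp only [key]
  rw [finsum_eq_sum_of_support_subset (s := F)]
  · rw [Finset.mul_sum]
    refine Finset.sum_congr rfl fun x hx => ?_
    rw [if_pos hx, flipDrift]
    ring
  · intro x hx
    by_contra hxF
    simp [Finset.mem_coe.not.1 hxF] at hx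

section Dynamics

variable {W : Type*} [MeasurableSpace W] {X : ℝ≥0 → W → Config} {P : Config → Measure W}

theorem eventually_eq_of_right_continuous {Y : ℝ≥0 → Config} {t : ℝ≥0}
    (hY : ContinuousWithinAt Y (Ici t) t) (x : ℤ × ℤ) : ∀ᶠ u in 𝓝[≥] t, Y u x = Y t x := by
  have h1 : Tendsto (fun u => Y u x) (𝓝[≥] t) (𝓝 (Y t x)) :=
    ((continuous_apply x).tendsto (Y t)).comp hY
  rw [nhds_discrete, tendsto_pure] at h1
  exact h1

/-- The drift of a count of plus sites. -/
theorem IsGlauberDynamics.tendsto_count (hX : IsGlauberDynamics X P) (σ : Config)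
    (F : Finset (ℤ × ℤ)) :
    Tendsto (fun t : ℝ => 1 / t * ((∫ w, ∑ x ∈ F, (if X t.toNNReal w x then (1 : ℝ) else 0) ∂(P σ))
      - ∑ x ∈ F, if σ x then (1 : ℝ) else 0)) (𝓝[>] 0) (𝓝 (∑ x ∈ F, flipDrift σ x)) := by
  classical
  set f : Config → ℝ := fun η => ∑ x ∈ F, if η x then (1 : ℝ) else 0 with hf
  set Lf : Config → ℝ := fun η => ∑ x ∈ F, flipDrift η x with hLf
  have hgen : ∀ η, generator f η = Lf η := fun η => by rw [hf, generator_count, one_mul]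
  have := hX.isProbabilityMeasure σ
  obtain ⟨ℱ, hmeas, hmart⟩ := hX.martingale_problem σ
  have hloc : IsLocalFunction f := ⟨F, fun η ζ h => by
    refine Finset.sum_congr rfl fun x hx => ?_
    rw [h x hx]⟩
  have hM := hmart f hloc
  simp only [hgen] at hM
  have hfm : Measurable f := by
    refine Finset.measurable_sum _ fun x _ => ?_
    exact Measurable.ite (measurableSet_eq_fun (measurable_pi_apply x) measurable_const) measurable_const
      measurable_const
  have hfX : ∀ t, Measurable fun w => f (X t w) := fun t =>
    hfm.comp ((hmeas t).mono (ℱ.le t) le_rfl)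
  have hfb : ∀ η, |f η| ≤ F.card := by
    intro η
    refine (Finset.abs_sum_le_sum_abs _ _).trans ?_
    refine (Finset.sum_le_card_nsmul F _ 1 fun x _ => ?_).trans (by simp)
    split_ifs <;> simp
  have hLfb : ∀ η, |Lf η| ≤ F.card := by
    intro η
    refine (Finset.abs_sum_le_sum_abs _ _).trans ?_
    exact (Finset.sum_le_card_nsmul F _ 1 fun x _ => abs_flipDrift_le η x).trans (by simp)
  have hfint : ∀ t, Integrable (fun w => f (X t w)) (P σ) := fun t =>
    Integrable.of_bound (hfX t).aestronglyMeasurable (F.card : ℝ)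
      (Eventually.of_forall fun w => hfb _)
  -- The time integral is the difference of two integrable functions, `f (X t)` and the martingale.
  -- This avoids any joint measurability of the process in time and `w`.
  have hIint : ∀ t : ℝ≥0, Integrable (fun w => ∫ u in (0 : ℝ)..(t : ℝ), Lf (X u.toNNReal w)) (P σ) := by
    intro t
    have := (hfint t).sub (hM.integrable t)
    refine this.congr (Eventually.of_forall fun w => ?_)
    simp
  -- Dynkin's formula: the martingale has the same expectation at times `0` and `t`.
  have hE : ∀ t : ℝ≥0, ∫ w, f (X t w) ∂(P σ) =
      f σ + ∫ w, (∫ u in (0 : ℝ)..(t : ℝ), Lf (X u.toNNReal w)) ∂(P σ) := by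
    intro t
    have h1 := hM.setIntegral_eq (zero_le (a := t)) (s := univ) MeasurableSet.univ
    simp only [setIntegral_univ] at h1
    rw [integral_sub (hfint t) (hIint t)] at h1
    have h2 : ∫ w, (f (X 0 w) - ∫ u in (0 : ℝ)..((0 : ℝ≥0) : ℝ), Lf (X u.toNNReal w)) ∂(P σ) = f σ := by
      rw [integral_congr_ae (g := fun _ => f σ)]
      · simp
      · filter_upwards [hX.start σ] with w hw
        simp [hw]
    rw [h2] at h1
    linarith
  have hlim : Tendsto (fun t : ℝ => ∫ w, (1 / t * ∫ u in (0 : ℝ)..t, Lf (X u.toNNReal w)) ∂(P σ))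
      (𝓝[>] 0) (𝓝 (∫ _, Lf σ ∂(P σ))) := by
    refine tendsto_integral_filter_of_dominated_convergence (fun _ => (F.card : ℝ)) ?_ ?_
      (integrable_const _) ?_
    · filter_upwards [self_mem_nhdsWithin] with t ht
      have := (hIint t.toNNReal).aestronglyMeasurable.const_mul (1 / t)
      rwa [Real.coe_toNNReal t (le_of_lt ht)] at this
    · filter_upwards [self_mem_nhdsWithin] with t (ht : 0 < t)
      refine Eventually.of_forall fun w => ?_
      have h := intervalIntegral.norm_integral_le_of_norm_le_const (a := 0) (b := t)
        (f := fun u => Lf (X u.toNNReal w)) (C := F.card) (fun u _ => hLfb _)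
      rw [norm_mul, Real.norm_eq_abs, abs_of_pos (by positivity : 0 < 1 / t)]
      rw [sub_zero, abs_of_pos ht] at h
      calc 1 / t * ‖∫ u in (0 : ℝ)..t, Lf (X u.toNNReal w)‖ ≤ 1 / t * (F.card * t) := by gcongr
        _ = F.card := by field_simp
    · filter_upwards [hX.start σ] with w hw
      -- `Lf` reads finitely many spins, namely those of `F` and of its neighbours. By right
      -- continuity each of them is frozen for a short random time, so the time average is
      -- eventually equal to `Lf σ`.
      have hev : ∀ᶠ u in 𝓝[≥] (0 : ℝ≥0), Lf (X u w) = Lf σ := by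
        have h1 : ∀ᶠ u in 𝓝[≥] (0 : ℝ≥0), ∀ x ∈ F ∪ F.biUnion neighbours, X u w x = X 0 w x := by
          rw [Filter.eventually_all_finset]
          exact fun x _ => eventually_eq_of_right_continuous (hX.right_continuous w 0) x
        filter_upwards [h1] with u hu
        rw [← hw]
        refine Finset.sum_congr rfl fun x hx => flipDrift_congr ?_ ?_
        · exact hu x (Finset.mem_union_left _ hx)
        · exact fun y hy => hu y (Finset.mem_union_right _ (Finset.mem_biUnion.2 ⟨x, hx, hy⟩))
      have hIci : (Ici (0 : ℝ≥0)) = univ := by ext; simp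
      rw [hIci, nhdsWithin_univ] at hev
      have hev2 : ∀ᶠ u in 𝓝 (0 : ℝ), Lf (X u.toNNReal w) = Lf σ := by
        have : Tendsto Real.toNNReal (𝓝 0) (𝓝 0) := by
          simpa using (continuous_real_toNNReal.tendsto (0 : ℝ))
        exact this.eventually hev
      obtain ⟨ε, hε, hball⟩ := Metric.eventually_nhds_iff.1 hev2
      refine Tendsto.congr' ?_ tendsto_const_nhds
      have : Ioo (0 : ℝ) ε ∈ 𝓝[>] (0 : ℝ) := Ioo_mem_nhdsGT hε
      filter_upwards [this] with t ht
      have h3 : ∫ u in (0 : ℝ)..t, Lf (X u.toNNReal w) = ∫ u in (0 : ℝ)..t, Lf σ := by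
        refine intervalIntegral.integral_congr fun u hu => ?_
        rw [uIcc_of_le ht.1.le] at hu
        refine hball ?_
        rw [Real.dist_eq, sub_zero, abs_of_nonneg hu.1]
        exact hu.2.trans_lt ht.2
      rw [h3, intervalIntegral.integral_const]
      have := ht.1.ne'
      simp only [sub_zero, smul_eq_mul]
      field_simp
  simp only [integral_const, smul_eq_mul, probReal_univ, one_mul] at hlim
  refine hlim.congr' ?_
  filter_upwards [self_mem_nhdsWithin] with t (ht : 0 < t)
  rw [integral_const_mul, hE t.toNNReal, Real.coe_toNNReal t ht.le]
  ring

/-- The factor `N²` from the acceleration of time cancels the area `1/N²` of a box, so no power of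
`N` survives in the limit. -/
theorem IsGlauberDynamics.tendsto_driftQuotient (hX : IsGlauberDynamics X P) {N : ℕ} (hN : 0 < N)
    (σ : Config) {S : Set ℂ} {F : Finset (ℤ × ℤ)}
    (hF : ∀ x, x ∈ F ↔ (latticeBox N x ∩ S).Nonempty) :
    Tendsto (driftQuotient X P N σ S) (𝓝[>] 0) (𝓝 (∑ x ∈ F, flipDrift σ x)) := by
  have hN' : (0 : ℝ) < N := by exact_mod_cast hN
  have hscale : Tendsto (fun t : ℝ => t * (N : ℝ) ^ 2) (𝓝[>] 0) (𝓝[>] 0) := by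
    refine tendsto_nhdsWithin_iff.2 ⟨?_, ?_⟩
    · have : Tendsto (fun t : ℝ => t * (N : ℝ) ^ 2) (𝓝 0) (𝓝 (0 * (N : ℝ) ^ 2)) :=
        (continuous_id.mul continuous_const).tendsto 0
      rw [zero_mul] at this
      exact this.mono_left nhdsWithin_le_nhds
    · filter_upwards [self_mem_nhdsWithin] with t (ht : 0 < t)
      exact mul_pos ht (by positivity)
  refine ((hX.tendsto_count σ F).comp hscale).congr fun t => ?_
  have hsum : ∀ η : Config, volume.real (plusRegion N η ∩ discretize N S) =
      (1 / (N : ℝ) ^ 2) * ∑ x ∈ F, if η x then (1 : ℝ) else 0 := by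
    intro η
    rw [volume_plusRegion_inter hN η hF, Finset.mul_sum]
    refine Finset.sum_congr rfl fun x _ => ?_
    split_ifs <;> simp
  simp only [driftQuotient, hsum, integral_const_mul, Function.comp]
  rcases eq_or_ne t 0 with rfl | ht
  · simp
  · field_simp

theorem IsGlauberDynamics.volumeDrift_eq (hX : IsGlauberDynamics X P) {N : ℕ} (hN : 0 < N)
    (σ : Config) {S : Set ℂ} {F : Finset (ℤ × ℤ)}
    (hF : ∀ x, x ∈ F ↔ (latticeBox N x ∩ S).Nonempty) :
    volumeDrift X P N σ S = ∑ x ∈ F, flipDrift σ x :=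
  (hX.tendsto_driftQuotient hN σ hF).limUnder_eq

end Dynamics

/-! ### Averaging over the two radii -/

open Classical in
/-- The indicator of the event that the box at `x` meets `S`. -/
def meets (N : ℕ) (S : Set ℂ) (x : ℤ × ℤ) : ℝ := if (latticeBox N x ∩ S).Nonempty then 1 else 0

/-- The tent function of height `1` and radius `δ` around `z`, evaluated at the box of `x`. -/
def tent (N : ℕ) (z : ℂ) (δ : ℝ) (x : ℤ × ℤ) : ℝ :=
  max 0 (1 - Metric.infDist z (latticeBox N x) / δ)

/-- The proportion of radii `α₁, α₂ ∈ [0, δ]` for which the box at `x` meets the three balls. -/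
def averageWeight (N : ℕ) (s x₀ x₁ : ℂ) (r δ : ℝ) (x : ℤ × ℤ) : ℝ :=
  1 - (1 - meets N (Metric.closedBall s r) x) * (1 - tent N x₀ δ x) * (1 - tent N x₁ δ x)

theorem meets_threeBalls (N : ℕ) (s x₀ x₁ : ℂ) (r α₁ α₂ : ℝ) (x : ℤ × ℤ) :
    meets N (threeBalls s x₀ x₁ r α₁ α₂) x =
      1 - (1 - meets N (Metric.closedBall s r) x) * (1 - meets N (Metric.closedBall x₀ α₁) x) *
        (1 - meets N (Metric.closedBall x₁ α₂) x) := by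
  have key : (latticeBox N x ∩ threeBalls s x₀ x₁ r α₁ α₂).Nonempty ↔
      ((latticeBox N x ∩ Metric.closedBall s r).Nonempty ∨
        (latticeBox N x ∩ Metric.closedBall x₀ α₁).Nonempty) ∨
        (latticeBox N x ∩ Metric.closedBall x₁ α₂).Nonempty := by
    rw [threeBalls, inter_union_distrib_left, inter_union_distrib_left, Set.union_nonempty,
      Set.union_nonempty]
  unfold meets
  split_ifs <;> first | (simp; done) | (exfalso; tauto)

theorem latticeBox_nonempty {N : ℕ} (hN : 0 < N) (x : ℤ × ℤ) : (latticeBox N x).Nonempty := by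
  have hN' : (0 : ℝ) < N := by exact_mod_cast hN
  refine ⟨⟨x.1 / N, x.2 / N⟩, ?_⟩
  have : (0 : ℝ) < 1 / (2 * N) := by positivity
  simp only [latticeBox, mem_ofPred_eq, sub_self]
  exact ⟨by linarith, this, by linarith, this⟩

theorem monotone_meets_closedBall (N : ℕ) (z : ℂ) (x : ℤ × ℤ) :
    Monotone fun α : ℝ => meets N (Metric.closedBall z α) x := by
  intro α β hαβ
  simp only [meets]
  split_ifs with h1 h2
  · rfl
  · exact absurd (h1.mono (inter_subset_inter_right _ (Metric.closedBall_subset_closedBall hαβ))) h2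
  · norm_num
  · rfl

theorem integral_one_sub_meets {N : ℕ} (hN : 0 < N) (z : ℂ) {δ : ℝ} (hδ : 0 < δ) (x : ℤ × ℤ) :
    ∫ α in (0 : ℝ)..δ, (1 - meets N (Metric.closedBall z α) x) = δ * (1 - tent N z δ x) := by
  set D := Metric.infDist z (latticeBox N x) with hD
  have hD0 : 0 ≤ D := Metric.infDist_nonneg
  -- The half-open box need not attain its distance `D` to `z`, so the single radius `α = D` is
  -- undecided. It is a null set.
  have hae : ∀ᵐ α : ℝ, α ∈ uIoc 0 δ →
      (1 - meets N (Metric.closedBall z α) x) = indicator (Iio D) (fun _ => (1 : ℝ)) α := by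
    have : ∀ᵐ α : ℝ, α ≠ D := by simp [ae_iff, measure_singleton]
    filter_upwards [this] with α hα _
    rcases lt_or_gt_of_ne hα with h | h
    · rw [indicator_of_mem (show α ∈ Iio D from h), meets, if_neg, sub_zero]
      rintro ⟨y, hy, hyα⟩
      rw [Metric.mem_closedBall, dist_comm] at hyα
      exact absurd (Metric.infDist_le_dist_of_mem (x := z) hy) (by linarith)
    · rw [indicator_of_notMem (by simpa using h.le), meets, if_pos, sub_self]
      obtain ⟨y, hy, hyα⟩ := (Metric.infDist_lt_iff (latticeBox_nonempty hN x)).1 h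
      exact ⟨y, hy, by rw [Metric.mem_closedBall, dist_comm]; exact hyα.le⟩
  rw [intervalIntegral.integral_congr_ae hae, intervalIntegral.integral_of_le hδ.le,
    setIntegral_indicator measurableSet_Iio, setIntegral_const, smul_eq_mul, mul_one, tent, ← hD]
  rcases le_or_gt D δ with h | h
  · have : Ioc 0 δ ∩ Iio D = Ioo 0 D := by
      ext y; simp only [mem_inter_iff, mem_Ioc, mem_Iio, mem_Ioo]
      exact ⟨fun h => ⟨h.1.1, h.2⟩, fun h' => ⟨⟨h'.1, h'.2.le.trans h⟩, h'.2⟩⟩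
    rw [this, Real.volume_real_Ioo_of_le hD0, max_eq_right]
    · field_simp; ring
    · rw [sub_nonneg, div_le_one hδ]; exact h
  · have : Ioc 0 δ ∩ Iio D = Ioc 0 δ := by
      rw [inter_eq_left]; intro y hy; exact hy.2.trans_lt h
    rw [this, Real.volume_real_Ioc_of_le hδ.le, max_eq_left]
    · ring
    · rw [sub_nonpos, one_le_div hδ]; exact h.le

section Average

variable {W : Type*} [MeasurableSpace W] {X : ℝ≥0 → W → Config} {P : Config → Measure W}

theorem isBounded_threeBalls (s x₀ x₁ : ℂ) (r α₁ α₂ : ℝ) :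
    Bornology.IsBounded (threeBalls s x₀ x₁ r α₁ α₂) :=
  (Metric.isBounded_closedBall.union Metric.isBounded_closedBall).union Metric.isBounded_closedBall

theorem threeBalls_mono {s x₀ x₁ : ℂ} {r α₁ α₂ β₁ β₂ : ℝ} (h₁ : α₁ ≤ β₁) (h₂ : α₂ ≤ β₂) :
    threeBalls s x₀ x₁ r α₁ α₂ ⊆ threeBalls s x₀ x₁ r β₁ β₂ :=
  union_subset_union (union_subset_union_right _ (Metric.closedBall_subset_closedBall h₁))
    (Metric.closedBall_subset_closedBall h₂)

/-- The index set `F` does not depend on the radii, which is what allows the integrals over them to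
be exchanged with the sum. -/
theorem IsGlauberDynamics.volumeDrift_threeBalls (hX : IsGlauberDynamics X P) {N : ℕ} (hN : 0 < N)
    (σ : Config) (s x₀ x₁ : ℂ) (r : ℝ) {δ α₁ α₂ : ℝ} (h₁ : α₁ ≤ δ) (h₂ : α₂ ≤ δ)
    {F : Finset (ℤ × ℤ)}
    (hF : ∀ x, (latticeBox N x ∩ threeBalls s x₀ x₁ r δ δ).Nonempty → x ∈ F) :
    volumeDrift X P N σ (threeBalls s x₀ x₁ r α₁ α₂) =
      ∑ x ∈ F, flipDrift σ x * (1 - (1 - meets N (Metric.closedBall s r) x) *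
        (1 - meets N (Metric.closedBall x₀ α₁) x) * (1 - meets N (Metric.closedBall x₁ α₂) x)) := by
  classical
  rw [hX.volumeDrift_eq hN σ
    (F := F.filter fun x => (latticeBox N x ∩ threeBalls s x₀ x₁ r α₁ α₂).Nonempty), Finset.sum_filter]
  · refine Finset.sum_congr rfl fun x _ => ?_
    rw [← meets_threeBalls, meets]
    split_ifs <;> simp
  · intro x
    rw [Finset.mem_filter, and_iff_right_iff_imp]
    exact fun h => hF x (h.mono (inter_subset_inter_right _ (threeBalls_mono h₁ h₂)))

/-- The complement of the indicator of the three balls is a product with one factor for each radius,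
so each integration acts on its own factor and turns an indicator into a tent. -/
theorem IsGlauberDynamics.averagedDrift_eq (hX : IsGlauberDynamics X P) {N : ℕ} (hN : 0 < N)
    (σ : Config) (s x₀ x₁ : ℂ) (r : ℝ) {δ : ℝ} (hδ : 0 < δ) {F : Finset (ℤ × ℤ)}
    (hF : ∀ x, (latticeBox N x ∩ threeBalls s x₀ x₁ r δ δ).Nonempty → x ∈ F) :
    averagedDrift X P N σ s x₀ x₁ r δ =
      ∑ x ∈ F, averageWeight N s x₀ x₁ r δ x * flipDrift σ x := by
  have hint : ∀ (z : ℂ) (x : ℤ × ℤ),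
      IntervalIntegrable (fun α => 1 - meets N (Metric.closedBall z α) x) volume 0 δ := fun z x =>
    intervalIntegrable_const.sub (monotone_meets_closedBall N z x).intervalIntegrable
  have hinner : ∀ α₁ ∈ uIcc 0 δ, ∫ α₂ in (0 : ℝ)..δ,
      volumeDrift X P N σ (threeBalls s x₀ x₁ r α₁ α₂) =
      ∑ x ∈ F, flipDrift σ x * (δ - (1 - meets N (Metric.closedBall s r) x) *
        (1 - meets N (Metric.closedBall x₀ α₁) x) * (δ * (1 - tent N x₁ δ x))) := by
    intro α₁ h₁
    rw [uIcc_of_le hδ.le] at h₁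
    rw [intervalIntegral.integral_congr (g := fun α₂ => ∑ x ∈ F, flipDrift σ x *
      (1 - (1 - meets N (Metric.closedBall s r) x) *
        (1 - meets N (Metric.closedBall x₀ α₁) x) * (1 - meets N (Metric.closedBall x₁ α₂) x)))]
    · rw [intervalIntegral.integral_finsetSum]
      · refine Finset.sum_congr rfl fun x _ => ?_
        rw [intervalIntegral.integral_const_mul, intervalIntegral.integral_sub intervalIntegrable_const
          ((hint x₁ x).const_mul _), intervalIntegral.integral_const_mul, integral_one_sub_meets hN x₁ hδ]
        simp
      · exact fun x _ => (intervalIntegrable_const.sub ((hint x₁ x).const_mul _)).const_mul _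
    · intro α₂ h₂
      rw [uIcc_of_le hδ.le] at h₂
      exact hX.volumeDrift_threeBalls hN σ s x₀ x₁ r h₁.2 h₂.2 hF
  rw [averagedDrift, intervalIntegral.integral_congr hinner, intervalIntegral.integral_finsetSum,
    Finset.mul_sum]
  · refine Finset.sum_congr rfl fun x _ => ?_
    have : ∀ α, flipDrift σ x * (δ - (1 - meets N (Metric.closedBall s r) x) *
        (1 - meets N (Metric.closedBall x₀ α) x) * (δ * (1 - tent N x₁ δ x))) =
        flipDrift σ x * δ - (flipDrift σ x * (1 - meets N (Metric.closedBall s r) x) *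
          (δ * (1 - tent N x₁ δ x))) * (1 - meets N (Metric.closedBall x₀ α) x) := fun α => by ring
    simp only [this]
    rw [intervalIntegral.integral_sub intervalIntegrable_const ((hint x₀ x).const_mul _),
      intervalIntegral.integral_const, intervalIntegral.integral_const_mul,
      integral_one_sub_meets hN x₀ hδ, averageWeight, smul_eq_mul]
    field_simp
    ring
  · intro x _
    refine (intervalIntegrable_const.sub ?_).const_mul _
    exact ((hint x₀ x).const_mul _).mul_const _

theorem IsGlauberDynamics.integrableOn_volumeDrift (hX : IsGlauberDynamics X P) {N : ℕ} (hN : 0 < N)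
    (σ : Config) (s x₀ x₁ : ℂ) (r δ : ℝ) :
    IntegrableOn (fun α : ℝ × ℝ => volumeDrift X P N σ (threeBalls s x₀ x₁ r α.1 α.2))
      (Icc 0 δ ×ˢ Icc 0 δ) := by
  set F := (finite_setOf_latticeBox_inter hN (isBounded_threeBalls s x₀ x₁ r δ δ)).toFinset
  have hF : ∀ x, (latticeBox N x ∩ threeBalls s x₀ x₁ r δ δ).Nonempty → x ∈ F := by
    intro x hx; simpa [F] using hx
  -- Monotonicity in the radius gives measurability of each factor, hence joint measurability in the
  -- two radii.
  have hmeas : ∀ (z : ℂ) (x : ℤ × ℤ), Measurable fun α : ℝ => meets N (Metric.closedBall z α) x :=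
    fun z x => (monotone_meets_closedBall N z x).measurable
  have hb : ∀ (S : Set ℂ) x, |1 - meets N S x| ≤ 1 := by
    intro S x; unfold meets; split_ifs <;> simp
  have hbounded : Bornology.IsBounded (Icc 0 δ ×ˢ Icc 0 δ : Set (ℝ × ℝ)) :=
    (Metric.isBounded_Icc 0 δ).prod (Metric.isBounded_Icc 0 δ)
  have hfin : volume (Icc 0 δ ×ˢ Icc 0 δ : Set (ℝ × ℝ)) < ⊤ := hbounded.measure_lt_top
  refine IntegrableOn.congr_fun (f := fun α : ℝ × ℝ => ∑ x ∈ F, flipDrift σ x *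
      (1 - (1 - meets N (Metric.closedBall s r) x) *
        (1 - meets N (Metric.closedBall x₀ α.1) x) * (1 - meets N (Metric.closedBall x₁ α.2) x))) ?_
    (fun α hα => (hX.volumeDrift_threeBalls hN σ s x₀ x₁ r hα.1.2 hα.2.2 hF).symm)
    (measurableSet_Icc.prod measurableSet_Icc)
  refine integrable_finsetSum _ fun x _ => Integrable.const_mul (Integrable.sub ?_ ?_) _
  · exact integrableOn_const hfin.ne
  · refine Measure.integrableOn_of_bounded (M := 1) hfin.ne ?_ ?_
    · refine Measurable.aestronglyMeasurable ?_
      exact ((measurable_const).mul (measurable_const.sub ((hmeas x₀ x).comp measurable_fst))).mul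
        (measurable_const.sub ((hmeas x₁ x).comp measurable_snd))
    · refine Eventually.of_forall fun α => ?_
      rw [Real.norm_eq_abs, abs_mul, abs_mul]
      exact mul_le_one₀ (mul_le_one₀ (hb _ _) (abs_nonneg _) (hb _ _)) (abs_nonneg _) (hb _ _)

end Average

/-! ### Interfaces in lattice charts -/

/-- The lattice point with coordinates `n`, `a` in the basis `u`, `(i - β) u` of the Gaussian
integers. -/
def site (u : ℤ × ℤ) (β : ℤ) (n a : ℤ) : ℤ × ℤ :=
  ((n - β * a) * u.1 - a * u.2, (n - β * a) * u.2 + a * u.1)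

/-- The four units of the Gaussian integers. -/
def IsUnitVector (u : ℤ × ℤ) : Prop := u = (1, 0) ∨ u = (0, 1) ∨ u = (-1, 0) ∨ u = (0, -1)

theorem IsUnitVector.sq {u : ℤ × ℤ} (hu : IsUnitVector u) : u.1 ^ 2 + u.2 ^ 2 = 1 := by
  rcases hu with rfl | rfl | rfl | rfl <;> simp

theorem IsUnitVector.site_injective {u : ℤ × ℤ} (hu : IsUnitVector u) (β : ℤ) :
    Function.Injective fun q : ℤ × ℤ => site u β q.1 q.2 := by
  rintro ⟨n, a⟩ ⟨m, b⟩ h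
  rcases hu with rfl | rfl | rfl | rfl <;> simp [site] at h <;> obtain ⟨h1, h2⟩ := h <;>
    subst_vars <;> simp_all

theorem IsUnitVector.exists_site_eq {u : ℤ × ℤ} (hu : IsUnitVector u) (β : ℤ) (x : ℤ × ℤ) :
    ∃ n a, site u β n a = x := by
  have h := hu.sq
  refine ⟨x.1 * u.1 + x.2 * u.2 + β * (x.2 * u.1 - x.1 * u.2), x.2 * u.1 - x.1 * u.2, ?_⟩
  ext
  · simp only [site]
    linear_combination x.1 * h
  · simp only [site]
    linear_combination x.2 * h

theorem oppositeCount_eq_sum (σ : Config) (x : ℤ × ℤ) :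
    oppositeCount σ x = (if σ (x.1 + 1, x.2) ≠ σ x then 1 else 0) +
      (if σ (x.1 - 1, x.2) ≠ σ x then 1 else 0) + (if σ (x.1, x.2 + 1) ≠ σ x then 1 else 0) +
      (if σ (x.1, x.2 - 1) ≠ σ x then 1 else 0) := by
  unfold oppositeCount neighbours
  rw [Finset.card_filter, Finset.sum_insert, Finset.sum_insert, Finset.sum_insert,
    Finset.sum_singleton]
  · ring
  · simp; omega
  · simp
  · simp; omega

/-- Adding `iu` to a site moves its coordinates by `(β, 1)`. For `β = 1` all four neighbours
therefore lie in the two adjacent columns. -/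
theorem oppositeCount_site (σ : Config) {u : ℤ × ℤ} (hu : IsUnitVector u) (β n a : ℤ) :
    oppositeCount σ (site u β n a) =
      (if σ (site u β (n + 1) a) ≠ σ (site u β n a) then 1 else 0) +
      (if σ (site u β (n - 1) a) ≠ σ (site u β n a) then 1 else 0) +
      (if σ (site u β (n + β) (a + 1)) ≠ σ (site u β n a) then 1 else 0) +
      (if σ (site u β (n - β) (a - 1)) ≠ σ (site u β n a) then 1 else 0) := by
  rw [oppositeCount_eq_sum]
  rcases hu with rfl | rfl | rfl | rfl
  · rw [show site (1, 0) β (n + 1) a = ((site (1, 0) β n a).1 + 1, (site (1, 0) β n a).2) by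
        ext <;> simp only [site] <;> ring,
      show site (1, 0) β (n - 1) a = ((site (1, 0) β n a).1 - 1, (site (1, 0) β n a).2) by
        ext <;> simp only [site] <;> ring,
      show site (1, 0) β (n + β) (a + 1) = ((site (1, 0) β n a).1, (site (1, 0) β n a).2 + 1) by
        ext <;> simp only [site] <;> ring,
      show site (1, 0) β (n - β) (a - 1) = ((site (1, 0) β n a).1, (site (1, 0) β n a).2 - 1) by
        ext <;> simp only [site] <;> ring]
  · rw [show site (0, 1) β (n + 1) a = ((site (0, 1) β n a).1, (site (0, 1) β n a).2 + 1) by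
        ext <;> simp only [site] <;> ring,
      show site (0, 1) β (n - 1) a = ((site (0, 1) β n a).1, (site (0, 1) β n a).2 - 1) by
        ext <;> simp only [site] <;> ring,
      show site (0, 1) β (n + β) (a + 1) = ((site (0, 1) β n a).1 - 1, (site (0, 1) β n a).2) by
        ext <;> simp only [site] <;> ring,
      show site (0, 1) β (n - β) (a - 1) = ((site (0, 1) β n a).1 + 1, (site (0, 1) β n a).2) by
        ext <;> simp only [site] <;> ring]
    ring
  · rw [show site (-1, 0) β (n + 1) a = ((site (-1, 0) β n a).1 - 1, (site (-1, 0) β n a).2) by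
        ext <;> simp only [site] <;> ring,
      show site (-1, 0) β (n - 1) a = ((site (-1, 0) β n a).1 + 1, (site (-1, 0) β n a).2) by
        ext <;> simp only [site] <;> ring,
      show site (-1, 0) β (n + β) (a + 1) = ((site (-1, 0) β n a).1, (site (-1, 0) β n a).2 - 1) by
        ext <;> simp only [site] <;> ring,
      show site (-1, 0) β (n - β) (a - 1) = ((site (-1, 0) β n a).1, (site (-1, 0) β n a).2 + 1) by
        ext <;> simp only [site] <;> ring]
    ring
  · rw [show site (0, -1) β (n + 1) a = ((site (0, -1) β n a).1, (site (0, -1) β n a).2 - 1) by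
        ext <;> simp only [site] <;> ring,
      show site (0, -1) β (n - 1) a = ((site (0, -1) β n a).1, (site (0, -1) β n a).2 + 1) by
        ext <;> simp only [site] <;> ring,
      show site (0, -1) β (n + β) (a + 1) = ((site (0, -1) β n a).1 + 1, (site (0, -1) β n a).2) by
        ext <;> simp only [site] <;> ring,
      show site (0, -1) β (n - β) (a - 1) = ((site (0, -1) β n a).1 - 1, (site (0, -1) β n a).2) by
        ext <;> simp only [site] <;> ring]
    ring

/-- The rates are `(k - 1)/2` for `k = 1, 2, 3`. This linearity makes the drift additive over the
steps of the interface; it fails at `k = 4`, an isolated site, which does not occur on a graph with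
small steps. -/
theorem flipDrift_eq_of_oppositeCount {σ : Config} {x : ℤ × ℤ} {k : ℕ} (h : oppositeCount σ x = k)
    (hk : k ≤ 3) :
    flipDrift σ x = (if σ x then -1 else 1) * (if 2 ≤ k then ((k : ℝ) - 1) / 2 else 0) := by
  unfold flipDrift flipRate
  rw [h]
  interval_cases k <;> norm_num

section Path

variable {σ : Config} {u : ℤ × ℤ} {h : ℤ → ℤ} {n a : ℤ}

/-- A site adjacent to the interface has one opposite neighbour across it in its own column, which
accounts for the `-1` in the rate. Each lateral neighbour adds one more exactly when the interface
steps past the site. -/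
theorem flipDrift_site_zero (hu : IsUnitVector u) (hst : ∀ n, |h (n + 1) - h n| ≤ 1)
    (hσ : ∀ m b, |m - n| ≤ 1 → |b - a| ≤ 1 → (σ (site u 0 m b) = true ↔ h m ≤ b)) :
    flipDrift σ (site u 0 n a) =
      if a = h n then -(1 / 2) * ((if h (n + 1) - h n = 1 then 1 else 0) +
        (if h n - h (n - 1) = -1 then 1 else 0))
      else if a = h n - 1 then (1 / 2) * ((if h (n + 1) - h n = -1 then 1 else 0) +
        (if h n - h (n - 1) = 1 then 1 else 0))
      else 0 := by
  have hσ' : ∀ m b, |m - n| ≤ 1 → |b - a| ≤ 1 → σ (site u 0 m b) = decide (h m ≤ b) := by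
    intro m b h1 h2
    have := hσ m b h1 h2
    rw [Bool.eq_iff_iff, decide_eq_true_iff]
    exact this
  have h1 := abs_le.1 (hst n)
  have h2 := abs_le.1 (hst (n - 1))
  rw [sub_add_cancel] at h2
  have hc := oppositeCount_site σ hu 0 n a
  simp only [add_zero, sub_zero] at hc
  rw [hσ' n a (by simp) (by simp), hσ' (n + 1) a (by simp) (by simp),
    hσ' (n - 1) a (by simp) (by simp), hσ' n (a + 1) (by simp) (by simp),
    hσ' n (a - 1) (by simp) (by simp)] at hc
  simp only [ne_eq, decide_eq_decide] at hc
  have hk3 : oppositeCount σ (site u 0 n a) ≤ 3 := by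
    rw [hc]; split_ifs <;> omega
  rw [flipDrift_eq_of_oppositeCount rfl hk3, hσ' n a (by simp) (by simp)]
  generalize oppositeCount σ (site u 0 n a) = k at hc hk3
  by_cases e1 : a = h n
  · have hk : k = 1 + (if h (n + 1) - h n = 1 then 1 else 0) +
        (if h n - h (n - 1) = -1 then 1 else 0) := by
      rw [hc]; split_ifs <;> omega
    rw [if_pos e1, if_pos (by simp [e1]), hk]
    split_ifs <;> first | omega | norm_num
  · by_cases e2 : a = h n - 1
    · have hk : k = 1 + (if h (n + 1) - h n = -1 then 1 else 0) +
          (if h n - h (n - 1) = 1 then 1 else 0) := by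
        rw [hc]; split_ifs <;> omega
      rw [if_neg e1, if_pos e2, if_neg (by simp [e2]), hk]
      split_ifs <;> first | omega | norm_num
    · have hk : k = 0 := by
        rw [hc]; split_ifs <;> omega
      rw [if_neg e1, if_neg e2, hk]
      simp

/-- On a monotone staircase a site has at most two opposite neighbours, and exactly two only at a
corner. -/
theorem flipDrift_site_one (hu : IsUnitVector u) (hst : ∀ n, 0 ≤ h (n + 1) - h n ∧ h (n + 1) - h n ≤ 1)
    (hσ : ∀ m b, |m - n| ≤ 1 → |b - a| ≤ 1 → (σ (site u 1 m b) = true ↔ h m ≤ b)) :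
    flipDrift σ (site u 1 n a) =
      if a = h n then (if h n - h (n - 1) = 0 ∧ h (n + 1) - h n = 1 then -(1 / 2) else 0)
      else if a = h n - 1 then (if h n - h (n - 1) = 1 ∧ h (n + 1) - h n = 0 then 1 / 2 else 0)
      else 0 := by
  have hσ' : ∀ m b, |m - n| ≤ 1 → |b - a| ≤ 1 → σ (site u 1 m b) = decide (h m ≤ b) := by
    intro m b h1 h2
    have := hσ m b h1 h2
    rw [Bool.eq_iff_iff, decide_eq_true_iff]
    exact this
  have h1 := hst n
  have h2 := hst (n - 1)
  rw [sub_add_cancel] at h2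
  have hc := oppositeCount_site σ hu 1 n a
  rw [hσ' n a (by simp) (by simp), hσ' (n + 1) a (by simp) (by simp),
    hσ' (n - 1) a (by simp) (by simp), hσ' (n + 1) (a + 1) (by simp) (by simp),
    hσ' (n - 1) (a - 1) (by simp) (by simp)] at hc
  simp only [ne_eq, decide_eq_decide] at hc
  have hk3 : oppositeCount σ (site u 1 n a) ≤ 3 := by
    rw [hc]; split_ifs <;> omega
  rw [flipDrift_eq_of_oppositeCount rfl hk3, hσ' n a (by simp) (by simp)]
  generalize oppositeCount σ (site u 1 n a) = k at hc hk3
  by_cases e1 : a = h n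
  · have hk : k = (if h (n + 1) - h n = 1 then 1 else 0) +
        (if h n - h (n - 1) = 0 then 1 else 0) := by
      rw [hc]; split_ifs <;> omega
    rw [if_pos e1, if_pos (by simp [e1]), hk]
    split_ifs <;> first | omega | norm_num
  · by_cases e2 : a = h n - 1
    · have hk : k = (if h (n + 1) - h n = 0 then 1 else 0) +
          (if h n - h (n - 1) = 1 then 1 else 0) := by
        rw [hc]; split_ifs <;> omega
      rw [if_neg e1, if_pos e2, if_neg (by simp [e2]), hk]
      split_ifs <;> first | omega | norm_num
    · have hk : k = 0 := by
        rw [hc]; split_ifs <;> omega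
      rw [if_neg e1, if_neg e2, hk]
      simp

end Path

/-- The row, in the column `n`, of the first site of the `n`-th step of the interface `h`. -/
def innerRow (β : ℤ) (h : ℤ → ℤ) (n : ℤ) : ℤ :=
  if β = 0 then min (h n) (h (n + 1))
  -- A column without a corner has zero drift, so for the summation by parts any row would do there.
  else if h n - h (n - 1) = 0 ∧ h (n + 1) - h n = 1 then h n else h n - 1

/-- The row, in the column `n + 1`, of the second site of the `n`-th step of the interface `h`. -/
def outerRow (β : ℤ) (h : ℤ → ℤ) (n : ℤ) : ℤ :=
  if β = 0 then min (h n) (h (n + 1)) else innerRow β h (n + 1)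

/-- Summation by parts. For `β = 0` a step contributes drifts of opposite sign at two neighbouring
sites of the same row. For `β = 1` the drift in column `n` is half the difference of the preceding
and the following step, and Abel summation moves the difference onto `w`. The weight vanishes in
both extreme columns, so there are no boundary terms. -/
theorem flipDrift_path_sum {σ : Config} {u : ℤ × ℤ} (hu : IsUnitVector u) {β : ℤ}
    (hβ : β = 0 ∨ β = 1) {h : ℤ → ℤ}
    (hst : ∀ n, -(1 - β) ≤ h (n + 1) - h n ∧ h (n + 1) - h n ≤ 1) (w : ℤ → ℤ → ℝ)
    (lo : ℤ) (M : ℕ) (alo ahi : ℤ)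
    (hσ : ∀ n a, lo - 1 ≤ n → n ≤ lo + M → alo - 1 ≤ a → a ≤ ahi + 1 →
      (σ (site u β n a) = true ↔ h n ≤ a))
    (hrow : ∀ n, lo ≤ n → n < lo + M → alo ≤ h n - 1 ∧ h n ≤ ahi)
    (hlo : ∀ a, w lo a = 0) (hhi : ∀ a, w (lo + M) a = 0) :
    ∑ k ∈ Finset.range M, ∑ a ∈ Finset.Icc alo ahi,
        w (lo + k) a * flipDrift σ (site u β (lo + k) a) =
      1 / 2 * ∑ k ∈ Finset.range M, ((h (lo + k + 1) - h (lo + k) : ℤ) : ℝ) *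
        (w (lo + k + 1) (outerRow β h (lo + k)) - w (lo + k) (innerRow β h (lo + k))) := by
  have two : ∀ (n : ℤ) (A B : ℝ), lo ≤ n → n < lo + M →
      (∀ a ∈ Finset.Icc alo ahi, flipDrift σ (site u β n a) =
        if a = h n then A else if a = h n - 1 then B else 0) →
      ∑ a ∈ Finset.Icc alo ahi, w n a * flipDrift σ (site u β n a) =
        w n (h n) * A + w n (h n - 1) * B := by
    intro n A B h1 h2 hA
    obtain ⟨h3, h4⟩ := hrow n h1 h2
    have : ∀ a ∈ Finset.Icc alo ahi, w n a * flipDrift σ (site u β n a) =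
        (if a = h n then w n a * A else 0) + (if a = h n - 1 then w n a * B else 0) := by
      intro a ha
      rw [hA a ha]
      split_ifs with e1 e2
      · omega
      · ring
      · ring
      · ring
    rw [Finset.sum_congr rfl this, Finset.sum_add_distrib, Finset.sum_ite_eq', Finset.sum_ite_eq',
      if_pos (Finset.mem_Icc.2 ⟨by omega, h4⟩), if_pos (Finset.mem_Icc.2 ⟨h3, by omega⟩)]
  -- `T n` is the half of the `n`-th step's term that sits in column `n + 1`. The sums over columns
  -- and over steps differ by the telescoping sum of `T (n) - T (n - 1)`.
  have tele : ∀ T : ℤ → ℝ, (∀ k ∈ Finset.range M, ∑ a ∈ Finset.Icc alo ahi,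
        w (lo + k) a * flipDrift σ (site u β (lo + k) a) =
        1 / 2 * (((h (lo + k + 1) - h (lo + k) : ℤ) : ℝ) *
        (w (lo + k + 1) (outerRow β h (lo + k)) - w (lo + k) (innerRow β h (lo + k)))) -
        (T (lo + k) - T (lo + k - 1))) → T (lo - 1) = 0 → T (lo + M - 1) = 0 →
      ∑ k ∈ Finset.range M, ∑ a ∈ Finset.Icc alo ahi,
        w (lo + k) a * flipDrift σ (site u β (lo + k) a) =
      1 / 2 * ∑ k ∈ Finset.range M, ((h (lo + k + 1) - h (lo + k) : ℤ) : ℝ) *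
        (w (lo + k + 1) (outerRow β h (lo + k)) - w (lo + k) (innerRow β h (lo + k))) := by
    intro T hT h0 h1
    rw [Finset.sum_congr rfl hT, Finset.sum_sub_distrib, ← Finset.mul_sum]
    have := Finset.sum_range_sub (fun k : ℕ => T (lo + k - 1)) M
    simp only [Nat.cast_add, Nat.cast_one, Nat.cast_zero, add_zero, h0, h1, sub_zero] at this
    have h2 : ∀ k : ℕ, lo + ((k : ℤ) + 1) - 1 = lo + k := fun k => by ring
    simp only [h2] at this
    rw [this, sub_zero]
  rcases hβ with rfl | rfl
  · refine tele (fun n => 1 / 2 * ((if h (n + 1) - h n = 1 then w (n + 1) (h (n + 1) - 1) else 0) -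
      (if h (n + 1) - h n = -1 then w (n + 1) (h (n + 1)) else 0))) ?_ ?_ ?_
    · intro k hk
      rw [Finset.mem_range] at hk
      generalize hn : lo + (k : ℤ) = n
      rw [two n _ _ (by omega) (by omega) fun a ha => flipDrift_site_zero hu
        (fun m => abs_le.2 (by have := hst m; omega)) fun m b hm hb => hσ m b ?_ ?_ ?_ ?_]
      · have hs := hst n
        have hs' := hst (n - 1)
        simp only [innerRow, outerRow, if_true, sub_add_cancel] at hs' ⊢
        have c1 : h (n + 1) - h n = -1 ∨ h (n + 1) - h n = 0 ∨ h (n + 1) - h n = 1 := by omega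
        rcases c1 with c1 | c1 | c1
        · have e : min (h n) (h (n + 1)) = h n - 1 := by rw [min_eq_right] <;> omega
          rw [c1, e]
          have e2 : h (n + 1) = h n - 1 := by omega
          rw [e2]
          split_ifs <;> first | contradiction | omega | (push_cast; ring)
        · rw [c1]
          split_ifs <;> first | contradiction | omega | (push_cast; ring)
        · have e : min (h n) (h (n + 1)) = h n := by rw [min_eq_left]; omega
          rw [c1, e]
          have e2 : h (n + 1) = h n + 1 := by omega
          rw [e2, add_sub_cancel_right]
          split_ifs <;> first | contradiction | omega | (push_cast; ring)
      all_goals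
        have := abs_le.1 hm
        have := abs_le.1 hb
        have := Finset.mem_Icc.1 ha
        omega
    · simp only [sub_add_cancel, hlo, ite_self, sub_self, mul_zero]
    · simp only [sub_add_cancel, hhi, ite_self, sub_self, mul_zero]
  · refine tele (fun n => 1 / 2 * (((h (n + 1) - h n : ℤ) : ℝ) * w (n + 1) (innerRow 1 h (n + 1))))
      ?_ ?_ ?_
    · intro k hk
      rw [Finset.mem_range] at hk
      generalize hn : lo + (k : ℤ) = n
      rw [two n _ _ (by omega) (by omega) fun a ha => flipDrift_site_one hu
        (fun m => by have := hst m; omega) fun m b hm hb => hσ m b ?_ ?_ ?_ ?_]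
      · have hs := hst n
        have hs' := hst (n - 1)
        simp only [outerRow, one_ne_zero, if_false, sub_add_cancel] at hs' ⊢
        have c1 : h (n + 1) - h n = 0 ∨ h (n + 1) - h n = 1 := by omega
        have c2 : h n - h (n - 1) = 0 ∨ h n - h (n - 1) = 1 := by omega
        generalize w (n + 1) (innerRow 1 h (n + 1)) = W
        rcases c1 with c1 | c1 <;> rcases c2 with c2 | c2 <;> simp [innerRow, c1, c2] <;> ring
      all_goals
        have := abs_le.1 hm
        have := abs_le.1 hb
        have := Finset.mem_Icc.1 ha
        omega
    · simp only [sub_add_cancel, hlo, mul_zero]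
    · simp only [sub_add_cancel, hhi, mul_zero]

/-! ### Heights of discretised epigraphs -/

/-- The first coordinate of `z` in the basis `u`, `(i - β) u`. -/
def chartFst (u : ℤ × ℤ) (β : ℤ) (z : ℂ) : ℝ :=
  z.re * u.1 + z.im * u.2 + β * (z.im * u.1 - z.re * u.2)

/-- The second coordinate of `z` in the basis `u`, `(i - β) u`. -/
def chartSnd (u : ℤ × ℤ) (z : ℂ) : ℝ := z.im * u.1 - z.re * u.2

/-- The point with coordinates `ξ`, `η` in the basis `u`, `(i - β) u`. -/
def chartPoint (u : ℤ × ℤ) (β : ℤ) (ξ η : ℝ) : ℂ :=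
  ⟨(ξ - β * η) * u.1 - η * u.2, (ξ - β * η) * u.2 + η * u.1⟩

theorem IsUnitVector.sq_real {u : ℤ × ℤ} (hu : IsUnitVector u) :
    (u.1 : ℝ) ^ 2 + (u.2 : ℝ) ^ 2 = 1 := by exact_mod_cast hu.sq

theorem chartFst_chartPoint {u : ℤ × ℤ} (hu : IsUnitVector u) (β : ℤ) (ξ η : ℝ) :
    chartFst u β (chartPoint u β ξ η) = ξ := by
  have := hu.sq_real
  simp only [chartFst, chartPoint]
  linear_combination ξ * this

theorem chartSnd_chartPoint {u : ℤ × ℤ} (hu : IsUnitVector u) (β : ℤ) (ξ η : ℝ) :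
    chartSnd u (chartPoint u β ξ η) = η := by
  have := hu.sq_real
  simp only [chartSnd, chartPoint]
  linear_combination η * this

theorem chartPoint_chart {u : ℤ × ℤ} (hu : IsUnitVector u) (β : ℤ) (z : ℂ) :
    chartPoint u β (chartFst u β z) (chartSnd u z) = z := by
  have := hu.sq_real
  apply Complex.ext
  · simp only [chartFst, chartSnd, chartPoint]
    linear_combination z.re * this
  · simp only [chartFst, chartSnd, chartPoint]
    linear_combination z.im * this

/-- The centre of the box of a site, scaled by `N`. -/
def siteCentre (N : ℕ) (x : ℤ × ℤ) : ℂ := ⟨x.1 / N, x.2 / N⟩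

theorem siteCentre_mem {N : ℕ} (hN : 0 < N) (x : ℤ × ℤ) : siteCentre N x ∈ latticeBox N x := by
  have hN' : (0 : ℝ) < N := by exact_mod_cast hN
  have : (0 : ℝ) < 1 / (2 * N) := by positivity
  simp only [latticeBox, mem_ofPred_eq, siteCentre, sub_self]
  exact ⟨by linarith, this, by linarith, this⟩

theorem siteCentre_site (N : ℕ) (u : ℤ × ℤ) (β n a : ℤ) :
    siteCentre N (site u β n a) = chartPoint u β (n / N) (a / N) := by
  apply Complex.ext <;> simp only [siteCentre, site, chartPoint] <;> push_cast <;> ring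

theorem latticeBox_add {N : ℕ} {x y : ℤ × ℤ} {z : ℂ} (hz : z ∈ latticeBox N x) :
    z + siteCentre N y ∈ latticeBox N (x + y) := by
  simp only [latticeBox, mem_ofPred_eq, siteCentre, Complex.add_re, Complex.add_im, Prod.fst_add,
    Prod.snd_add, Int.cast_add, add_div, add_sub_add_right_eq_sub] at hz ⊢
  exact hz

theorem site_add (u : ℤ × ℤ) (β n a m b : ℤ) :
    site u β (n + m) (a + b) = site u β n a + site u β m b := by
  ext <;> simp only [site, Prod.fst_add, Prod.snd_add] <;> ring

theorem abs_chart_sub_le {N : ℕ} (hN : 0 < N) {u : ℤ × ℤ} (hu : IsUnitVector u) {β : ℤ}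
    (hβ : β = 0 ∨ β = 1) {n a : ℤ} {z : ℂ} (hz : z ∈ latticeBox N (site u β n a)) :
    |chartFst u β z - n / N| ≤ 1 / N ∧ |chartSnd u z - a / N| ≤ 1 / N := by
  have hN' : (0 : ℝ) < N := by exact_mod_cast hN
  have h0 : z = chartPoint u β (n / N) (a / N) + (z - siteCentre N (site u β n a)) := by
    rw [siteCentre_site]; ring
  set y := z - siteCentre N (site u β n a) with hy
  have h1 : chartFst u β z = n / N + chartFst u β y := by
    conv_lhs => rw [h0]
    conv_rhs => rw [← chartFst_chartPoint hu β (n / N) (a / N)]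
    simp only [chartFst, Complex.add_re, Complex.add_im]
    ring
  have h2 : chartSnd u z = a / N + chartSnd u y := by
    conv_lhs => rw [h0]
    conv_rhs => rw [← chartSnd_chartPoint hu β (n / N) (a / N)]
    simp only [chartSnd, Complex.add_re, Complex.add_im]
    ring
  simp only [latticeBox, mem_ofPred_eq] at hz
  have h3 : y.re = z.re - (site u β n a).1 / N := rfl
  have h4 : y.im = z.im - (site u β n a).2 / N := rfl
  rw [← h3, ← h4] at hz
  have e : (1 : ℝ) / N = 2 * (1 / (2 * N)) := by field_simp
  rw [h1, h2, add_sub_cancel_left, add_sub_cancel_left, e, abs_le, abs_le]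
  obtain ⟨a1, a2, a3, a4⟩ := hz
  generalize (1 : ℝ) / (2 * N) = c at *
  unfold chartFst chartSnd
  rcases hu with rfl | rfl | rfl | rfl <;> rcases hβ with rfl | rfl <;> norm_num <;>
    refine ⟨⟨?_, ?_⟩, ?_, ?_⟩ <;> linarith

/-- The epigraph of `g` in the chart given by `u` and `β`. -/
def chartEpigraph (u : ℤ × ℤ) (β : ℤ) (g : ℝ → ℝ) : Set ℂ :=
  {z | g (chartFst u β z) ≤ chartSnd u z}

/-- Lattice translations permute the boxes, so an inequality between `g` and its translate passes to
the heights without any rounding error. The last clause records this; it yields the exact step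
bounds, while the second clause only locates `h` up to a constant. -/
theorem exists_height {N : ℕ} (hN : 0 < N) {u : ℤ × ℤ} (hu : IsUnitVector u) {β : ℤ}
    (hβ : β = 0 ∨ β = 1) {g : ℝ → ℝ} (hg : ∀ x y, |g x - g y| ≤ |x - y|) :
    ∃ h : ℤ → ℤ,
      (∀ n a, (latticeBox N (site u β n a) ∩ chartEpigraph u β g).Nonempty ↔ h n ≤ a) ∧
      (∀ n, |(h n : ℝ) - N * g (n / N)| ≤ 2) ∧
      ∀ n dn da : ℤ, (∀ x : ℝ, |x - n / N| ≤ 1 / N → g (x + dn / N) ≤ g x + da / N) →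
        h (n + dn) ≤ h n + da := by
  have hN' : (0 : ℝ) < N := by exact_mod_cast hN
  have htrans : ∀ n a dn da : ℤ,
      (∀ x : ℝ, |x - n / N| ≤ 1 / N → g (x + dn / N) ≤ g x + da / N) →
      (latticeBox N (site u β n a) ∩ chartEpigraph u β g).Nonempty →
      (latticeBox N (site u β (n + dn) (a + da)) ∩ chartEpigraph u β g).Nonempty := by
    rintro n a dn da hd ⟨z, hz, hzg⟩
    refine ⟨z + siteCentre N (site u β dn da), by rw [site_add]; exact latticeBox_add hz, ?_⟩
    have h1 : chartFst u β (z + siteCentre N (site u β dn da)) = chartFst u β z + dn / N := by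
      conv_rhs => rw [← chartFst_chartPoint hu β (dn / N) (da / N), ← siteCentre_site]
      simp only [chartFst, Complex.add_re, Complex.add_im]
      ring
    have h2 : chartSnd u (z + siteCentre N (site u β dn da)) = chartSnd u z + da / N := by
      conv_rhs => rw [← chartSnd_chartPoint hu β (dn / N) (da / N), ← siteCentre_site]
      simp only [chartSnd, Complex.add_re, Complex.add_im]
      ring
    have h3 : g (chartFst u β z) ≤ chartSnd u z := hzg
    show g (chartFst u β _) ≤ chartSnd u _
    rw [h1, h2]
    have := hd _ (abs_chart_sub_le hN hu hβ hz).1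
    linarith
  have hlow : ∀ n a : ℤ, (latticeBox N (site u β n a) ∩ chartEpigraph u β g).Nonempty →
      N * g (n / N) - 2 ≤ a := by
    rintro n a ⟨z, hz, hzg⟩
    obtain ⟨h1, h2⟩ := abs_chart_sub_le hN hu hβ hz
    have h3 : g (chartFst u β z) ≤ chartSnd u z := hzg
    have h4 := (abs_le.1 ((hg (chartFst u β z) (n / N)).trans h1)).1
    have h5 := (abs_le.1 h2).2
    have h6 : g (n / N) - 2 / N ≤ a / N := by
      have : (2 : ℝ) / N = 1 / N + 1 / N := by ring
      linarith
    have h7 := mul_le_mul_of_nonneg_left h6 hN'.le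
    rw [mul_sub, mul_div_cancel₀ _ hN'.ne', mul_div_cancel₀ _ hN'.ne'] at h7
    exact h7
  have hupp : ∀ n a : ℤ, N * g (n / N) ≤ a →
      (latticeBox N (site u β n a) ∩ chartEpigraph u β g).Nonempty := by
    intro n a ha
    refine ⟨_, siteCentre_mem hN _, ?_⟩
    show g (chartFst u β _) ≤ chartSnd u _
    rw [siteCentre_site, chartFst_chartPoint hu, chartSnd_chartPoint hu, le_div_iff₀ hN']
    linarith
  have hex : ∀ n : ℤ, ∃ l : ℤ, (latticeBox N (site u β n l) ∩ chartEpigraph u β g).Nonempty ∧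
      ∀ a, (latticeBox N (site u β n a) ∩ chartEpigraph u β g).Nonempty → l ≤ a := by
    intro n
    refine Int.exists_least_of_bdd ⟨⌊N * g (n / N) - 2⌋, fun a ha => ?_⟩
      ⟨⌈N * g (n / N)⌉, hupp n _ (Int.le_ceil _)⟩
    have := (Int.floor_le (N * g (n / N) - 2)).trans (hlow n a ha)
    exact_mod_cast this
  choose h hh1 hh2 using hex
  have hup : ∀ n a : ℤ, ∀ k : ℕ, (latticeBox N (site u β n a) ∩ chartEpigraph u β g).Nonempty →
      (latticeBox N (site u β n (a + k)) ∩ chartEpigraph u β g).Nonempty := by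
    intro n a k hk
    have := htrans n a 0 k (fun x _ => by simp; positivity) hk
    simpa using this
  refine ⟨h, fun n a => ⟨hh2 n a, fun ha => ?_⟩, fun n => abs_le.2 ⟨?_, ?_⟩, fun n dn da hd => ?_⟩
  · obtain ⟨k, hk⟩ := Int.eq_ofNat_of_zero_le (sub_nonneg.2 ha)
    have := hup n (h n) k (hh1 n)
    rwa [show h n + (k : ℤ) = a by omega] at this
  · linarith [hlow n (h n) (hh1 n)]
  · have h1 := hh2 n _ (hupp n _ (Int.le_ceil _))
    have h2 := Int.ceil_lt_add_one (N * g (n / N))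
    have h3 : (h n : ℝ) ≤ ⌈N * g (n / N)⌉ := by exact_mod_cast h1
    linarith
  · exact hh2 _ _ (htrans n (h n) dn da hd (hh1 n))

/-! ### Flux through one end of the interface -/

set_option maxHeartbeats 1000000 in
-- An abstract form of the flux computation: about `R/l` coefficients of mean `μ` multiply
-- increments close to `-G/(lR)`, so the sum is close to `-Gμ/l²`. The increment is prescribed only
-- up to the factor `c k`, since steps with `c k = 0` may have other displacements.
theorem abs_sum_range_add_le {c t : ℕ → ℝ} {M : ℕ} {G μ B K κ R l : ℝ} (hl : 0 < l) (hκ : 0 < κ)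
    (hκ1 : κ ≤ 1) (hκl : 6 * κ ≤ l) (hK : 1 ≤ K) (hμ : |μ| ≤ 1) (hG : |G| / l ≤ B)
    (hc : ∀ k, |c k| ≤ 1)
    (hR : (K / κ + 2) * (2 * l) ≤ R) (hM : 2 * R + l ≤ M * l)
    (hsum : ∀ m ≤ M, |(∑ j ∈ Finset.range m, c j) - m * μ| ≤ κ * m + K)
    (ht : ∀ k < M, |t k| ≤ B / R)
    (ht1 : ∀ k < M, K / κ ≤ k → k * l + 3 * κ * k ≤ R →
      |c k * t k + c k * (G / (l * R))| ≤ B * κ / R)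
    (ht2 : ∀ k < M, K / κ ≤ k → R ≤ k * l - 3 * κ * k → t k = 0) :
    |(∑ k ∈ Finset.range M, c k * t k) + G * μ / l ^ 2| ≤
      B * (κ * (2 / l + 12 / l ^ 2) + 8 * K / (κ * R)) := by
  have hK0 : 0 < K := by linarith
  have hKκ : 0 < K / κ := by positivity
  have hRpos : 0 < R := lt_of_lt_of_le (by positivity) hR
  have hB : 0 ≤ B := le_trans (by positivity) hG
  -- Below `a` the additive error `K` is not yet dominated by `κ k`; between `a` and `m₁` the site
  -- is surely inside the tent, and from `m₂` on surely outside. The layer between `m₁` and `m₂` has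
  -- about `9κR/l²` terms, up to rounding, each at most `B/R`.
  set a := ⌈K / κ⌉₊ with ha
  set m₁ := ⌊R / (l + 3 * κ)⌋₊ with hm₁
  set m₂ := ⌈R / (l - 3 * κ)⌉₊ with hm₂
  have hl3 : 0 < l - 3 * κ := by linarith
  have ha1 : K / κ ≤ a := Nat.le_ceil _
  have ha2 : (a : ℝ) < K / κ + 1 := Nat.ceil_lt_add_one hKκ.le
  have hm₁1 : (m₁ : ℝ) ≤ R / (l + 3 * κ) := Nat.floor_le (by positivity)
  have hm₁2 : R / (l + 3 * κ) < m₁ + 1 := Nat.lt_floor_add_one _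
  have hm₂1 : R / (l - 3 * κ) ≤ m₂ := Nat.le_ceil _
  have hm₂2 : (m₂ : ℝ) < R / (l - 3 * κ) + 1 := Nat.ceil_lt_add_one (by positivity)
  have hq1 : R / (2 * l) ≤ R / (l + 3 * κ) :=
    div_le_div_of_nonneg_left hRpos.le (by positivity) (by linarith)
  have hq2 : R / (l - 3 * κ) ≤ 2 * R / l := by
    rw [div_le_div_iff₀ hl3 hl]; nlinarith
  have hq3 : R / (l + 3 * κ) ≤ R / (l - 3 * κ) :=
    div_le_div_of_nonneg_left hRpos.le hl3 (by linarith)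
  have ham : a ≤ m₁ := by
    have : K / κ + 2 ≤ R / (2 * l) := by rwa [le_div_iff₀ (by positivity)]
    have : (a : ℝ) ≤ m₁ := by linarith
    exact_mod_cast this
  have hm12 : m₁ ≤ m₂ := by
    have : (m₁ : ℝ) ≤ m₂ := by linarith
    exact_mod_cast this
  have hm2M : m₂ ≤ M := by
    have h1 : 2 * R / l + 1 ≤ M := by
      rw [div_add_one hl.ne', div_le_iff₀ hl]; exact hM
    have : (m₂ : ℝ) ≤ M := by linarith
    exact_mod_cast this
  have hsplit : ∑ k ∈ Finset.range M, c k * t k =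
      ∑ k ∈ Finset.range m₁, c k * t k + ∑ k ∈ Finset.Ico m₁ m₂, c k * t k := by
    rw [Finset.sum_range_add_sum_Ico _ hm12, ← Finset.sum_range_add_sum_Ico _ hm2M, add_eq_left]
    refine Finset.sum_eq_zero fun k hk => ?_
    rw [Finset.mem_Ico] at hk
    have hk1 : (m₂ : ℝ) ≤ k := by exact_mod_cast hk.1
    rw [ht2 k hk.2 ?_ ?_, mul_zero]
    · have : (a : ℝ) ≤ m₂ := by exact_mod_cast ham.trans hm12
      linarith
    · have : R / (l - 3 * κ) ≤ k := hm₂1.trans hk1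
      rw [div_le_iff₀ hl3] at this
      linarith
  have hGB : |G / (l * R)| ≤ B / R := by
    rw [abs_div, abs_mul, abs_of_pos hl, abs_of_pos hRpos, ← div_div]
    gcongr
  have e1 : |∑ k ∈ Finset.range m₁, (c k * t k + c k * (G / (l * R)))| ≤
      a * (2 * B / R) + m₁ * (B * κ / R) := by
    rw [← Finset.sum_range_add_sum_Ico _ ham]
    refine (abs_add_le _ _).trans (add_le_add ?_ ?_)
    · refine (Finset.abs_sum_le_sum_abs _ _).trans ?_
      refine (Finset.sum_le_card_nsmul _ _ (2 * B / R) fun k hk => ?_).trans ?_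
      · rw [Finset.mem_range] at hk
        rw [← mul_add, abs_mul]
        calc |c k| * |t k + G / (l * R)| ≤ 1 * (B / R + B / R) := by
              gcongr
              · exact hc k
              · exact (abs_add_le _ _).trans (add_le_add (ht k (by omega)) hGB)
          _ = 2 * B / R := by ring
      · simp
    · refine (Finset.abs_sum_le_sum_abs _ _).trans ?_
      refine (Finset.sum_le_card_nsmul _ _ (B * κ / R) fun k hk => ?_).trans ?_
      · rw [Finset.mem_Ico] at hk
        have hk1 : (a : ℝ) ≤ k := by exact_mod_cast hk.1
        have hk2 : (k : ℝ) ≤ m₁ := by exact_mod_cast hk.2.le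
        refine ht1 k (by omega) (by linarith) ?_
        have := hk2.trans hm₁1
        rw [le_div_iff₀ (by positivity)] at this
        linarith
      · rw [Nat.card_Ico, nsmul_eq_mul]
        have : ((m₁ - a : ℕ) : ℝ) ≤ m₁ := by exact_mod_cast Nat.sub_le _ _
        gcongr
  have e2 : |∑ k ∈ Finset.Ico m₁ m₂, c k * t k| ≤ (m₂ - m₁) * (B / R) := by
    refine (Finset.abs_sum_le_sum_abs _ _).trans ?_
    refine (Finset.sum_le_card_nsmul _ _ (B / R) fun k hk => ?_).trans ?_
    · rw [Finset.mem_Ico] at hk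
      rw [abs_mul]
      calc |c k| * |t k| ≤ 1 * (B / R) := by
            gcongr
            · exact hc k
            · exact ht k (by omega)
        _ = B / R := one_mul _
    · rw [Nat.card_Ico, nsmul_eq_mul, Nat.cast_sub hm12]
  have e3 : |(∑ j ∈ Finset.range m₁, c j) - m₁ * μ| ≤ κ * m₁ + K := hsum m₁ (hm12.trans hm2M)
  have hm1R : (m₁ : ℝ) / R ≤ 1 / l := by
    rw [div_le_div_iff₀ hRpos hl, one_mul]
    rw [le_div_iff₀ (by positivity)] at hm₁1
    nlinarith [Nat.cast_nonneg (α := ℝ) m₁]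
  have hm1R' : 1 / l - 3 * κ / l ^ 2 - 1 / R ≤ (m₁ : ℝ) / R := by
    have h1 : 1 / l - 3 * κ / l ^ 2 ≤ 1 / (l + 3 * κ) := by
      rw [show 1 / l - 3 * κ / l ^ 2 = (l - 3 * κ) / l ^ 2 by field_simp,
        div_le_div_iff₀ (by positivity) (by positivity)]
      nlinarith [sq_nonneg κ]
    have h2 : 1 / (l + 3 * κ) ≤ (m₁ + 1) / R := by
      rw [div_lt_iff₀ (by positivity)] at hm₁2
      rw [div_le_div_iff₀ (by positivity) hRpos]
      linarith
    rw [add_div] at h2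
    linarith
  have hm2R : (m₂ : ℝ) / R ≤ 1 / l + 6 * κ / l ^ 2 + 1 / R := by
    have h1 : 1 / (l - 3 * κ) ≤ 1 / l + 6 * κ / l ^ 2 := by
      rw [show 1 / l + 6 * κ / l ^ 2 = (l + 6 * κ) / l ^ 2 by field_simp,
        div_le_div_iff₀ (by positivity) (by positivity)]
      nlinarith
    have h2 : (m₂ : ℝ) / R ≤ (R / (l - 3 * κ) + 1) / R := by gcongr
    rw [add_div, div_div, mul_comm (l - 3 * κ), ← div_div, div_self hRpos.ne'] at h2
    linarith
  have e4 : |G * μ / l ^ 2 - (m₁ * μ) * (G / (l * R))| ≤ B * (3 * κ / l ^ 2 + 1 / R) := by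
    have : G * μ / l ^ 2 - (m₁ * μ) * (G / (l * R)) = (G / l) * μ * (1 / l - m₁ / R) := by
      field_simp
    rw [this, abs_mul, abs_mul, abs_div, abs_of_pos hl, abs_of_nonneg (by linarith : 0 ≤ 1 / l - m₁ / R)]
    calc |G| / l * |μ| * (1 / l - m₁ / R) ≤ B * 1 * (3 * κ / l ^ 2 + 1 / R) := by
          gcongr
          · linarith
      _ = _ := by ring
  have hfin : (∑ k ∈ Finset.range M, c k * t k) + G * μ / l ^ 2 =
      (∑ k ∈ Finset.range m₁, (c k * t k + c k * (G / (l * R)))) +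
      (∑ k ∈ Finset.Ico m₁ m₂, c k * t k) -
      ((∑ j ∈ Finset.range m₁, c j) - m₁ * μ) * (G / (l * R)) +
      (G * μ / l ^ 2 - (m₁ * μ) * (G / (l * R))) := by
    rw [hsplit, Finset.sum_add_distrib, ← Finset.sum_mul]
    ring
  have e5 : |((∑ j ∈ Finset.range m₁, c j) - m₁ * μ) * (G / (l * R))| ≤ (κ * m₁ + K) * (B / R) := by
    rw [abs_mul]
    gcongr
  rw [hfin]
  refine (abs_add_le _ _).trans ?_
  refine (add_le_add (abs_sub _ _) le_rfl).trans ?_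
  refine (add_le_add (add_le_add (abs_add_le _ _) le_rfl) le_rfl).trans ?_
  have f1 : a * (2 * B / R) + m₁ * (B * κ / R) ≤ B * ((2 * (K / κ) + 2) / R + κ * (1 / l)) := by
    have h1 : a * (2 * B / R) ≤ (K / κ + 1) * (2 * B / R) := by gcongr
    have h2 : m₁ * (B * κ / R) = B * κ * (m₁ / R) := by ring
    have h3 : B * κ * (m₁ / R) ≤ B * κ * (1 / l) := by gcongr
    have h4 : (K / κ + 1) * (2 * B / R) = B * ((2 * (K / κ) + 2) / R) := by ring
    rw [mul_add]
    linarith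
  have f2 : (m₂ - m₁) * (B / R) ≤ B * (9 * κ / l ^ 2 + 2 / R) := by
    have : (m₂ - m₁) * (B / R) = B * (m₂ / R - m₁ / R) := by ring
    rw [this]
    gcongr
    have : (2 : ℝ) / R = 1 / R + 1 / R := by ring
    have : 9 * κ / l ^ 2 = 6 * κ / l ^ 2 + 3 * κ / l ^ 2 := by ring
    linarith
  have f3 : (κ * m₁ + K) * (B / R) ≤ B * (κ * (1 / l) + K / R) := by
    have : (κ * m₁ + K) * (B / R) = B * (κ * (m₁ / R) + K / R) := by ring
    rw [this]
    gcongr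
  have f4 : (2 * (K / κ) + 2) / R + 2 / R + K / R + 1 / R ≤ 8 * K / (κ * R) := by
    rw [← add_div, ← add_div, ← add_div, ← div_div]
    gcongr
    have : K ≤ K / κ := by rw [le_div_iff₀ hκ]; nlinarith
    have : 8 * K / κ = 8 * (K / κ) := by ring
    linarith
  have f5 : B * (κ * (2 / l + 12 / l ^ 2) + 8 * K / (κ * R)) ≥
      B * ((2 * (K / κ) + 2) / R + κ * (1 / l)) + B * (9 * κ / l ^ 2 + 2 / R) +
      B * (κ * (1 / l) + K / R) + B * (3 * κ / l ^ 2 + 1 / R) := by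
    rw [← mul_add, ← mul_add, ← mul_add]
    apply mul_le_mul_of_nonneg_left _ hB
    have : κ * (2 / l + 12 / l ^ 2) = κ * (1 / l) + 9 * κ / l ^ 2 + κ * (1 / l) + 3 * κ / l ^ 2 := by
      ring
    linarith
  linarith

/-! ### Increments of the distance and of the tent along a direction -/

/-- The Euclidean scalar product. -/
def dot (z w : ℂ) : ℝ := z.re * w.re + z.im * w.im

theorem abs_dot_le (z w : ℂ) : |dot z w| ≤ ‖z‖ * ‖w‖ := by
  have h := abs_real_inner_le_norm z w
  rwa [Complex.inner, show ((w * (starRingEnd ℂ) z).re) = dot z w by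
    simp only [dot, Complex.mul_re, Complex.conj_re, Complex.conj_im]; ring] at h

theorem dot_self (z : ℂ) : dot z z = ‖z‖ ^ 2 := by
  rw [dot, ← Complex.normSq_eq_norm_sq, Complex.normSq_apply]

theorem dot_add_left (z z' w : ℂ) : dot (z + z') w = dot z w + dot z' w := by
  simp only [dot, Complex.add_re, Complex.add_im]; ring

theorem dot_sub_right (z w w' : ℂ) : dot z (w - w') = dot z w - dot z w' := by
  simp only [dot, Complex.sub_re, Complex.sub_im]; ring

theorem dot_smul_left (c : ℝ) (z w : ℂ) : dot (c • z) w = c * dot z w := by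
  simp only [dot, Complex.smul_re, Complex.smul_im, smul_eq_mul]; ring

theorem dot_smul_right (c : ℝ) (z w : ℂ) : dot z (c • w) = c * dot z w := by
  simp only [dot, Complex.smul_re, Complex.smul_im, smul_eq_mul]; ring

/-- Convexity of the norm: the unit vector along `a` is a subgradient at `a`. -/
theorem dot_unit_le_norm_sub (a h : ℂ) : dot h (‖a‖⁻¹ • a) ≤ ‖a + h‖ - ‖a‖ := by
  rcases eq_or_ne a 0 with rfl | ha
  · simp [dot]
  have ha' : 0 < ‖a‖ := norm_pos_iff.2 ha
  have h1 := (le_abs_self _).trans (abs_dot_le (a + h) a)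
  rw [dot_add_left, dot_self] at h1
  rw [dot_smul_right, inv_mul_le_iff₀ ha']
  nlinarith

theorem norm_unit_sub_unit_le {a b : ℂ} (hb : b ≠ 0) :
    ‖‖a‖⁻¹ • a - ‖b‖⁻¹ • b‖ ≤ 2 * ‖a - b‖ / ‖b‖ := by
  have hb' : 0 < ‖b‖ := norm_pos_iff.2 hb
  have h1 : ‖a‖⁻¹ • a - ‖b‖⁻¹ • b = ‖b‖⁻¹ • (a - b) + (‖a‖⁻¹ - ‖b‖⁻¹) • a := by
    rw [smul_sub, sub_smul]; abel
  have h2 : ‖(‖a‖⁻¹ - ‖b‖⁻¹) • a‖ ≤ ‖a - b‖ / ‖b‖ := by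
    rcases eq_or_ne a 0 with rfl | ha
    · simp only [smul_zero, norm_zero]; positivity
    have ha' : 0 < ‖a‖ := norm_pos_iff.2 ha
    rw [norm_smul, Real.norm_eq_abs, inv_sub_inv ha'.ne' hb'.ne', abs_div, abs_mul, abs_norm, abs_norm,
      show |‖b‖ - ‖a‖| / (‖a‖ * ‖b‖) * ‖a‖ = |‖b‖ - ‖a‖| / ‖b‖ by field_simp]
    gcongr
    rw [norm_sub_rev]
    exact abs_norm_sub_norm_le b a
  rw [h1]
  refine (norm_add_le _ _).trans ?_
  rw [norm_smul, norm_inv, norm_norm]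
  have : 2 * ‖a - b‖ / ‖b‖ = ‖b‖⁻¹ * ‖a - b‖ + ‖a - b‖ / ‖b‖ := by field_simp; ring
  rw [this]
  gcongr

/-- The subgradient inequalities at `a` and at `a + h` bracket the increment, and both unit vectors
are within `2E/‖b‖` of that of `b`. No second derivative of the norm is needed. -/
theorem abs_norm_add_sub_norm_sub_le {a h b : ℂ} {E : ℝ} (hb : b ≠ 0) (h1 : ‖a - b‖ ≤ E)
    (h2 : ‖a + h - b‖ ≤ E) :
    |‖a + h‖ - ‖a‖ - dot h (‖b‖⁻¹ • b)| ≤ ‖h‖ * (2 * E / ‖b‖) := by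
  have hb' : 0 < ‖b‖ := norm_pos_iff.2 hb
  have key : ∀ a' : ℂ, ‖a' - b‖ ≤ E →
      |dot h (‖a'‖⁻¹ • a') - dot h (‖b‖⁻¹ • b)| ≤ ‖h‖ * (2 * E / ‖b‖) := by
    intro a' ha'
    rw [← dot_sub_right]
    refine (abs_dot_le _ _).trans ?_
    gcongr
    refine (norm_unit_sub_unit_le hb).trans ?_
    gcongr
  have l1 := dot_unit_le_norm_sub a h
  have l2 := dot_unit_le_norm_sub (a + h) (-h)
  rw [add_neg_cancel_right, show dot (-h) (‖a + h‖⁻¹ • (a + h)) = - dot h (‖a + h‖⁻¹ • (a + h)) by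
    simp only [dot, Complex.neg_re, Complex.neg_im]; ring] at l2
  have k1 := abs_le.1 (key a h1)
  have k2 := abs_le.1 (key (a + h) h2)
  rw [abs_le]
  constructor <;> linarith

theorem norm_sub_siteCentre_le {N : ℕ} (hN : 0 < N) {x : ℤ × ℤ} {z : ℂ} (hz : z ∈ latticeBox N x) :
    ‖z - siteCentre N x‖ ≤ 1 / N := by
  refine (Complex.norm_le_abs_re_add_abs_im _).trans ?_
  have hN' : (0 : ℝ) < N := by exact_mod_cast hN
  simp only [latticeBox, mem_ofPred_eq] at hz
  simp only [siteCentre, Complex.sub_re, Complex.sub_im]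
  have e : (1 : ℝ) / N = 1 / (2 * N) + 1 / (2 * N) := by field_simp; norm_num
  rw [e]
  exact add_le_add (abs_le.2 ⟨hz.1, hz.2.1.le⟩) (abs_le.2 ⟨hz.2.2.1, hz.2.2.2.le⟩)

theorem mem_latticeBox_add_sub {N : ℕ} {x x' : ℤ × ℤ} {z : ℂ} (hz : z ∈ latticeBox N x) :
    z + (siteCentre N x' - siteCentre N x) ∈ latticeBox N x' := by
  have h : siteCentre N x' - siteCentre N x = siteCentre N (x' - x) := by
    apply Complex.ext <;> simp [siteCentre, sub_div]
  have := latticeBox_add (y := x' - x) hz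
  rwa [add_sub_cancel, ← h] at this

/-- Translation by `v` carries the box of `x` onto the box of `x'`, so an estimate that is uniform
over the points of the first box passes to the infima. -/
theorem abs_infDist_sub_le {N : ℕ} (hN : 0 < N) {z v : ℂ} {x x' : ℤ × ℤ} {d ε : ℝ}
    (h : ∀ y ∈ latticeBox N x,
      |‖y - z + (siteCentre N x' - siteCentre N x)‖ - ‖y - z‖ - d| ≤ ε)
    (hv : v = siteCentre N x' - siteCentre N x) :
    |Metric.infDist z (latticeBox N x') - Metric.infDist z (latticeBox N x) - d| ≤ ε := by
  rw [← hv] at h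
  have e : ∀ y : ℂ, dist z y = ‖y - z‖ := fun y => by rw [dist_comm, dist_eq_norm]
  rw [abs_le]
  constructor
  · have : Metric.infDist z (latticeBox N x) + d - ε ≤ Metric.infDist z (latticeBox N x') := by
      refine (Metric.le_infDist (latticeBox_nonempty hN x')).2 fun {y} hy => ?_
      have hy' := mem_latticeBox_add_sub (x' := x) hy
      have h1 := (abs_le.1 (h _ hy')).1
      have h2 := Metric.infDist_le_dist_of_mem (x := z) hy'
      rw [e] at h2 ⊢
      rw [show y + (siteCentre N x - siteCentre N x') - z + v = y - z by rw [hv]; ring] at h1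
      linarith
    linarith
  · have : Metric.infDist z (latticeBox N x') - d - ε ≤ Metric.infDist z (latticeBox N x) := by
      refine (Metric.le_infDist (latticeBox_nonempty hN x)).2 fun {y} hy => ?_
      have hy' := mem_latticeBox_add_sub (x' := x') hy
      have h1 := (abs_le.1 (h _ hy)).2
      have h2 := Metric.infDist_le_dist_of_mem (x := z) hy'
      rw [e] at h2 ⊢
      rw [show y + (siteCentre N x' - siteCentre N x) - z = y - z + v by rw [hv]; ring] at h2
      linarith
    linarith

theorem abs_infDist_sub_norm_le {N : ℕ} (hN : 0 < N) (z : ℂ) (x : ℤ × ℤ) :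
    |Metric.infDist z (latticeBox N x) - ‖siteCentre N x - z‖| ≤ 1 / N := by
  have e : ∀ y : ℂ, dist z y = ‖y - z‖ := fun y => by rw [dist_comm, dist_eq_norm]
  rw [abs_le]
  constructor
  · have : ‖siteCentre N x - z‖ - 1 / N ≤ Metric.infDist z (latticeBox N x) := by
      refine (Metric.le_infDist (latticeBox_nonempty hN x)).2 fun {y} hy => ?_
      rw [e]
      have h1 := norm_sub_siteCentre_le hN hy
      have h2 : ‖siteCentre N x - z‖ ≤ ‖y - z‖ + ‖y - siteCentre N x‖ := by
        rw [show siteCentre N x - z = (y - z) - (y - siteCentre N x) by ring]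
        exact norm_sub_le _ _
      linarith
    linarith
  · have := Metric.infDist_le_dist_of_mem (x := z) (siteCentre_mem hN x)
    rw [e] at this
    have hN' : (0 : ℝ) < N := by exact_mod_cast hN
    have : (0 : ℝ) < 1 / N := by positivity
    linarith

theorem abs_tent_sub_le {N : ℕ} (hN : 0 < N) (z : ℂ) {δ : ℝ} (hδ : 0 < δ) (x x' : ℤ × ℤ) :
    |tent N z δ x' - tent N z δ x| ≤ ‖siteCentre N x' - siteCentre N x‖ / δ := by
  have h := abs_infDist_sub_le hN (z := z) (x := x) (x' := x') (d := 0)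
    (ε := ‖siteCentre N x' - siteCentre N x‖) (fun y _ => by
      rw [sub_zero]
      have := abs_norm_sub_norm_le (y - z + (siteCentre N x' - siteCentre N x)) (y - z)
      rwa [add_sub_cancel_left] at this) rfl
  rw [sub_zero] at h
  unfold tent
  rw [max_comm 0, max_comm 0]
  refine (abs_max_sub_max_le_abs _ _ _).trans ?_
  rw [show (1 - Metric.infDist z (latticeBox N x') / δ) - (1 - Metric.infDist z (latticeBox N x) / δ) =
    -((Metric.infDist z (latticeBox N x') - Metric.infDist z (latticeBox N x)) / δ) by ring, abs_neg,
    abs_div, abs_of_pos hδ]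
  gcongr

theorem tent_eq_zero {N : ℕ} (hN : 0 < N) {z : ℂ} {δ : ℝ} (hδ : 0 < δ) {x : ℤ × ℤ}
    (h : δ + 1 / N ≤ ‖siteCentre N x - z‖) : tent N z δ x = 0 := by
  have := (abs_le.1 (abs_infDist_sub_norm_le hN z x)).1
  rw [tent, max_eq_left]
  rw [sub_nonpos, one_le_div hδ]
  linarith

theorem norm_chartPoint_sq {u : ℤ × ℤ} (hu : IsUnitVector u) (β : ℤ) (a b : ℝ) :
    ‖chartPoint u β a b‖ ^ 2 = (a - β * b) ^ 2 + b ^ 2 := by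
  rw [← dot_self, dot, chartPoint]
  linear_combination ((a - β * b) ^ 2 + b ^ 2) * hu.sq_real

theorem norm_chartPoint_le {u : ℤ × ℤ} (hu : IsUnitVector u) {β : ℤ} (hβ : β = 0 ∨ β = 1)
    (a b : ℝ) : ‖chartPoint u β a b‖ ≤ |a| + 2 * |b| := by
  refine abs_le_of_sq_le_sq' ?_ (by positivity) |>.2
  rw [norm_chartPoint_sq hu]
  have h1 : -(|a| * |b|) ≤ a * b := by rw [← abs_mul]; exact neg_abs_le _
  have h2 := sq_abs a
  have h3 := sq_abs b
  have h4 : 0 ≤ |a| * |b| := by positivity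
  rcases hβ with rfl | rfl
  · push_cast; nlinarith [sq_nonneg b]
  · push_cast; nlinarith [sq_nonneg b]

theorem norm_chartPoint_pos {u : ℤ × ℤ} (hu : IsUnitVector u) (β : ℤ) (m : ℝ) :
    0 < ‖chartPoint u β 1 m‖ := by
  have h := norm_chartPoint_sq hu β 1 m
  have h2 : 0 < ‖chartPoint u β 1 m‖ ^ 2 := by
    rw [h]
    rcases eq_or_ne m 0 with rfl | hm
    · simp
    · positivity
  refine (norm_nonneg _).lt_of_ne' fun h0 => ?_
  rw [h0] at h2
  simp at h2

theorem chartPoint_sub (u : ℤ × ℤ) (β : ℤ) (ξ η ξ' η' : ℝ) :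
    chartPoint u β ξ η - chartPoint u β ξ' η' = chartPoint u β (ξ - ξ') (η - η') := by
  apply Complex.ext <;> simp only [chartPoint, Complex.sub_re, Complex.sub_im] <;> ring

theorem chartPoint_smul (u : ℤ × ℤ) (β : ℤ) (c ξ η : ℝ) :
    c • chartPoint u β ξ η = chartPoint u β (c * ξ) (c * η) := by
  apply Complex.ext <;> simp only [chartPoint, Complex.smul_re, Complex.smul_im, smul_eq_mul] <;> ring

/-- Increments of the tent function along steps that follow the direction `V`. -/
theorem tent_increment {N : ℕ} (hN : 0 < N) {z V : ℂ} {x x' : ℤ × ℤ} {δ κ : ℝ} (hδ : 0 < δ)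
    (hV : V ≠ 0) {j : ℝ} (hj : 0 < j)
    (h1 : ‖(N : ℝ) • (siteCentre N x - z) - j • V‖ + 1 ≤ 2 * κ * j)
    (h2 : ‖(N : ℝ) • (siteCentre N x' - z) - j • V‖ + 1 ≤ 2 * κ * j) :
    (j * ‖V‖ + 3 * κ * j ≤ δ * N →
      |tent N z δ x' - tent N z δ x +
        dot ((N : ℝ) • (siteCentre N x' - siteCentre N x)) V / (‖V‖ * (δ * N))| ≤
        ‖(N : ℝ) • (siteCentre N x' - siteCentre N x)‖ * (4 * κ / ‖V‖) / (δ * N)) ∧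
    (δ * N ≤ j * ‖V‖ - 3 * κ * j → tent N z δ x' - tent N z δ x = 0) := by
  have hN' : (0 : ℝ) < N := by exact_mod_cast hN
  have hV' : 0 < ‖V‖ := norm_pos_iff.2 hV
  have hκ : 0 < κ := by
    have : 0 < 2 * κ * j := lt_of_lt_of_le (by positivity) h1
    by_contra h
    nlinarith
  have hκj : 0 < κ * j := by positivity
  have hjV : ‖(j : ℝ) • V‖ = j * ‖V‖ := by rw [norm_smul, Real.norm_eq_abs, abs_of_pos hj]
  have hdist : ∀ y : ℤ × ℤ, ‖(N : ℝ) • (siteCentre N y - z) - j • V‖ + 1 ≤ 2 * κ * j →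
      |N * Metric.infDist z (latticeBox N y) - j * ‖V‖| ≤ 2 * κ * j := by
    intro y hy
    have e1 := abs_infDist_sub_norm_le hN z y
    have e2 := abs_norm_sub_norm_le ((N : ℝ) • (siteCentre N y - z)) (j • V)
    rw [hjV, norm_smul, Real.norm_eq_abs, abs_of_pos hN'] at e2
    have e3 : |N * Metric.infDist z (latticeBox N y) - N * ‖siteCentre N y - z‖| ≤ 1 := by
      rw [← mul_sub, abs_mul, abs_of_pos hN']
      calc (N : ℝ) * |Metric.infDist z (latticeBox N y) - ‖siteCentre N y - z‖| ≤ N * (1 / N) := by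
            gcongr
        _ = 1 := by field_simp
    have := abs_le.1 e2
    have := abs_le.1 e3
    rw [abs_le]
    constructor <;> linarith
  have d1 := abs_le.1 (hdist x h1)
  have d2 := abs_le.1 (hdist x' h2)
  constructor
  · intro hle
    have hin : ∀ y, N * Metric.infDist z (latticeBox N y) - j * ‖V‖ ≤ 2 * κ * j →
        tent N z δ y = 1 - Metric.infDist z (latticeBox N y) / δ := by
      intro y hy
      rw [tent, max_eq_right]
      rw [sub_nonneg, div_le_one hδ]
      refine le_of_mul_le_mul_left ?_ hN'
      linarith
    rw [hin x d1.2, hin x' d2.2]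
    set v := siteCentre N x' - siteCentre N x with hv
    set b : ℂ := (j / N) • V with hb
    have hbn : ‖b‖ = j * ‖V‖ / N := by
      rw [hb, norm_smul, Real.norm_eq_abs, abs_of_pos (by positivity)]; ring
    have hb0 : b ≠ 0 := by rw [← norm_pos_iff, hbn]; positivity
    -- The summand `1` in `h1` and `h2` pays for the distance, scaled by `N`, between a point of the
    -- box and its centre.
    have hEE : ∀ y : ℤ × ℤ, ‖(N : ℝ) • (siteCentre N y - z) - j • V‖ + 1 ≤ 2 * κ * j →
        ∀ a ∈ latticeBox N y, ‖a - z - b‖ ≤ 2 * κ * j / N := by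
      intro y hy a ha
      have f1 := norm_sub_siteCentre_le hN ha
      have f2 : siteCentre N y - z - b = (N : ℝ)⁻¹ • ((N : ℝ) • (siteCentre N y - z) - j • V) := by
        rw [smul_sub, inv_smul_smul₀ hN'.ne', smul_smul, hb, inv_mul_eq_div]
      have f3 : ‖siteCentre N y - z - b‖ ≤ (2 * κ * j - 1) / N := by
        rw [f2, norm_smul, norm_inv, Real.norm_natCast, inv_mul_eq_div]
        gcongr
        linarith
      rw [show a - z - b = (a - siteCentre N y) + (siteCentre N y - z - b) by ring]
      refine (norm_add_le _ _).trans ((add_le_add f1 f3).trans (le_of_eq ?_))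
      ring
    have hkey := abs_infDist_sub_le hN (z := z) (x := x) (x' := x') (d := dot v (‖b‖⁻¹ • b))
      (ε := ‖v‖ * (2 * (2 * κ * j / N) / ‖b‖)) (fun a ha => by
        refine abs_norm_add_sub_norm_sub_le hb0 (hEE x h1 a ha) ?_
        have := hEE x' h2 _ (mem_latticeBox_add_sub (x' := x') ha)
        rwa [show a + (siteCentre N x' - siteCentre N x) - z - b = a - z + v - b by
          rw [hv]; ring] at this) hv
    have hbv : dot v (‖b‖⁻¹ • b) = dot v V / ‖V‖ := by
      rw [hbn, hb, smul_smul, dot_smul_right]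
      field_simp
    rw [hbv, hbn] at hkey
    rw [norm_smul, dot_smul_left, Real.norm_natCast]
    have e4 : 1 - Metric.infDist z (latticeBox N x') / δ - (1 - Metric.infDist z (latticeBox N x) / δ) +
        N * dot v V / (‖V‖ * (δ * N)) = -((Metric.infDist z (latticeBox N x') -
          Metric.infDist z (latticeBox N x) - dot v V / ‖V‖) / δ) := by
      field_simp; ring
    rw [e4, abs_neg, abs_div, abs_of_pos hδ]
    calc _ ≤ ‖v‖ * (2 * (2 * κ * j / N) / (j * ‖V‖ / N)) / δ := by gcongr
      _ = _ := by field_simp; ring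
  · intro hle
    have hout : ∀ y, -(2 * κ * j) ≤ N * Metric.infDist z (latticeBox N y) - j * ‖V‖ →
        tent N z δ y = 0 := by
      intro y hy
      rw [tent, max_eq_left]
      rw [sub_nonpos, one_le_div hδ]
      refine le_of_mul_le_mul_left ?_ hN'
      linarith
    rw [hout x d1.1, hout x' d2.1, sub_self]

/-! ### The flux through an end of a differentiable graph -/

set_option maxHeartbeats 1000000 in
-- The two ends are treated together: `ς` is the direction in which the interface leaves the ball,
-- `(p, q)` and `(p', q')` are the two sites of the `j`-th step counted outwards, and `c₀` is
-- subtracted from the steps of `h`. The first `J` steps lie where `w` still feels the ball, and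
-- only a crude bound is required there. `G` is needed only on steps with `c j ≠ 0`, which is why
-- the choice of `c₀` matters in the sheared chart.
theorem end_flux {u : ℤ × ℤ} (hu : IsUnitVector u) {β : ℤ} (hβ : β = 0 ∨ β = 1) {g : ℝ → ℝ}
    (hg : ∀ x y, |g x - g y| ≤ |x - y|) {ξ m : ℝ} (hder : HasDerivAt g m ξ) (hm : |m| ≤ 1)
    {K J K' G c₀ : ℝ} (hK : 1 ≤ K) (hJ : 0 ≤ J) (hK' : 0 ≤ K') (hμ : |m - c₀| ≤ 1) :
    ∀ ε > 0, ∃ δ₀ > 0, ∀ δ : ℝ, 0 < δ → δ < δ₀ → ∃ N₀ : ℕ, ∀ N : ℕ, N₀ ≤ N →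
      ∀ (ς : ℝ), (ς = 1 ∨ ς = -1) → ∀ M : ℕ,
      2 * (δ * N) + ‖chartPoint u β 1 m‖ ≤ M * ‖chartPoint u β 1 m‖ →
      M * ‖chartPoint u β 1 m‖ ≤ 3 * (δ * N) →
      ∀ (p q p' q' : ℕ → ℤ) (c : ℕ → ℝ) (w : ℤ × ℤ → ℝ),
      (∀ j < M, |(p j : ℝ) - (N * ξ + ς * j)| ≤ K) →
      (∀ j < M, |(p' j : ℝ) - (N * ξ + ς * j)| ≤ K) →
      (∀ j < M, |(q j : ℝ) - N * g (p j / N)| ≤ K) →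
      (∀ j < M, |(q' j : ℝ) - N * g (p' j / N)| ≤ K) →
      (∀ j, |c j| ≤ 1) →
      (∀ j < M, c j ≠ 0 → dot (chartPoint u β (p' j - p j) (q' j - q j))
        (ς • chartPoint u β 1 m) = G) →
      (∀ k ≤ M, |(∑ j ∈ Finset.range k, c j) -
        (ς * N * (g (ξ + ς * k / N) - g ξ) - c₀ * k)| ≤ K) →
      (∀ j < M, (j : ℝ) ≤ J →
        |w (site u β (p' j) (q' j)) - w (site u β (p j) (q j))| ≤ K' / (δ * N)) →
      (∀ j < M, J ≤ (j : ℝ) →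
        w (site u β (p j) (q j)) =
          tent N (chartPoint u β ξ (g ξ)) δ (site u β (p j) (q j)) ∧
        w (site u β (p' j) (q' j)) =
          tent N (chartPoint u β ξ (g ξ)) δ (site u β (p' j) (q' j))) →
      |(∑ j ∈ Finset.range M, c j *
        (w (site u β (p' j) (q' j)) - w (site u β (p j) (q j)))) +
          G * (m - c₀) / ‖chartPoint u β 1 m‖ ^ 2| ≤ ε := by
  intro ε hε
  set V := chartPoint u β 1 m with hV
  set l := ‖V‖ with hl
  have hl0 : 0 < l := norm_chartPoint_pos hu β m
  have hV0 : V ≠ 0 := norm_pos_iff.1 hl0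
  -- The four summands cover the error of `tent_increment` (displacement at most `10K`, relative
  -- error `4κ/l`), the Lipschitz bound for a tent increment, the main term, and the crude bound on
  -- the first `J` steps.
  set B : ℝ := 40 * K / l + 10 * K + |G| / l + K' with hB
  have hB1 : 40 * K / l ≤ B := by rw [hB]; have : 0 ≤ |G| / l := by positivity
                                  linarith
  have hB2 : 10 * K ≤ B := by
    rw [hB]; have : 0 ≤ |G| / l := by positivity
    have : 0 ≤ 40 * K / l := by positivity
    linarith
  have hB3 : |G| / l ≤ B := by
    rw [hB]
    have : 0 ≤ 40 * K / l := by positivity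
    linarith
  have hB4 : K' ≤ B := by
    rw [hB]
    have : 0 ≤ |G| / l := by positivity
    have : 0 ≤ 40 * K / l := by positivity
    linarith
  have hB0 : 0 < B := by linarith
  obtain ⟨κ, hκ0, hκ1, hκl, hκε⟩ : ∃ κ : ℝ, 0 < κ ∧ κ ≤ 1 ∧ 6 * κ ≤ l ∧
      B * (κ * (2 / l + 12 / l ^ 2)) ≤ ε / 2 := by
    have hc : 0 < B * (2 / l + 12 / l ^ 2) := by positivity
    refine ⟨min 1 (min (l / 6) (ε / 2 / (B * (2 / l + 12 / l ^ 2)))), by positivity,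
      min_le_left _ _, ?_, ?_⟩
    · have := (min_le_right 1 (min (l / 6) (ε / 2 / (B * (2 / l + 12 / l ^ 2))))).trans
        (min_le_left _ _)
      linarith
    · have := (min_le_right 1 (min (l / 6) (ε / 2 / (B * (2 / l + 12 / l ^ 2))))).trans
        (min_le_right _ _)
      rw [le_div_iff₀ hc] at this
      calc _ = _ := by ring
        _ ≤ ε / 2 := this
  have hlin := (hasDerivAt_iff_isLittleO.1 hder).def (show 0 < κ / 2 by positivity)
  obtain ⟨ρ, hρ0, hρ⟩ := Metric.eventually_nhds_iff.1 hlin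
  have hρ' : ∀ x, |x - ξ| < ρ → |g x - g ξ - m * (x - ξ)| ≤ κ / 2 * |x - ξ| := by
    intro x hx
    have := hρ (y := x) (by rwa [Real.dist_eq])
    simpa [Real.norm_eq_abs, mul_comm] using this
  -- With `M l ≤ 3δN` this keeps every index below `ρN/2`, hence within the range of the first-order
  -- expansion of `g`.
  refine ⟨ρ * l / 6, by positivity, fun δ hδ0 hδ => ?_⟩
  obtain ⟨N₀, hN₀⟩ := exists_nat_gt (max (2 * K / ρ + 1) (max (((8 * K + J) / κ + 2) * (2 * l) / δ)
    (B * (8 * (8 * K + J) / κ) * 2 / (ε * δ))))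
  refine ⟨N₀, fun N hN ς hς M hM1 hM2 p q p' q' c w hp hp' hq hq' hc hcG hsum hw1 hw2 => ?_⟩
  have hNN : (N₀ : ℝ) ≤ N := by exact_mod_cast hN
  have hNb := hN₀.le.trans hNN
  have hN1 : 2 * K / ρ + 1 ≤ N := (le_max_left _ _).trans hNb
  have hN2 : ((8 * K + J) / κ + 2) * (2 * l) / δ ≤ N :=
    ((le_max_left _ _).trans (le_max_right _ _)).trans hNb
  have hN3 : B * (8 * (8 * K + J) / κ) * 2 / (ε * δ) ≤ N :=
    ((le_max_right _ _).trans (le_max_right _ _)).trans hNb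
  have hN' : (0 : ℝ) < N := lt_of_lt_of_le (by positivity) hN1
  have hNpos : 0 < N := by exact_mod_cast hN'
  have hR0 : 0 < δ * N := by positivity
  have hς2 : ς * ς = 1 := by rcases hς with rfl | rfl <;> norm_num
  have hςa : |ς| = 1 := by rcases hς with rfl | rfl <;> norm_num
  have hKρ : 2 * K < ρ * N := by
    have : 2 * K / ρ < N := by linarith
    rw [div_lt_iff₀ hρ0] at this
    linarith
  have hMρ : (M : ℝ) ≤ ρ * N / 2 := by
    have : (M : ℝ) * l ≤ ρ * N / 2 * l := by nlinarith
    exact le_of_mul_le_mul_right this hl0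
  have hdev : ∀ y : ℝ, |y| < ρ * N → |N * (g (ξ + y / N) - g ξ) - m * y| ≤ κ / 2 * |y| := by
    intro y hy
    have h1 := hρ' (ξ + y / N) (by
      rw [add_sub_cancel_left, abs_div, abs_of_pos hN', div_lt_iff₀ hN']; exact hy)
    rw [add_sub_cancel_left] at h1
    have e : N * (g (ξ + y / N) - g ξ) - m * y = N * (g (ξ + y / N) - g ξ - m * (y / N)) := by
      field_simp
    rw [e, abs_mul, abs_of_pos hN']
    calc (N : ℝ) * |g (ξ + y / N) - g ξ - m * (y / N)| ≤ N * (κ / 2 * |y / N|) := by gcongr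
      _ = κ / 2 * |y| := by rw [abs_div, abs_of_pos hN']; field_simp
  have hpos : ∀ j < M, ∀ (a b : ℤ), |(a : ℝ) - (N * ξ + ς * j)| ≤ K → |(b : ℝ) - N * g (a / N)| ≤ K →
      ‖(N : ℝ) • (siteCentre N (site u β a b) - chartPoint u β ξ (g ξ)) - (j : ℝ) • (ς • V)‖ + 1 ≤
        8 * K + κ * j := by
    intro j hj a b ha hb
    have hjM : (j : ℝ) ≤ M := by exact_mod_cast hj.le
    have e : (N : ℝ) • (siteCentre N (site u β a b) - chartPoint u β ξ (g ξ)) - (j : ℝ) • (ς • V) =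
        chartPoint u β (a - (N * ξ + ς * j)) (b - N * g ξ - j * ς * m) := by
      rw [siteCentre_site, chartPoint_sub, chartPoint_smul, hV, chartPoint_smul, chartPoint_smul,
        chartPoint_sub]
      congr 1
      · field_simp; ring
      · field_simp
    have ha' : |(a : ℝ) - N * ξ| ≤ K + j := by
      have : (a : ℝ) - N * ξ = (a - (N * ξ + ς * j)) + ς * j := by ring
      rw [this]
      refine (abs_add_le _ _).trans (add_le_add ha ?_)
      rw [abs_mul, hςa, one_mul, Nat.abs_cast]
    have h2 := hdev (a - N * ξ) (by linarith)
    rw [show ξ + ((a : ℝ) - N * ξ) / N = a / N by field_simp; ring] at h2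
    have hb' : |(b : ℝ) - N * g ξ - j * ς * m| ≤ K + κ / 2 * (K + j) + K := by
      have : (b : ℝ) - N * g ξ - j * ς * m = (b - N * g (a / N)) +
        (N * (g (a / N) - g ξ) - m * (a - N * ξ)) + m * (a - (N * ξ + ς * j)) := by ring
      rw [this]
      refine (abs_add_le _ _).trans (add_le_add ((abs_add_le _ _).trans (add_le_add hb ?_)) ?_)
      · exact h2.trans (by gcongr)
      · rw [abs_mul]
        calc |m| * |(a : ℝ) - (N * ξ + ς * j)| ≤ 1 * K := by gcongr
          _ = K := one_mul K
    rw [e]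
    have h3 := norm_chartPoint_le hu hβ (a - (N * ξ + ς * j)) (b - N * g ξ - j * ς * m)
    have : κ * K ≤ K := by nlinarith
    linarith
  have hstep : ∀ j < M, ‖(N : ℝ) • (siteCentre N (site u β (p' j) (q' j)) -
      siteCentre N (site u β (p j) (q j)))‖ ≤ 10 * K := by
    intro j hj
    rw [siteCentre_site, siteCentre_site, chartPoint_sub, chartPoint_smul]
    refine (norm_chartPoint_le hu hβ _ _).trans ?_
    have e1 : (N : ℝ) * ((p' j : ℝ) / N - p j / N) = p' j - p j := by field_simp
    have e2 : (N : ℝ) * ((q' j : ℝ) / N - q j / N) = q' j - q j := by field_simp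
    rw [e1, e2]
    have h1 : |(p' j : ℝ) - p j| ≤ 2 * K := by
      have := abs_le.1 (hp j hj)
      have := abs_le.1 (hp' j hj)
      rw [abs_le]; constructor <;> linarith
    have h2 : |(q' j : ℝ) - q j| ≤ 4 * K := by
      have h3 := abs_le.1 (hq j hj)
      have h4 := abs_le.1 (hq' j hj)
      have h5 := hg (p' j / N) (p j / N)
      rw [← sub_div, abs_div, abs_of_pos hN', le_div_iff₀ hN'] at h5
      have h6 : |N * g (p' j / N) - N * g (p j / N)| ≤ 2 * K := by
        rw [← mul_sub, abs_mul, abs_of_pos hN']; linarith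
      have h7 := abs_le.1 h6
      rw [abs_le]; constructor <;> linarith
    linarith
  have hςV : ‖ς • V‖ = l := by rw [norm_smul, Real.norm_eq_abs, hςa, one_mul]
  have hgdot : ∀ j < M, c j ≠ 0 → dot ((N : ℝ) • (siteCentre N (site u β (p' j) (q' j)) -
      siteCentre N (site u β (p j) (q j)))) (ς • V) = G := by
    intro j hj hcj
    rw [siteCentre_site, siteCentre_site, chartPoint_sub, chartPoint_smul, ← hcG j hj hcj]
    congr 2 <;> field_simp
  have hinc : ∀ j < M, (8 * K + J) / κ ≤ j → _ := fun j hj hjK =>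
    tent_increment hNpos (z := chartPoint u β ξ (g ξ)) (V := ς • V) (x := site u β (p j) (q j))
      (x' := site u β (p' j) (q' j)) (κ := κ) (j := j) hδ0
      (norm_pos_iff.1 (by rw [hςV]; exact hl0)) (lt_of_lt_of_le (by positivity) hjK)
      ((hpos j hj _ _ (hp j hj) (hq j hj)).trans (by
        rw [div_le_iff₀ hκ0] at hjK; linarith))
      ((hpos j hj _ _ (hp' j hj) (hq' j hj)).trans (by
        rw [div_le_iff₀ hκ0] at hjK; linarith))
  rw [hςV] at hinc
  have h8K : ∀ j : ℕ, (8 * K + J) / κ ≤ j → J ≤ j := fun j hj => by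
    refine le_trans ?_ hj
    rw [le_div_iff₀ hκ0]
    nlinarith
  -- Taking `8K + J` in place of `K` makes the discarded initial segment contain the first `J`
  -- steps.
  have hmain := abs_sum_range_add_le (c := c)
    (t := fun j => w (site u β (p' j) (q' j)) - w (site u β (p j) (q j))) (M := M) (G := G)
    (μ := m - c₀) (B := B) (K := 8 * K + J) (κ := κ) (R := δ * N) (l := l) hl0 hκ0 hκ1 hκl (by linarith)
    hμ hB3 hc ?_ hM1 ?_ ?_ ?_ ?_
  · refine hmain.trans ?_
    rw [mul_add]
    have : B * (8 * (8 * K + J) / (κ * (δ * N))) ≤ ε / 2 := by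
      rw [div_le_iff₀ (by positivity)] at hN3
      rw [← mul_div_assoc, div_le_iff₀ (by positivity)]
      have e : B * (8 * (8 * K + J) / κ) * 2 = (B * (8 * (8 * K + J)) * 2) / κ := by ring
      rw [e, div_le_iff₀ hκ0] at hN3
      linarith
    linarith
  · rw [div_le_iff₀ hδ0] at hN2
    linarith
  · intro k hk
    have hkM : (k : ℝ) ≤ M := by exact_mod_cast hk
    have h1 := hdev (ς * k) (by rw [abs_mul, hςa, one_mul, Nat.abs_cast]; linarith)
    rw [abs_mul, hςa, one_mul, Nat.abs_cast] at h1
    have h2 : |ς * (N * (g (ξ + ς * k / N) - g ξ) - m * (ς * k))| ≤ κ / 2 * k := by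
      rw [abs_mul, hςa, one_mul]; exact h1
    have e : (∑ j ∈ Finset.range k, c j) - k * (m - c₀) =
        ((∑ j ∈ Finset.range k, c j) - (ς * N * (g (ξ + ς * k / N) - g ξ) - c₀ * k)) +
        ς * (N * (g (ξ + ς * k / N) - g ξ) - m * (ς * k)) + (ς * ς - 1) * (m * k) := by ring
    rw [e, hς2, sub_self, zero_mul, add_zero]
    refine (abs_add_le _ _).trans ?_
    have h3 := hsum k hk
    have : κ / 2 * k ≤ κ * k := by gcongr; linarith
    linarith
  · intro j hj
    rcases le_total (j : ℝ) J with h | h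
    · refine (hw1 j hj h).trans ?_
      gcongr
    · obtain ⟨e1, e2⟩ := hw2 j hj h
      simp only [e1, e2]
      refine (abs_tent_sub_le hNpos _ hδ0 _ _).trans ?_
      have := hstep j hj
      rw [norm_smul, Real.norm_natCast] at this
      rw [div_le_div_iff₀ hδ0 hR0]
      have h3 := this.trans hB2
      nlinarith
  · intro j hj hjK hle
    rcases eq_or_ne (c j) 0 with h0 | h0
    · rw [h0]; simp only [zero_mul, add_zero, abs_zero]; positivity
    · obtain ⟨e1, e2⟩ := hw2 j hj (h8K j hjK)
      have h1 := (hinc j hj hjK).1 hle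
      rw [hgdot j hj h0] at h1
      simp only [e1, e2]
      rw [← mul_add, abs_mul]
      calc _ ≤ 1 * (10 * K * (4 * κ / l) / (δ * N)) := by
            gcongr
            · exact hc j
            · refine h1.trans ?_
              gcongr
              exact hstep j hj
        _ = (40 * K / l) * κ / (δ * N) := by ring
        _ ≤ _ := by gcongr
  · intro j hj hjK hle
    obtain ⟨e1, e2⟩ := hw2 j hj (h8K j hjK)
    simp only [e1, e2]
    exact (hinc j hj hjK).2 hle

/-! ### Weights along the interface -/

theorem sum_range_window {F : ℤ → ℝ} {a b : ℤ} {A M : ℕ} (hab : a ≤ b) (hba : b + M ≤ a + A)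
    (h1 : ∀ n, a ≤ n → n < b → F n = 0) (h2 : ∀ n, b + M ≤ n → n < a + A → F n = 0) :
    ∑ k ∈ Finset.range A, F (a + k) = ∑ j ∈ Finset.range M, F (b + j) := by
  obtain ⟨i, rfl⟩ : ∃ i : ℕ, b = a + i := ⟨(b - a).toNat, by omega⟩
  obtain ⟨e, rfl⟩ : ∃ e : ℕ, A = i + (M + e) := ⟨A - i - M, by omega⟩
  rw [Finset.sum_range_add, Finset.sum_range_add, Finset.sum_eq_zero, zero_add]
  · rw [add_eq_left.2]
    · refine Finset.sum_congr rfl fun j _ => ?_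
      push_cast; rw [add_assoc]
    · refine Finset.sum_eq_zero fun k hk => ?_
      rw [Finset.mem_range] at hk
      refine h2 _ ?_ ?_ <;> push_cast <;> omega
  · intro k hk
    rw [Finset.mem_range] at hk
    exact h1 _ (by omega) (by omega)

/-- The asymptotic frequency of the steps that do not bend the interface, for slopes above `1/2` in a
sheared chart. -/
def stepOffset (β : ℤ) (m : ℝ) : ℤ := if β = 1 ∧ 1 / 2 < m then 1 else 0

/-- The scalar product of the bending steps with the tangent vector. -/
def stepDot (β : ℤ) (m : ℝ) : ℝ := if β = 1 ∧ 1 / 2 < m then m else 1 - β * m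

/-- Twice the flux through an end of the interface with slope `m`. -/
def endFlux (β : ℤ) (m : ℝ) : ℝ :=
  stepDot β m * (m - stepOffset β m) / ((1 - β * m) ^ 2 + m ^ 2) + stepOffset β m

theorem dot_chartPoint {u : ℤ × ℤ} (hu : IsUnitVector u) (β : ℤ) (a b c d : ℝ) :
    dot (chartPoint u β a b) (chartPoint u β c d) = (a - β * b) * (c - β * d) + b * d := by
  simp only [dot, chartPoint]
  linear_combination ((a - β * b) * (c - β * d) + b * d) * hu.sq_real

theorem innerRow_bounds {β : ℤ} (hβ : β = 0 ∨ β = 1) {h : ℤ → ℤ}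
    (hst : ∀ n, -(1 - β) ≤ h (n + 1) - h n ∧ h (n + 1) - h n ≤ 1) (n : ℤ) :
    |innerRow β h n - h n| ≤ 1 ∧ |outerRow β h n - h (n + 1)| ≤ 1 := by
  have h1 := hst n
  have h2 := hst (n + 1)
  rcases hβ with rfl | rfl
  · simp only [innerRow, outerRow, if_true]
    constructor <;> rw [abs_le] <;> constructor <;> omega
  · simp only [innerRow, outerRow, one_ne_zero, if_false]
    constructor <;> split_ifs <;> simp

/-- For `β = 1` and `m < 1/2` a rise has flat steps on both sides, so its displacement is exactly
`u`. For `m > 1/2` a flat step has rises on both sides, and its displacement is exactly `iu`. At `m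
= 1/2` the tangent is diagonal and every displacement `(1, k)` has the same component along it. -/
theorem dot_step {u : ℤ × ℤ} (hu : IsUnitVector u) {β : ℤ} (hβ : β = 0 ∨ β = 1) {h : ℤ → ℤ}
    (hst : ∀ n, -(1 - β) ≤ h (n + 1) - h n ∧ h (n + 1) - h n ≤ 1) {m : ℝ} {n : ℤ}
    (hlt : m < 1 / 2 → β = 1 → h (n + 2) ≤ h n + 1 ∧ h (n + 1) ≤ h (n - 1) + 1)
    (hgt : 1 / 2 < m → β = 1 → h (n - 1) + 1 ≤ h (n + 1) ∧ h n + 1 ≤ h (n + 2))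
    (hne : h (n + 1) - h n ≠ stepOffset β m) :
    dot (chartPoint u β 1 ((outerRow β h n : ℝ) - innerRow β h n)) (chartPoint u β 1 m) =
      stepDot β m := by
  rw [dot_chartPoint hu]
  have h1 := hst n
  have h2 := hst (n + 1)
  have h3 := hst (n - 1)
  rw [sub_add_cancel] at h3
  rw [show n + 1 + 1 = n + 2 by ring] at h2
  rcases hβ with rfl | rfl
  · simp [innerRow, outerRow, stepDot]
  · rcases lt_trichotomy m (1 / 2) with hm | hm | hm
    · obtain ⟨a1, a2⟩ := hlt hm rfl
      rw [stepOffset, if_neg (by rintro ⟨-, h⟩; linarith)] at hne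
      rw [stepDot, if_neg (by rintro ⟨-, h⟩; linarith)]
      have e : outerRow 1 h n = innerRow 1 h n := by
        simp only [innerRow, outerRow, one_ne_zero, if_false, add_sub_cancel_right]
        split_ifs <;> omega
      rw [e]
      push_cast; ring
    · rw [stepDot, if_neg (by rintro ⟨-, h⟩; linarith), hm]
      push_cast; ring
    · obtain ⟨a1, a2⟩ := hgt hm rfl
      rw [stepOffset, if_pos ⟨rfl, hm⟩] at hne
      rw [stepDot, if_pos ⟨rfl, hm⟩]
      have e : outerRow 1 h n = innerRow 1 h n + 1 := by
        simp only [innerRow, outerRow, one_ne_zero, if_false, add_sub_cancel_right,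
          show n + 1 + 1 = n + 2 by ring]
        split_ifs <;> omega
      rw [e]
      push_cast; ring

/-! ### Weights of sites near a graph -/

/-- The point of the graph of `g` above `x`. -/
def graphPoint (u : ℤ × ℤ) (β : ℤ) (g : ℝ → ℝ) (x : ℝ) : ℂ := chartPoint u β x (g x)

/-- Near the point above `ξ`, the set `D` is the epigraph of `g` in a lattice chart. -/
structure GraphChart (D : Set ℂ) (u : ℤ × ℤ) (β : ℤ) (g : ℝ → ℝ) (ξ ρ c : ℝ) : Prop where
  unit : IsUnitVector u
  shear : β = 0 ∨ β = 1
  slope : ∀ x y, x ≤ y → -(1 - β) * (y - x) ≤ g y - g x ∧ g y - g x ≤ y - x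
  radius_pos : 0 < ρ
  growth_pos : 0 < c
  mem_iff : ∀ z, |chartFst u β z - ξ| < ρ → |chartSnd u z - g ξ| < 2 * ρ →
    (z ∈ D ↔ g (chartFst u β z) ≤ chartSnd u z)
  growth_right : ∀ x y, ξ ≤ x → x ≤ y → y ≤ ξ + ρ →
    ‖graphPoint u β g x - graphPoint u β g ξ‖ + c * (y - x) ≤
      ‖graphPoint u β g y - graphPoint u β g ξ‖
  growth_left : ∀ x y, ξ - ρ ≤ x → x ≤ y → y ≤ ξ →
    ‖graphPoint u β g y - graphPoint u β g ξ‖ + c * (y - x) ≤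
      ‖graphPoint u β g x - graphPoint u β g ξ‖

theorem abs_chartFst_le {u : ℤ × ℤ} (hu : IsUnitVector u) {β : ℤ} (hβ : β = 0 ∨ β = 1) (z : ℂ) :
    |chartFst u β z| ≤ 2 * ‖z‖ := by
  have h := norm_chartPoint_sq hu β (chartFst u β z) (chartSnd u z)
  rw [chartPoint_chart hu] at h
  refine abs_le_of_sq_le_sq ?_ (by positivity)
  rw [mul_pow, h]
  rcases hβ with rfl | rfl
  · push_cast; nlinarith [sq_nonneg (chartFst u 0 z), sq_nonneg (chartSnd u z)]
  · push_cast
    nlinarith [sq_nonneg (chartFst u 1 z), sq_nonneg (chartSnd u z),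
      sq_nonneg (chartFst u 1 z - 2 * chartSnd u z)]

theorem abs_chartSnd_le {u : ℤ × ℤ} (hu : IsUnitVector u) (z : ℂ) : |chartSnd u z| ≤ ‖z‖ := by
  have h := norm_chartPoint_sq hu 0 (chartFst u 0 z) (chartSnd u z)
  rw [chartPoint_chart hu] at h
  refine abs_le_of_sq_le_sq ?_ (by positivity)
  rw [h]
  exact le_add_of_nonneg_left (sq_nonneg _)

theorem chartFst_sub (u : ℤ × ℤ) (β : ℤ) (z w : ℂ) :
    chartFst u β (z - w) = chartFst u β z - chartFst u β w := by
  simp only [chartFst, Complex.sub_re, Complex.sub_im]; ring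

theorem chartSnd_sub (u : ℤ × ℤ) (z w : ℂ) :
    chartSnd u (z - w) = chartSnd u z - chartSnd u w := by
  simp only [chartSnd, Complex.sub_re, Complex.sub_im]; ring

theorem tent_mem_Icc (N : ℕ) (z : ℂ) {δ : ℝ} (hδ : 0 < δ) (x : ℤ × ℤ) : tent N z δ x ∈ Icc 0 1 := by
  refine ⟨le_max_left _ _, max_le zero_le_one ?_⟩
  have : 0 ≤ Metric.infDist z (latticeBox N x) / δ := div_nonneg Metric.infDist_nonneg hδ.le
  linarith

theorem meets_mem_Icc (N : ℕ) (S : Set ℂ) (x : ℤ × ℤ) : meets N S x ∈ Icc 0 1 := by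
  unfold meets; split_ifs <;> simp

theorem tent_pos_imp {N : ℕ} (hN : 0 < N) {z : ℂ} {δ : ℝ} (hδ : 0 < δ) {x : ℤ × ℤ}
    (h : tent N z δ x ≠ 0) : (latticeBox N x ∩ Metric.closedBall z δ).Nonempty := by
  have h1 : Metric.infDist z (latticeBox N x) < δ := by
    by_contra! hle
    refine h (max_eq_left ?_)
    rw [sub_nonpos, one_le_div hδ]
    exact hle
  obtain ⟨y, hy, hyδ⟩ := (Metric.infDist_lt_iff (latticeBox_nonempty hN x)).1 h1
  exact ⟨y, hy, by rw [Metric.mem_closedBall, dist_comm]; exact hyδ.le⟩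

theorem averageWeight_ne_zero {N : ℕ} (hN : 0 < N) {s x₀ x₁ : ℂ} {r δ : ℝ} (hδ : 0 < δ) {x : ℤ × ℤ}
    (h : averageWeight N s x₀ x₁ r δ x ≠ 0) :
    (latticeBox N x ∩ threeBalls s x₀ x₁ r δ δ).Nonempty := by
  by_contra hne
  apply h
  have hsub : ∀ S ⊆ threeBalls s x₀ x₁ r δ δ, ¬ (latticeBox N x ∩ S).Nonempty := fun S hS hS' =>
    hne (hS'.mono (inter_subset_inter_right _ hS))
  have h0 : tent N x₀ δ x = 0 := by
    by_contra h0
    exact hsub _ (subset_union_right.trans subset_union_left) (tent_pos_imp hN hδ h0)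
  have h1 : tent N x₁ δ x = 0 := by
    by_contra h1
    exact hsub _ subset_union_right (tent_pos_imp hN hδ h1)
  have h2 : meets N (Metric.closedBall s r) x = 0 :=
    if_neg (hsub _ (subset_union_left.trans subset_union_left))
  rw [averageWeight, h0, h1, h2]
  norm_num

theorem one_sub_averageWeight {N : ℕ} (s x₀ x₁ : ℂ) (r : ℝ) {δ : ℝ} (hδ : 0 < δ) (x : ℤ × ℤ) :
    0 ≤ 1 - averageWeight N s x₀ x₁ r δ x ∧
    1 - averageWeight N s x₀ x₁ r δ x ≤ 1 - tent N x₀ δ x ∧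
    1 - averageWeight N s x₀ x₁ r δ x ≤ 1 - tent N x₁ δ x := by
  obtain ⟨a1, a2⟩ := meets_mem_Icc N (Metric.closedBall s r) x
  obtain ⟨b1, b2⟩ := tent_mem_Icc N x₀ hδ x
  obtain ⟨c1, c2⟩ := tent_mem_Icc N x₁ hδ x
  have e : 1 - averageWeight N s x₀ x₁ r δ x = (1 - meets N (Metric.closedBall s r) x) *
    (1 - tent N x₀ δ x) * (1 - tent N x₁ δ x) := by rw [averageWeight]; ring
  rw [e]
  have hA := sub_nonneg.2 a2
  have hB := sub_nonneg.2 b2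
  have hC := sub_nonneg.2 c2
  have hA1 := sub_le_self 1 a1
  have hB1 := sub_le_self 1 b1
  have hC1 := sub_le_self 1 c1
  refine ⟨by positivity, ?_, ?_⟩
  · calc _ ≤ 1 * (1 - tent N x₀ δ x) * 1 := by gcongr
      _ = _ := by ring
  · calc _ ≤ 1 * 1 * (1 - tent N x₁ δ x) := by gcongr
      _ = _ := by ring

namespace GraphChart

variable {D : Set ℂ} {u : ℤ × ℤ} {β : ℤ} {g : ℝ → ℝ} {ξ ρ c : ℝ}

theorem abs_sub_le (hC : GraphChart D u β g ξ ρ c) (x y : ℝ) : |g x - g y| ≤ |x - y| := by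
  have key : ∀ x y, x ≤ y → |g x - g y| ≤ |x - y| := by
    intro x y hxy
    obtain ⟨h1, h2⟩ := hC.slope x y hxy
    rw [abs_of_nonpos (sub_nonpos.2 hxy), abs_le]
    rcases hC.shear with rfl | rfl
    · push_cast at h1; constructor <;> linarith
    · push_cast at h1; constructor <;> linarith
  rcases le_total x y with h | h
  · exact key x y h
  · rw [abs_sub_comm (g x), abs_sub_comm x]; exact key y x h

theorem norm_graphPoint_sub_le (hC : GraphChart D u β g ξ ρ c) (x y : ℝ) :
    ‖graphPoint u β g x - graphPoint u β g y‖ ≤ 3 * |x - y| := by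
  rw [graphPoint, graphPoint, chartPoint_sub]
  have h1 := norm_chartPoint_le hC.unit hC.shear (x - y) (g x - g y)
  have h2 := hC.abs_sub_le x y
  linarith

theorem abs_sub_le_norm (hC : GraphChart D u β g ξ ρ c) (x y : ℝ) :
    |x - y| ≤ 2 * ‖graphPoint u β g x - graphPoint u β g y‖ := by
  have := abs_chartFst_le hC.unit hC.shear (graphPoint u β g x - graphPoint u β g y)
  rwa [chartFst_sub, graphPoint, graphPoint, chartFst_chartPoint hC.unit,
    chartFst_chartPoint hC.unit] at this

theorem norm_siteCentre_sub_le (hC : GraphChart D u β g ξ ρ c) {N : ℕ} (hN : 0 < N) {n a : ℤ}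
    (ha : |(a : ℝ) - N * g (n / N)| ≤ 3) :
    ‖siteCentre N (site u β n a) - graphPoint u β g (n / N)‖ ≤ 6 / N := by
  have hN' : (0 : ℝ) < N := by exact_mod_cast hN
  rw [siteCentre_site, graphPoint, chartPoint_sub]
  refine (norm_chartPoint_le hC.unit hC.shear _ _).trans ?_
  rw [sub_self, abs_zero, zero_add, show (a : ℝ) / N - g (n / N) = (a - N * g (n / N)) / N by
    field_simp, abs_div, abs_of_pos hN', show (6 : ℝ) / N = 2 * (3 / N) by ring]
  gcongr

/-- At chart distance `8/(cN)` inside the crossing points, the growth condition puts the graph at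
depth at least `8/N` in the ball. This exceeds the `6/N` between a site centre and the graph. The
same margin decides the sites outside the ball. -/
theorem weight_eq_one (hC : GraphChart D u β g ξ ρ c) {N : ℕ} (hN : 0 < N) {n a : ℤ}
    (ha : |(a : ℝ) - N * g (n / N)| ≤ 3) {r δ ξ₀ ξ₁ : ℝ}
    (h0 : ‖graphPoint u β g ξ₀ - graphPoint u β g ξ‖ = r)
    (h1 : ‖graphPoint u β g ξ₁ - graphPoint u β g ξ‖ = r)
    (hξ₀ : ξ - ρ ≤ ξ₀) (hξ₁ : ξ₁ ≤ ξ + ρ)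
    (hn0 : N * ξ₀ + 8 / c ≤ n) (hn1 : n ≤ N * ξ₁ - 8 / c) (x₀ x₁ : ℂ) :
    averageWeight N (graphPoint u β g ξ) x₀ x₁ r δ (site u β n a) = 1 := by
  have hN' : (0 : ℝ) < N := by exact_mod_cast hN
  have hc := hC.growth_pos
  have hd := hC.norm_siteCentre_sub_le hN ha
  have e0 : ξ₀ + 8 / c / N ≤ n / N := by
    rw [le_div_iff₀ hN', add_mul, div_mul_cancel₀ _ hN'.ne']; linarith
  have e1 : (n : ℝ) / N ≤ ξ₁ - 8 / c / N := by
    rw [div_le_iff₀ hN', sub_mul, div_mul_cancel₀ _ hN'.ne']; linarith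
  have e2 : c * (8 / c / N) = 8 / N := by field_simp
  have e3 : 0 < 8 / c / N := by positivity
  have hball : ‖graphPoint u β g (n / N) - graphPoint u β g ξ‖ ≤ r - 8 / N := by
    rcases le_total ξ (n / N) with h | h
    · have := hC.growth_right (n / N) ξ₁ h (by linarith) hξ₁
      have : c * (8 / c / N) ≤ c * (ξ₁ - n / N) := by gcongr; linarith
      linarith
    · have := hC.growth_left ξ₀ (n / N) hξ₀ (by linarith) h
      have : c * (8 / c / N) ≤ c * (n / N - ξ₀) := by gcongr; linarith
      linarith
  have hm : meets N (Metric.closedBall (graphPoint u β g ξ) r) (site u β n a) = 1 := by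
    refine if_pos ⟨_, siteCentre_mem hN _, ?_⟩
    rw [Metric.mem_closedBall, dist_eq_norm, show siteCentre N (site u β n a) - graphPoint u β g ξ =
      (siteCentre N (site u β n a) - graphPoint u β g (n / N)) +
      (graphPoint u β g (n / N) - graphPoint u β g ξ) by ring]
    refine (norm_add_le _ _).trans ?_
    have : (6 : ℝ) / N ≤ 8 / N := by gcongr; norm_num
    linarith
  rw [averageWeight, hm]
  ring

theorem meets_eq_zero (hC : GraphChart D u β g ξ ρ c) {N : ℕ} (hN : 0 < N) {n a : ℤ}
    (ha : |(a : ℝ) - N * g (n / N)| ≤ 3) {r : ℝ}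
    (hn : r + 8 / N ≤ ‖graphPoint u β g (n / N) - graphPoint u β g ξ‖) :
    meets N (Metric.closedBall (graphPoint u β g ξ) r) (site u β n a) = 0 := by
  have hN' : (0 : ℝ) < N := by exact_mod_cast hN
  have hd := hC.norm_siteCentre_sub_le hN ha
  refine if_neg ?_
  rintro ⟨y, hy, hyr⟩
  rw [Metric.mem_closedBall, dist_eq_norm] at hyr
  have h1 := norm_sub_siteCentre_le hN hy
  have h2 : ‖graphPoint u β g (n / N) - graphPoint u β g ξ‖ ≤
      ‖siteCentre N (site u β n a) - graphPoint u β g (n / N)‖ +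
      ‖y - siteCentre N (site u β n a)‖ + ‖y - graphPoint u β g ξ‖ := by
    rw [show graphPoint u β g (n / N) - graphPoint u β g ξ =
      -(siteCentre N (site u β n a) - graphPoint u β g (n / N)) - (y - siteCentre N (site u β n a)) +
      (y - graphPoint u β g ξ) by ring]
    refine (norm_add_le _ _).trans (add_le_add ((norm_sub_le _ _).trans ?_) le_rfl)
    rw [norm_neg]
  have h3 : (8 : ℝ) / N = 6 / N + 1 / N + 1 / N := by ring
  have h4 : (0 : ℝ) < 1 / N := by positivity
  linarith

theorem tent_eq_zero_of_far (hC : GraphChart D u β g ξ ρ c) {N : ℕ} (hN : 0 < N) {n a : ℤ}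
    (ha : |(a : ℝ) - N * g (n / N)| ≤ 3) {δ x : ℝ} (hδ : 0 < δ)
    (hx : 2 * δ * N + 14 ≤ |(n : ℝ) - N * x|) :
    tent N (graphPoint u β g x) δ (site u β n a) = 0 := by
  have hN' : (0 : ℝ) < N := by exact_mod_cast hN
  have hd := hC.norm_siteCentre_sub_le hN ha
  refine tent_eq_zero hN hδ ?_
  have h1 := hC.abs_sub_le_norm (n / N) x
  rw [show (n : ℝ) / N - x = (n - N * x) / N by field_simp, abs_div, abs_of_pos hN',
    div_le_iff₀ hN'] at h1
  have h2 : ‖graphPoint u β g (n / N) - graphPoint u β g x‖ ≤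
      ‖siteCentre N (site u β n a) - graphPoint u β g (n / N)‖ +
      ‖siteCentre N (site u β n a) - graphPoint u β g x‖ := by
    rw [show graphPoint u β g (n / N) - graphPoint u β g x =
      (siteCentre N (site u β n a) - graphPoint u β g x) -
      (siteCentre N (site u β n a) - graphPoint u β g (n / N)) by ring, add_comm]
    exact norm_sub_le _ _
  have h3 : δ + 7 / N ≤ ‖graphPoint u β g (n / N) - graphPoint u β g x‖ := by
    refine le_of_mul_le_mul_right ?_ hN'
    rw [add_mul, div_mul_cancel₀ _ hN'.ne']
    linarith
  have h4 : (7 : ℝ) / N = 6 / N + 1 / N := by ring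
  linarith

theorem one_sub_tent_le (hC : GraphChart D u β g ξ ρ c) {N : ℕ} (hN : 0 < N) {n a : ℤ}
    (ha : |(a : ℝ) - N * g (n / N)| ≤ 3) {δ x : ℝ} (hδ : 0 < δ) :
    1 - tent N (graphPoint u β g x) δ (site u β n a) ≤ (7 + 3 * |(n : ℝ) - N * x|) / (δ * N) := by
  have hN' : (0 : ℝ) < N := by exact_mod_cast hN
  have hd := hC.norm_siteCentre_sub_le hN ha
  have h1 := hC.norm_graphPoint_sub_le (n / N) x
  rw [show (n : ℝ) / N - x = (n - N * x) / N by field_simp, abs_div, abs_of_pos hN'] at h1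
  have h2 := (abs_le.1 (abs_infDist_sub_norm_le hN (graphPoint u β g x) (site u β n a))).2
  have h3 : ‖siteCentre N (site u β n a) - graphPoint u β g x‖ ≤ 6 / N + 3 * (|(n : ℝ) - N * x| / N) := by
    rw [show siteCentre N (site u β n a) - graphPoint u β g x =
      (siteCentre N (site u β n a) - graphPoint u β g (n / N)) +
      (graphPoint u β g (n / N) - graphPoint u β g x) by ring]
    exact (norm_add_le _ _).trans (add_le_add hd h1)
  have h4 : 1 - Metric.infDist (graphPoint u β g x) (latticeBox N (site u β n a)) / δ ≤
      tent N (graphPoint u β g x) δ (site u β n a) := le_max_right _ _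
  have h5 : Metric.infDist (graphPoint u β g x) (latticeBox N (site u β n a)) / δ ≤
      ((7 + 3 * |(n : ℝ) - N * x|) / N) / δ := by
    gcongr
    have : (7 + 3 * |(n : ℝ) - N * x|) / N = 6 / N + 3 * (|(n : ℝ) - N * x| / N) + 1 / N := by ring
    linarith
  rw [div_div, mul_comm (N : ℝ) δ] at h5
  linarith

end GraphChart

/-! ### Discrete heights and the fluxes through the two ends -/

/-- `h` is the height function of the discretised epigraph of `g`. -/
structure IsHeight (N : ℕ) (g : ℝ → ℝ) (h : ℤ → ℤ) : Prop where
  near : ∀ n, |(h n : ℝ) - N * g (n / N)| ≤ 2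
  shift : ∀ n dn da : ℤ, (∀ x : ℝ, |x - n / N| ≤ 1 / N → g (x + dn / N) ≤ g x + da / N) →
    h (n + dn) ≤ h n + da

/-- `g` is differentiable at `ξ`, and its difference quotients near `ξ` lie on the same side of `1/2`
as its derivative. -/
structure RegularAt (g : ℝ → ℝ) (m ξ : ℝ) : Prop where
  hasDerivAt : HasDerivAt g m ξ
  half : ∃ ρ > 0, ∀ x y, |x - ξ| < ρ → |y - ξ| < ρ → x ≤ y →
    (m < 1 / 2 → g y - g x ≤ (y - x) / 2) ∧ (1 / 2 < m → (y - x) / 2 ≤ g y - g x)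

theorem eventually_le_mul_natCast {a : ℝ} (ha : 0 < a) (C : ℝ) : ∀ᶠ N : ℕ in atTop, C ≤ a * N :=
  (tendsto_natCast_atTop_atTop.const_mul_atTop ha).eventually_ge_atTop C

/-- The increment of the weight `w` along the `n`-th step of the interface. -/
def stepIncrement (u : ℤ × ℤ) (β : ℤ) (h : ℤ → ℤ) (w : ℤ × ℤ → ℝ) (n : ℤ) : ℝ :=
  w (site u β (n + 1) (outerRow β h n)) - w (site u β n (innerRow β h n))

/-- Slopes of `g` at most `1/2` forbid two consecutive rises of a staircase, and slopes at least
`1/2` forbid two consecutive flat steps. By `shift` these statements hold exactly at the lattice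
scale. -/
theorem IsHeight.half {N : ℕ} (hN : 0 < N) {g : ℝ → ℝ} {h : ℤ → ℤ} (hh : IsHeight N g h)
    {m ξ ρ : ℝ} (hρ : ∀ x y, |x - ξ| < ρ → |y - ξ| < ρ → x ≤ y →
      (m < 1 / 2 → g y - g x ≤ (y - x) / 2) ∧ (1 / 2 < m → (y - x) / 2 ≤ g y - g x))
    {n : ℤ} (hn : |(n : ℝ) - N * ξ| + 4 < ρ * N) :
    (m < 1 / 2 → h (n + 2) ≤ h n + 1 ∧ h (n + 1) ≤ h (n - 1) + 1) ∧
    (1 / 2 < m → h (n - 1) + 1 ≤ h (n + 1) ∧ h n + 1 ≤ h (n + 2)) := by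
  have hN' : (0 : ℝ) < N := by exact_mod_cast hN
  have hball : ∀ (k : ℤ) (x : ℝ) (d : ℝ), |(k : ℝ) - n| ≤ 2 → |d| ≤ 2 → |x - k / N| ≤ 1 / N →
      |k + d - (n : ℝ)| ≤ 3 → |x + d / N - ξ| < ρ := by
    intro k x d hk hd hx hkd
    have h1 : x + d / N - ξ = (x - k / N) + (k + d - n) / N + (n - N * ξ) / N := by field_simp; ring
    have h2 : |(k + d - (n : ℝ)) / N| ≤ 3 / N := by rw [abs_div, abs_of_pos hN']; gcongr
    rw [h1]
    refine lt_of_le_of_lt ((abs_add_le _ _).trans (add_le_add ((abs_add_le _ _).trans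
      (add_le_add hx h2)) le_rfl)) ?_
    rw [abs_div, abs_of_pos hN', ← add_div, ← add_div, div_lt_iff₀ hN']
    linarith
  have h2N : (0 : ℝ) ≤ 2 / N := by positivity
  have hup : m < 1 / 2 → ∀ k : ℤ, |(k : ℝ) - n| ≤ 1 → h (k + 2) ≤ h k + 1 := by
    intro hm k hk
    have hk' := abs_le.1 hk
    refine hh.shift k 2 1 fun x hx => ?_
    have b1 := hball k x 0 (by linarith) (by simp) hx (by rw [abs_le]; constructor <;> linarith)
    have b2 := hball k x 2 (by linarith) (by simp) hx (by rw [abs_le]; constructor <;> linarith)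
    rw [zero_div, add_zero] at b1
    have := (hρ x (x + 2 / N) b1 b2 (by linarith)).1 hm
    have e : (x + 2 / N - x) / 2 = 1 / N := by ring
    rw [e] at this
    push_cast
    linarith
  have hdn : 1 / 2 < m → ∀ k : ℤ, |(k : ℝ) - n - 3 / 2| ≤ 1 → h (k + (-2)) ≤ h k + (-1) := by
    intro hm k hk
    have hk' := abs_le.1 hk
    refine hh.shift k (-2) (-1) fun x hx => ?_
    have b1 := hball (k - 2) (x - 2 / N) 2 (by push_cast; rw [abs_le]; constructor <;> linarith)
      (by simp) (by push_cast; rwa [show x - 2 / N - (k - 2) / N = x - k / N by ring])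
      (by push_cast; rw [abs_le]; constructor <;> linarith)
    have b2 := hball (k - 2) (x - 2 / N) 0 (by push_cast; rw [abs_le]; constructor <;> linarith)
      (by simp) (by push_cast; rwa [show x - 2 / N - (k - 2) / N = x - k / N by ring])
      (by push_cast; rw [abs_le]; constructor <;> linarith)
    rw [zero_div, add_zero] at b2
    rw [sub_add_cancel] at b1
    have := (hρ (x - 2 / N) x b2 b1 (by linarith)).2 hm
    have e : (x - (x - 2 / N)) / 2 = 1 / N := by ring
    rw [e] at this
    push_cast
    rw [neg_div, ← sub_eq_add_neg, neg_div]
    linarith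
  refine ⟨fun hm => ⟨hup hm n (by simp), ?_⟩, fun hm => ⟨?_, ?_⟩⟩
  · have := hup hm (n - 1) (by push_cast; rw [abs_le]; constructor <;> linarith)
    rwa [show n - 1 + 2 = n + 1 by ring] at this
  · have := hdn hm (n + 1) (by push_cast; rw [abs_le]; constructor <;> linarith)
    rw [show n + 1 + -2 = n - 1 by ring] at this
    omega
  · have := hdn hm (n + 2) (by push_cast; rw [abs_le]; constructor <;> linarith)
    rw [show n + 2 + -2 = n by ring] at this
    omega

namespace GraphChart

variable {D : Set ℂ} {u : ℤ × ℤ} {β : ℤ} {g : ℝ → ℝ} {ξ ρ c : ℝ}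

theorem step_bounds (hC : GraphChart D u β g ξ ρ c) {N : ℕ} (hN : 0 < N) {h : ℤ → ℤ}
    (hh : IsHeight N g h) (n : ℤ) : -(1 - β) ≤ h (n + 1) - h n ∧ h (n + 1) - h n ≤ 1 := by
  have hN' : (0 : ℝ) < N := by exact_mod_cast hN
  have hN1 : (0 : ℝ) < 1 / N := by positivity
  constructor
  · have := hh.shift (n + 1) (-1) (1 - β) fun x _ => by
      have := (hC.slope (x - 1 / N) x (by linarith)).1
      rw [sub_sub_cancel] at this
      push_cast
      rw [neg_div, ← sub_eq_add_neg, show (1 - (β : ℝ)) / N = (1 - β) * (1 / N) by ring]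
      linarith
    rw [add_neg_cancel_right] at this
    omega
  · have := hh.shift n 1 1 fun x _ => by
      have := (hC.slope x (x + 1 / N) (by linarith)).2
      rw [add_sub_cancel_left] at this
      push_cast
      linarith
    omega

theorem innerRow_near (hC : GraphChart D u β g ξ ρ c) {N : ℕ} (hN : 0 < N) {h : ℤ → ℤ}
    (hh : IsHeight N g h) (n : ℤ) : |(innerRow β h n : ℝ) - N * g (n / N)| ≤ 3 := by
  have h1 := (innerRow_bounds hC.shear (hC.step_bounds hN hh) n).1
  have h2 : |(innerRow β h n : ℝ) - h n| ≤ 1 := by exact_mod_cast h1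
  have := abs_le.1 h2
  have := abs_le.1 (hh.near n)
  rw [abs_le]; constructor <;> linarith

theorem outerRow_near (hC : GraphChart D u β g ξ ρ c) {N : ℕ} (hN : 0 < N) {h : ℤ → ℤ}
    (hh : IsHeight N g h) (n : ℤ) :
    |(outerRow β h n : ℝ) - N * g (((n + 1 : ℤ) : ℝ) / N)| ≤ 3 := by
  have h1 := (innerRow_bounds hC.shear (hC.step_bounds hN hh) n).2
  have h2 : |(outerRow β h n : ℝ) - h (n + 1)| ≤ 1 := by exact_mod_cast h1
  have := abs_le.1 h2
  have := abs_le.1 (hh.near (n + 1))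
  rw [abs_le]; constructor <;> linarith

/-- Beyond the right crossing point the ball is no longer met and the other tent is too far away, so
only one factor of `averageWeight` remains. -/
theorem weight_right (hC : GraphChart D u β g ξ ρ c) {N : ℕ} (hN : 0 < N) {n a : ℤ}
    (ha : |(a : ℝ) - N * g (n / N)| ≤ 3) {r δ ξ₀ ξ₁ : ℝ} (hδ : 0 < δ)
    (h1 : ‖graphPoint u β g ξ₁ - graphPoint u β g ξ‖ = r) (hξ₁ : ξ ≤ ξ₁)
    (hn1 : N * ξ₁ + 8 / c ≤ n) (hn : n ≤ N * (ξ + ρ)) (h01 : 2 * δ * N + 14 ≤ N * (ξ₁ - ξ₀)) :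
    averageWeight N (graphPoint u β g ξ) (graphPoint u β g ξ₀) (graphPoint u β g ξ₁) r δ
      (site u β n a) = tent N (graphPoint u β g ξ₁) δ (site u β n a) := by
  have hN' : (0 : ℝ) < N := by exact_mod_cast hN
  have hc := hC.growth_pos
  have h8 : 0 < 8 / c := by positivity
  have e1 : ξ₁ + 8 / c / N ≤ n / N := by
    rw [le_div_iff₀ hN', add_mul, div_mul_cancel₀ _ hN'.ne']; linarith
  have e2 : (n : ℝ) / N ≤ ξ + ρ := by rw [div_le_iff₀ hN']; linarith
  have e3 : c * (8 / c / N) = 8 / N := by field_simp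
  have hm := hC.meets_eq_zero hN ha (r := r) (by
    have : 0 < 8 / c / N := by positivity
    have h2 := hC.growth_right ξ₁ (n / N) hξ₁ (by linarith) e2
    have h3 : c * (8 / c / N) ≤ c * (n / N - ξ₁) := by gcongr; linarith
    linarith)
  have h0 := hC.tent_eq_zero_of_far hN ha (x := ξ₀) hδ (by
    refine le_trans ?_ (le_abs_self _)
    linarith)
  rw [averageWeight, hm, h0]
  ring

theorem weight_left (hC : GraphChart D u β g ξ ρ c) {N : ℕ} (hN : 0 < N) {n a : ℤ}
    (ha : |(a : ℝ) - N * g (n / N)| ≤ 3) {r δ ξ₀ ξ₁ : ℝ} (hδ : 0 < δ)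
    (h0 : ‖graphPoint u β g ξ₀ - graphPoint u β g ξ‖ = r) (hξ₀ : ξ₀ ≤ ξ)
    (hn0 : n ≤ N * ξ₀ - 8 / c) (hn : N * (ξ - ρ) ≤ n) (h01 : 2 * δ * N + 14 ≤ N * (ξ₁ - ξ₀)) :
    averageWeight N (graphPoint u β g ξ) (graphPoint u β g ξ₀) (graphPoint u β g ξ₁) r δ
      (site u β n a) = tent N (graphPoint u β g ξ₀) δ (site u β n a) := by
  have hN' : (0 : ℝ) < N := by exact_mod_cast hN
  have hc := hC.growth_pos
  have h8 : 0 < 8 / c := by positivity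
  have e1 : n / N ≤ ξ₀ - 8 / c / N := by
    rw [div_le_iff₀ hN', sub_mul, div_mul_cancel₀ _ hN'.ne']; linarith
  have e2 : ξ - ρ ≤ (n : ℝ) / N := by rw [le_div_iff₀ hN']; linarith
  have e3 : c * (8 / c / N) = 8 / N := by field_simp
  have hm := hC.meets_eq_zero hN ha (r := r) (by
    have : 0 < 8 / c / N := by positivity
    have h2 := hC.growth_left (n / N) ξ₀ e2 (by linarith) hξ₀
    have h3 : c * (8 / c / N) ≤ c * (ξ₀ - n / N) := by gcongr; linarith
    linarith)
  have h1 := hC.tent_eq_zero_of_far hN ha (x := ξ₁) hδ (by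
    refine le_trans ?_ (neg_le_abs _)
    linarith)
  rw [averageWeight, hm, h1]
  ring

/-- The squared norm is `1 + m²`, at most `2`, for `β = 0`, and `(1 - m)² + m²`, at least `1/2`, for
`β = 1`. The fractions are rational bounds for `1/√2` and `√2`. -/
theorem norm_tangent_bounds (hC : GraphChart D u β g ξ ρ c) {m : ℝ} (hm : |m| ≤ 1)
    (hmβ : β = 1 → 0 ≤ m) :
    7 / 10 ≤ ‖chartPoint u β 1 m‖ ∧ ‖chartPoint u β 1 m‖ ≤ 10 / 7 := by
  have h := norm_chartPoint_sq hC.unit β 1 m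
  have hm' := abs_le.1 hm
  have h0 := norm_nonneg (chartPoint u β 1 m)
  constructor
  · refine le_of_sq_le_sq ?_ h0
    rw [h]
    rcases hC.shear with rfl | rfl
    · push_cast; nlinarith [sq_nonneg m]
    · push_cast; nlinarith [sq_nonneg (2 * m - 1)]
  · refine le_of_sq_le_sq ?_ (by norm_num)
    rw [h]
    rcases hC.shear with rfl | rfl
    · push_cast; nlinarith
    · have := hmβ rfl
      push_cast; nlinarith

theorem abs_sub_stepOffset_le (_hC : GraphChart D u β g ξ ρ c) {m : ℝ} (hm : |m| ≤ 1)
    (hmβ : β = 1 → 0 ≤ m) : |m - stepOffset β m| ≤ 1 := by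
  unfold stepOffset
  split_ifs with h
  · have := abs_le.1 hm
    have := hmβ h.1
    push_cast; rw [abs_le]; constructor <;> linarith
  · simpa using hm

theorem abs_step_sub_offset_le (hC : GraphChart D u β g ξ ρ c) {m : ℝ} {N : ℕ} (hN : 0 < N)
    {h : ℤ → ℤ} (hh : IsHeight N g h) (n : ℤ) :
    |((h (n + 1) - h n : ℤ) : ℝ) - stepOffset β m| ≤ 1 := by
  have hst := hC.step_bounds hN hh n
  have : |h (n + 1) - h n - stepOffset β m| ≤ 1 := by
    unfold stepOffset
    split_ifs with h
    · obtain ⟨rfl, -⟩ := h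
      rw [abs_le]; omega
    · rcases hC.shear with rfl | rfl <;> rw [abs_le] <;> omega
  exact_mod_cast this

theorem dot_step_eq (hC : GraphChart D u β g ξ ρ c) {N : ℕ} (hN : 0 < N) {h : ℤ → ℤ}
    (hh : IsHeight N g h) {m x ρ' : ℝ}
    (hρ' : ∀ y z, |y - x| < ρ' → |z - x| < ρ' → y ≤ z →
      (m < 1 / 2 → g z - g y ≤ (z - y) / 2) ∧ (1 / 2 < m → (z - y) / 2 ≤ g z - g y))
    {n : ℤ} (hn : |(n : ℝ) - N * x| + 4 < ρ' * N)
    (hne : ((h (n + 1) - h n : ℤ) : ℝ) - stepOffset β m ≠ 0) :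
    dot (chartPoint u β 1 ((outerRow β h n : ℝ) - innerRow β h n)) (chartPoint u β 1 m) =
      stepDot β m := by
  have hhalf := hh.half hN hρ' hn
  refine dot_step hC.unit hC.shear (hC.step_bounds hN hh) (fun h1 _ => hhalf.1 h1)
    (fun h1 _ => hhalf.2 h1) fun he => hne ?_
  rw [he, sub_self]

set_option maxHeartbeats 1000000 in
-- Only a window of about `3δN/l` columns around the crossing point matters: before it `w` is `1`,
-- after it `w` is `0`, and in both regions the increments vanish.
theorem right_half_flux (hC : GraphChart D u β g ξ ρ c) {m ξ₀ ξ₁ r : ℝ} (hm : |m| ≤ 1)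
    (hmβ : β = 1 → 0 ≤ m) (hreg : RegularAt g m ξ₁)
    (h0 : ‖graphPoint u β g ξ₀ - graphPoint u β g ξ‖ = r)
    (h1 : ‖graphPoint u β g ξ₁ - graphPoint u β g ξ‖ = r)
    (h0ρ : ξ - ρ / 8 ≤ ξ₀) (h0ξ : ξ₀ < ξ) (h1ξ : ξ < ξ₁) (h1ρ : ξ₁ ≤ ξ + ρ / 8) :
    ∀ ε > 0, ∃ δ₀ > 0, ∀ δ : ℝ, 0 < δ → δ < δ₀ → ∀ᶠ N : ℕ in atTop, ∀ h : ℤ → ℤ, IsHeight N g h →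
      ∀ (a : ℤ) (A : ℕ), N * ξ ≤ a → a ≤ N * ξ + 1 → N * (ξ + ρ / 2) ≤ a + A →
      a + A ≤ N * (ξ + ρ / 2) + 3 →
      |∑ k ∈ Finset.range A, (((h (a + k + 1) - h (a + k) : ℤ) : ℝ) - stepOffset β m) *
        stepIncrement u β h (averageWeight N (graphPoint u β g ξ) (graphPoint u β g ξ₀)
          (graphPoint u β g ξ₁) r δ) (a + k) +
        stepDot β m * (m - stepOffset β m) / ((1 - β * m) ^ 2 + m ^ 2)| ≤ ε := by
  intro ε hε
  have hc := hC.growth_pos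
  have hρ := hC.radius_pos
  obtain ⟨ρ', hρ', hhalf⟩ := hreg.half
  -- `k₂` columns on each side of the crossing point are not decided by the growth condition. The
  -- window starts `k₂` columns early, so `J = 2 * k₂ + 2` steps pass them, and `K'` bounds `1 -
  -- tent` over those steps.
  obtain ⟨k₂, hk₂⟩ : ∃ k₂ : ℕ, 8 / c + 1 ≤ k₂ := exists_nat_ge _
  have h8 : 0 < 8 / c := by positivity
  obtain ⟨hl1, hl2⟩ := hC.norm_tangent_bounds hm hmβ
  set l := ‖chartPoint u β 1 m‖ with hl
  have hl0 : 0 < l := by linarith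
  have hlsq : l ^ 2 = (1 - β * m) ^ 2 + m ^ 2 := norm_chartPoint_sq hC.unit β 1 m
  have hk0 : (0 : ℝ) ≤ k₂ := Nat.cast_nonneg _
  obtain ⟨δ₁, hδ₁, hflux⟩ := end_flux hC.unit hC.shear hC.abs_sub_le hreg.hasDerivAt hm
    (K := 2 * k₂ + 10) (J := 2 * k₂ + 2) (K' := 7 + 3 * (2 * k₂ + 2 + k₂ + 2)) (G := stepDot β m)
    (c₀ := stepOffset β m) (by linarith) (by positivity) (by positivity)
    (hC.abs_sub_stepOffset_le hm hmβ) ε hε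
  refine ⟨min δ₁ (min (ρ / 64) (min (ρ' / 16) (min (ξ₁ - ξ) (min (ξ - ξ₀) ((ξ₁ - ξ₀) / 4))))),
    by simp only [lt_min_iff]; refine ⟨hδ₁, by linarith, by linarith, by linarith, by linarith, by linarith⟩, ?_⟩
  intro δ hδ hδlt
  simp only [lt_min_iff] at hδlt
  obtain ⟨d1, d2, d3, d4, d6, d5⟩ := hδlt
  obtain ⟨N₀, hN₀⟩ := hflux δ hδ d1
  filter_upwards [eventually_ge_atTop N₀, eventually_gt_atTop 0,
    eventually_le_mul_natCast hδ (20 * (k₂ + 20))] with N hNN hN hX h hh a A ha1 ha2 ha3 ha4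
  have hN' : (0 : ℝ) < N := by exact_mod_cast hN
  have x2 := mul_lt_mul_of_pos_right d2 hN'
  have x3 := mul_lt_mul_of_pos_right d3 hN'
  have x4 := mul_lt_mul_of_pos_right d4 hN'
  have x5 := mul_lt_mul_of_pos_right d5 hN'
  have x8 := mul_lt_mul_of_pos_right d6 hN'
  have x6 := mul_le_mul_of_nonneg_right h1ρ hN'.le
  have x7 := mul_le_mul_of_nonneg_right h0ρ hN'.le
  set w := averageWeight N (graphPoint u β g ξ) (graphPoint u β g ξ₀) (graphPoint u β g ξ₁) r δ
    with hw
  obtain ⟨n₁, hn₁⟩ : ∃ n₁ : ℤ, n₁ = ⌊N * ξ₁⌋ - k₂ := ⟨_, rfl⟩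
  have hn1a : (n₁ : ℝ) ≤ N * ξ₁ - k₂ := by
    rw [hn₁]; push_cast; linarith [Int.floor_le (N * ξ₁)]
  have hn1b : N * ξ₁ - k₂ - 1 < (n₁ : ℝ) := by
    rw [hn₁]; push_cast; linarith [Int.lt_floor_add_one (N * ξ₁)]
  -- As `l ≤ 10/7`, the window has at least `2.1 δN - 1` columns, more than the `2δN + 14` after
  -- which the tent vanishes, even after the undecided columns are subtracted.
  obtain ⟨M, hM⟩ : ∃ M : ℕ, M = ⌊3 * (δ * N) / l⌋₊ := ⟨_, rfl⟩
  have hM1 : M * l ≤ 3 * (δ * N) := by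
    rw [← le_div_iff₀ hl0, hM]; exact Nat.floor_le (by positivity)
  have hM2 : 3 * (δ * N) < (M + 1) * l := by
    rw [← div_lt_iff₀ hl0, hM]; exact Nat.lt_floor_add_one _
  have hM0 : (0 : ℝ) ≤ M := Nat.cast_nonneg M
  have hM3 : (M : ℝ) ≤ 5 * (δ * N) := by nlinarith
  have hM4 : 21 / 10 * (δ * N) ≤ M + 1 := by nlinarith
  have hinner := hC.innerRow_near hN hh
  have houter := hC.outerRow_near hN hh
  have hright : ∀ n b : ℤ, |(b : ℝ) - N * g (n / N)| ≤ 3 → N * ξ₁ + 8 / c ≤ n → n ≤ N * (ξ + ρ) →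
      w (site u β n b) = tent N (graphPoint u β g ξ₁) δ (site u β n b) := fun n b hb hn hn' =>
    hC.weight_right hN hb hδ h1 h1ξ.le hn hn' (by linarith)
  have hfar : ∀ n b : ℤ, |(b : ℝ) - N * g (n / N)| ≤ 3 → n₁ + M ≤ n → n ≤ a + A →
      w (site u β n b) = 0 := by
    intro n b hb hn hn'
    have hn2 : (n₁ : ℝ) + M ≤ n := by exact_mod_cast hn
    have hn3 : (n : ℝ) ≤ a + A := by exact_mod_cast hn'
    rw [hright n b hb (by linarith) (by linarith),
      hC.tent_eq_zero_of_far hN hb hδ (le_trans (by linarith) (le_abs_self _))]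
  have hone : ∀ n b : ℤ, |(b : ℝ) - N * g (n / N)| ≤ 3 → a ≤ n → n ≤ n₁ →
      w (site u β n b) = 1 := by
    intro n b hb hn hn'
    have hn2 : (a : ℝ) ≤ n := by exact_mod_cast hn
    have hn3 : (n : ℝ) ≤ n₁ := by exact_mod_cast hn'
    exact hC.weight_eq_one hN hb h0 h1 (by linarith) (by linarith) (by linarith) (by linarith) _ _
  rw [sum_range_window (F := fun n => (((h (n + 1) - h n : ℤ) : ℝ) - stepOffset β m) *
      stepIncrement u β h w n) (a := a) (b := n₁) (A := A) (M := M)]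
  rotate_left
  · have : (a : ℝ) < n₁ := by linarith
    exact_mod_cast this.le
  · have : (n₁ : ℝ) + M ≤ a + A := by linarith
    exact_mod_cast this
  · intro n hn1 hn2
    rw [stepIncrement, hone _ _ (houter n) (by omega) (by omega),
      hone _ _ (hinner n) (by omega) (by omega), sub_self, mul_zero]
  · intro n hn1 hn2
    rw [stepIncrement, hfar _ _ (houter n) (by omega) (by omega),
      hfar _ _ (hinner n) (by omega) (by omega), sub_self, mul_zero]
  have key := hN₀ N hNN 1 (Or.inl rfl) M (by linarith) hM1 (fun j => n₁ + j)
    (fun j => innerRow β h (n₁ + j)) (fun j => n₁ + j + 1) (fun j => outerRow β h (n₁ + j))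
    (fun j => ((h (n₁ + j + 1) - h (n₁ + j) : ℤ) : ℝ) - stepOffset β m) w
    ?_ ?_ ?_ ?_ ?_ ?_ ?_ ?_ ?_
  · rw [← hl, hlsq] at key
    exact key
  · intro j _
    push_cast
    rw [abs_le]; constructor <;> linarith
  · intro j _
    push_cast
    rw [abs_le]; constructor <;> linarith
  · intro j _
    exact (hinner _).trans (by linarith)
  · intro j _
    exact (houter _).trans (by linarith)
  · intro j
    exact hC.abs_step_sub_offset_le hN hh _
  · intro j hj hne
    have hj' : (j : ℝ) < M := by exact_mod_cast hj
    have := hC.dot_step_eq hN hh hhalf (n := n₁ + j) (by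
      rw [← lt_sub_iff_add_lt, abs_lt]; push_cast; constructor <;> linarith) hne
    rw [one_smul]
    push_cast
    rwa [add_sub_cancel_left]
  · intro k _
    have hs : ∑ j ∈ Finset.range k, (((h (n₁ + j + 1) - h (n₁ + j) : ℤ) : ℝ) - stepOffset β m) =
        h (n₁ + k) - h n₁ - stepOffset β m * k := by
      rw [Finset.sum_sub_distrib, Finset.sum_const, Finset.card_range, nsmul_eq_mul]
      have := Finset.sum_range_sub (fun j : ℕ => (h (n₁ + j) : ℝ)) k
      push_cast at this ⊢
      simp only [← add_assoc, add_zero] at this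
      rw [this]; ring
    rw [hs]
    have e1 := hh.near n₁
    have e2 := hh.near (n₁ + k)
    have e3 := hC.abs_sub_le (n₁ / N) ξ₁
    have e4 := hC.abs_sub_le (((n₁ + k : ℤ) : ℝ) / N) (ξ₁ + 1 * k / N)
    have e5 : ((n₁ + k : ℤ) : ℝ) / N - (ξ₁ + 1 * k / N) = n₁ / N - ξ₁ := by push_cast; ring
    have e6 : N * |(n₁ : ℝ) / N - ξ₁| ≤ k₂ + 1 := by
      rw [show (n₁ : ℝ) / N - ξ₁ = (n₁ - N * ξ₁) / N by field_simp, abs_div, abs_of_pos hN',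
        mul_div_cancel₀ _ hN'.ne', abs_le]
      constructor <;> linarith
    rw [e5] at e4
    have e7 : ∀ x, |x| ≤ |(n₁ : ℝ) / N - ξ₁| → |N * x| ≤ k₂ + 1 := fun x hx => by
      rw [abs_mul, abs_of_pos hN']
      exact (mul_le_mul_of_nonneg_left hx hN'.le).trans e6
    have e8 := e7 _ e3
    have e9 := e7 _ e4
    rw [abs_le] at e1 e2 e8 e9 ⊢
    constructor <;> linarith
  · intro j _ hjJ
    have hb : ∀ n b : ℤ, |(b : ℝ) - N * g (n / N)| ≤ 3 → n₁ + j ≤ n → n ≤ n₁ + j + 1 →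
        0 ≤ 1 - w (site u β n b) ∧
          1 - w (site u β n b) ≤ (7 + 3 * (2 * k₂ + 2 + k₂ + 2)) / (δ * N) := by
      intro n b hb hn hn'
      have hn2 : (n₁ : ℝ) + j ≤ n := by exact_mod_cast hn
      have hn3 : (n : ℝ) ≤ n₁ + j + 1 := by exact_mod_cast hn'
      obtain ⟨b1, -, b2⟩ := one_sub_averageWeight (N := N) (graphPoint u β g ξ)
        (graphPoint u β g ξ₀) (graphPoint u β g ξ₁) r hδ (site u β n b)
      refine ⟨b1, (b2.trans (hC.one_sub_tent_le hN hb hδ)).trans ?_⟩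
      gcongr
      have : (0 : ℝ) ≤ j := Nat.cast_nonneg j
      rw [abs_le]; constructor <;> linarith
    have b1 := hb _ _ (houter (n₁ + j)) (by omega) (by omega)
    have b2 := hb _ _ (hinner (n₁ + j)) (by omega) (by omega)
    rw [abs_le]; constructor <;> linarith
  · intro j hj hJ
    have hj' : (j : ℝ) < M := by exact_mod_cast hj
    refine ⟨hright _ _ (hinner _) ?_ ?_, hright _ _ (houter _) ?_ ?_⟩ <;> push_cast <;> linarith

set_option maxHeartbeats 1000000 in
-- The mirror image of `right_half_flux`: the steps are counted from right to left, so the inner and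
-- outer sites exchange roles and the flux changes sign.
theorem left_half_flux (hC : GraphChart D u β g ξ ρ c) {m ξ₀ ξ₁ r : ℝ} (hm : |m| ≤ 1)
    (hmβ : β = 1 → 0 ≤ m) (hreg : RegularAt g m ξ₀)
    (h0 : ‖graphPoint u β g ξ₀ - graphPoint u β g ξ‖ = r)
    (h1 : ‖graphPoint u β g ξ₁ - graphPoint u β g ξ‖ = r)
    (h0ρ : ξ - ρ / 8 ≤ ξ₀) (h0ξ : ξ₀ < ξ) (h1ξ : ξ < ξ₁) (h1ρ : ξ₁ ≤ ξ + ρ / 8) :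
    ∀ ε > 0, ∃ δ₀ > 0, ∀ δ : ℝ, 0 < δ → δ < δ₀ → ∀ᶠ N : ℕ in atTop, ∀ h : ℤ → ℤ, IsHeight N g h →
      ∀ (a : ℤ) (A : ℕ), N * ξ ≤ a + A → a + A ≤ N * ξ + 1 →
      N * (ξ - ρ / 2) - 3 ≤ a → a ≤ N * (ξ - ρ / 2) →
      |∑ k ∈ Finset.range A, (((h (a + k + 1) - h (a + k) : ℤ) : ℝ) - stepOffset β m) *
        stepIncrement u β h (averageWeight N (graphPoint u β g ξ) (graphPoint u β g ξ₀)
          (graphPoint u β g ξ₁) r δ) (a + k) -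
        stepDot β m * (m - stepOffset β m) / ((1 - β * m) ^ 2 + m ^ 2)| ≤ ε := by
  intro ε hε
  have hc := hC.growth_pos
  have hρ := hC.radius_pos
  obtain ⟨ρ', hρ', hhalf⟩ := hreg.half
  obtain ⟨k₂, hk₂⟩ : ∃ k₂ : ℕ, 8 / c + 1 ≤ k₂ := exists_nat_ge _
  have h8 : 0 < 8 / c := by positivity
  obtain ⟨hl1, hl2⟩ := hC.norm_tangent_bounds hm hmβ
  set l := ‖chartPoint u β 1 m‖ with hl
  have hl0 : 0 < l := by linarith
  have hlsq : l ^ 2 = (1 - β * m) ^ 2 + m ^ 2 := norm_chartPoint_sq hC.unit β 1 m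
  have hk0 : (0 : ℝ) ≤ k₂ := Nat.cast_nonneg _
  obtain ⟨δ₁, hδ₁, hflux⟩ := end_flux hC.unit hC.shear hC.abs_sub_le hreg.hasDerivAt hm
    (K := 2 * k₂ + 10) (J := 2 * k₂ + 2) (K' := 7 + 3 * (2 * k₂ + 2 + k₂ + 2)) (G := stepDot β m)
    (c₀ := stepOffset β m) (by linarith) (by positivity) (by positivity)
    (hC.abs_sub_stepOffset_le hm hmβ) ε hε
  refine ⟨min δ₁ (min (ρ / 64) (min (ρ' / 16) (min (ξ₁ - ξ) (min (ξ - ξ₀) ((ξ₁ - ξ₀) / 4))))),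
    by simp only [lt_min_iff]; refine ⟨hδ₁, by linarith, by linarith, by linarith, by linarith, by linarith⟩, ?_⟩
  intro δ hδ hδlt
  simp only [lt_min_iff] at hδlt
  obtain ⟨d1, d2, d3, d4, d6, d5⟩ := hδlt
  obtain ⟨N₀, hN₀⟩ := hflux δ hδ d1
  filter_upwards [eventually_ge_atTop N₀, eventually_gt_atTop 0,
    eventually_le_mul_natCast hδ (20 * (k₂ + 20))] with N hNN hN hX h hh a A ha1 ha2 ha3 ha4
  have hN' : (0 : ℝ) < N := by exact_mod_cast hN
  have x2 := mul_lt_mul_of_pos_right d2 hN'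
  have x3 := mul_lt_mul_of_pos_right d3 hN'
  have x4 := mul_lt_mul_of_pos_right d4 hN'
  have x5 := mul_lt_mul_of_pos_right d5 hN'
  have x8 := mul_lt_mul_of_pos_right d6 hN'
  have x6 := mul_le_mul_of_nonneg_right h1ρ hN'.le
  have x7 := mul_le_mul_of_nonneg_right h0ρ hN'.le
  set w := averageWeight N (graphPoint u β g ξ) (graphPoint u β g ξ₀) (graphPoint u β g ξ₁) r δ
    with hw
  obtain ⟨n₀, hn₀⟩ : ∃ n₀ : ℤ, n₀ = ⌈N * ξ₀⌉ + k₂ := ⟨_, rfl⟩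
  have hn0a : N * ξ₀ + k₂ ≤ (n₀ : ℝ) := by
    rw [hn₀]; push_cast; linarith [Int.le_ceil (N * ξ₀)]
  have hn0b : (n₀ : ℝ) < N * ξ₀ + k₂ + 1 := by
    rw [hn₀]; push_cast; linarith [Int.ceil_lt_add_one (N * ξ₀)]
  obtain ⟨M, hM⟩ : ∃ M : ℕ, M = ⌊3 * (δ * N) / l⌋₊ := ⟨_, rfl⟩
  have hM1 : M * l ≤ 3 * (δ * N) := by
    rw [← le_div_iff₀ hl0, hM]; exact Nat.floor_le (by positivity)
  have hM2 : 3 * (δ * N) < (M + 1) * l := by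
    rw [← div_lt_iff₀ hl0, hM]; exact Nat.lt_floor_add_one _
  have hM0 : (0 : ℝ) ≤ M := Nat.cast_nonneg M
  have hM3 : (M : ℝ) ≤ 5 * (δ * N) := by nlinarith
  have hM4 : 21 / 10 * (δ * N) ≤ M + 1 := by nlinarith
  have hinner := hC.innerRow_near hN hh
  have houter := hC.outerRow_near hN hh
  have hleft : ∀ n b : ℤ, |(b : ℝ) - N * g (n / N)| ≤ 3 → n ≤ N * ξ₀ - 8 / c → N * (ξ - ρ) ≤ n →
      w (site u β n b) = tent N (graphPoint u β g ξ₀) δ (site u β n b) := fun n b hb hn hn' =>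
    hC.weight_left hN hb hδ h0 h0ξ.le hn hn' (by linarith)
  have hfar : ∀ n b : ℤ, |(b : ℝ) - N * g (n / N)| ≤ 3 → a ≤ n → n + M ≤ n₀ →
      w (site u β n b) = 0 := by
    intro n b hb hn hn'
    have hn2 : (n : ℝ) + M ≤ n₀ := by exact_mod_cast hn'
    have hn3 : (a : ℝ) ≤ n := by exact_mod_cast hn
    rw [hleft n b hb (by linarith) (by linarith),
      hC.tent_eq_zero_of_far hN hb hδ (le_trans (by linarith) (neg_le_abs _))]
  have hone : ∀ n b : ℤ, |(b : ℝ) - N * g (n / N)| ≤ 3 → n₀ ≤ n → n ≤ a + A →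
      w (site u β n b) = 1 := by
    intro n b hb hn hn'
    have hn2 : (n₀ : ℝ) ≤ n := by exact_mod_cast hn
    have hn3 : (n : ℝ) ≤ a + A := by exact_mod_cast hn'
    exact hC.weight_eq_one hN hb h0 h1 (by linarith) (by linarith) (by linarith) (by linarith) _ _
  rw [sum_range_window (F := fun n => (((h (n + 1) - h n : ℤ) : ℝ) - stepOffset β m) *
      stepIncrement u β h w n) (a := a) (b := n₀ - M) (A := A) (M := M),
    ← Finset.sum_range_reflect]
  rotate_left
  · have : (a : ℝ) + M < n₀ := by linarith
    have : a + M < n₀ := by exact_mod_cast this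
    omega
  · have : (n₀ : ℝ) ≤ a + A := by linarith
    have : n₀ ≤ a + A := by exact_mod_cast this
    omega
  · intro n hn1 hn2
    rw [stepIncrement, hfar _ _ (houter n) (by omega) (by omega),
      hfar _ _ (hinner n) (by omega) (by omega), sub_self, mul_zero]
  · intro n hn1 hn2
    rw [stepIncrement, hone _ _ (houter n) (by omega) (by omega),
      hone _ _ (hinner n) (by omega) (by omega), sub_self, mul_zero]
  have hidx : ∀ j < M, n₀ - M + ((M - 1 - j : ℕ) : ℤ) = n₀ - 1 - j := fun j hj => by omega
  have key := hN₀ N hNN (-1) (Or.inr rfl) M (by linarith) hM1 (fun j => n₀ - 1 - j + 1)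
    (fun j => outerRow β h (n₀ - 1 - j)) (fun j => n₀ - 1 - j) (fun j => innerRow β h (n₀ - 1 - j))
    (fun j => ((h (n₀ - 1 - j + 1) - h (n₀ - 1 - j) : ℤ) : ℝ) - stepOffset β m) w
    ?_ ?_ ?_ ?_ ?_ ?_ ?_ ?_ ?_
  · rw [← hl, hlsq] at key
    rw [← abs_neg]
    convert key using 2
    rw [neg_sub, sub_eq_add_neg, add_comm, ← Finset.sum_neg_distrib]
    congr 1
    refine Finset.sum_congr rfl fun j hj => ?_
    rw [hidx j (Finset.mem_range.1 hj), stepIncrement]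
    ring
  · intro j _
    push_cast
    rw [abs_le]; constructor <;> linarith
  · intro j _
    push_cast
    rw [abs_le]; constructor <;> linarith
  · intro j _
    exact (houter _).trans (by linarith)
  · intro j _
    exact (hinner _).trans (by linarith)
  · intro j
    exact hC.abs_step_sub_offset_le hN hh _
  · intro j hj hne
    have hj' : (j : ℝ) < M := by exact_mod_cast hj
    have := hC.dot_step_eq hN hh hhalf (n := n₀ - 1 - j) (by
      rw [← lt_sub_iff_add_lt, abs_lt]; push_cast; constructor <;> linarith) hne
    rw [dot_chartPoint hC.unit] at this
    rw [chartPoint_smul, dot_chartPoint hC.unit, ← this]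
    push_cast
    ring
  · intro k _
    have hs : ∑ j ∈ Finset.range k, (((h (n₀ - 1 - j + 1) - h (n₀ - 1 - j) : ℤ) : ℝ) -
        stepOffset β m) = h n₀ - h (n₀ - k) - stepOffset β m * k := by
      rw [Finset.sum_sub_distrib, Finset.sum_const, Finset.card_range, nsmul_eq_mul]
      have := Finset.sum_range_sub' (fun j : ℕ => (h (n₀ - j) : ℝ)) k
      rw [Finset.sum_congr rfl (g := fun j : ℕ => (h (n₀ - j) : ℝ) - h (n₀ - (j + 1 : ℕ)))
        fun j _ => by push_cast; rw [show n₀ - 1 - (j : ℤ) + 1 = n₀ - j by ring,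
          show n₀ - 1 - (j : ℤ) = n₀ - (j + 1) by ring], this]
      push_cast
      rw [sub_zero]; ring
    rw [hs]
    have e1 := hh.near n₀
    have e2 := hh.near (n₀ - k)
    have e3 := hC.abs_sub_le (n₀ / N) ξ₀
    have e4 := hC.abs_sub_le (((n₀ - k : ℤ) : ℝ) / N) (ξ₀ + -1 * k / N)
    have e5 : ((n₀ - k : ℤ) : ℝ) / N - (ξ₀ + -1 * k / N) = n₀ / N - ξ₀ := by push_cast; ring
    have e6 : N * |(n₀ : ℝ) / N - ξ₀| ≤ k₂ + 1 := by
      rw [show (n₀ : ℝ) / N - ξ₀ = (n₀ - N * ξ₀) / N by field_simp, abs_div, abs_of_pos hN',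
        mul_div_cancel₀ _ hN'.ne', abs_le]
      constructor <;> linarith
    rw [e5] at e4
    have e7 : ∀ x, |x| ≤ |(n₀ : ℝ) / N - ξ₀| → |N * x| ≤ k₂ + 1 := fun x hx => by
      rw [abs_mul, abs_of_pos hN']
      exact (mul_le_mul_of_nonneg_left hx hN'.le).trans e6
    have e8 := e7 _ e3
    have e9 := e7 _ e4
    rw [abs_le] at e1 e2 e8 e9 ⊢
    constructor <;> linarith
  · intro j _ hjJ
    have hb : ∀ n b : ℤ, |(b : ℝ) - N * g (n / N)| ≤ 3 → n₀ - 1 - j ≤ n → n ≤ n₀ - j →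
        0 ≤ 1 - w (site u β n b) ∧
          1 - w (site u β n b) ≤ (7 + 3 * (2 * k₂ + 2 + k₂ + 2)) / (δ * N) := by
      intro n b hb hn hn'
      have hn2 : (n₀ : ℝ) - 1 - j ≤ n := by exact_mod_cast hn
      have hn3 : (n : ℝ) ≤ n₀ - j := by exact_mod_cast hn'
      obtain ⟨b1, b2, -⟩ := one_sub_averageWeight (N := N) (graphPoint u β g ξ)
        (graphPoint u β g ξ₀) (graphPoint u β g ξ₁) r hδ (site u β n b)
      refine ⟨b1, (b2.trans (hC.one_sub_tent_le hN hb hδ)).trans ?_⟩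
      gcongr
      have : (0 : ℝ) ≤ j := Nat.cast_nonneg j
      rw [abs_le]; constructor <;> linarith
    have b1 := hb _ _ (houter (n₀ - 1 - j)) (by omega) (by omega)
    have b2 := hb _ _ (hinner (n₀ - 1 - j)) (by omega) (by omega)
    rw [abs_le]; constructor <;> linarith
  · intro j hj hJ
    have hj' : (j : ℝ) < M := by exact_mod_cast hj
    refine ⟨hleft _ _ (houter _) ?_ ?_, hleft _ _ (hinner _) ?_ ?_⟩ <;> push_cast <;> linarith

/-! ### The averaged drift as a difference of end fluxes -/

theorem chart_threeBalls (hC : GraphChart D u β g ξ ρ c) {r δ ξ₀ ξ₁ : ℝ}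
    (h0 : ‖graphPoint u β g ξ₀ - graphPoint u β g ξ‖ = r)
    (h1 : ‖graphPoint u β g ξ₁ - graphPoint u β g ξ‖ = r) (hδr : δ ≤ r) (hδ : 0 < δ) {z : ℂ}
    (hz : z ∈ threeBalls (graphPoint u β g ξ) (graphPoint u β g ξ₀) (graphPoint u β g ξ₁) r δ δ) :
    |chartFst u β z - ξ| ≤ 4 * r ∧ |chartSnd u z - g ξ| ≤ 2 * r := by
  have hz' : ‖z - graphPoint u β g ξ‖ ≤ 2 * r := by
    rcases hz with (hz | hz) | hz <;> rw [Metric.mem_closedBall, dist_eq_norm] at hz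
    · linarith
    · rw [← sub_add_sub_cancel z (graphPoint u β g ξ₀)]
      exact (norm_add_le _ _).trans (by linarith)
    · rw [← sub_add_sub_cancel z (graphPoint u β g ξ₁)]
      exact (norm_add_le _ _).trans (by linarith)
  have e1 := abs_chartFst_le hC.unit hC.shear (z - graphPoint u β g ξ)
  have e2 := abs_chartSnd_le hC.unit (z - graphPoint u β g ξ)
  rw [chartFst_sub, graphPoint, chartFst_chartPoint hC.unit] at e1
  rw [chartSnd_sub, graphPoint, chartSnd_chartPoint hC.unit] at e2
  exact ⟨e1.trans (by rw [← graphPoint]; linarith), e2.trans hz'⟩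

theorem site_near_of_weight_ne_zero (hC : GraphChart D u β g ξ ρ c) {r δ ξ₀ ξ₁ : ℝ}
    (h0 : ‖graphPoint u β g ξ₀ - graphPoint u β g ξ‖ = r)
    (h1 : ‖graphPoint u β g ξ₁ - graphPoint u β g ξ‖ = r) (hδr : δ ≤ r) (hδ : 0 < δ) {N : ℕ}
    (hN : 0 < N) {n a : ℤ}
    (h : (latticeBox N (site u β n a) ∩ threeBalls (graphPoint u β g ξ) (graphPoint u β g ξ₀)
      (graphPoint u β g ξ₁) r δ δ).Nonempty) :
    |(n : ℝ) - N * ξ| ≤ N * (4 * r) + 1 ∧ |(a : ℝ) - N * g ξ| ≤ N * (2 * r) + 1 := by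
  have hN' : (0 : ℝ) < N := by exact_mod_cast hN
  obtain ⟨z, hz, hzS⟩ := h
  obtain ⟨e1, e2⟩ := hC.chart_threeBalls h0 h1 hδr hδ hzS
  obtain ⟨e3, e4⟩ := abs_chart_sub_le hN hC.unit hC.shear hz
  have scale : ∀ x y t b : ℝ, |x - y| ≤ t → |x - b / N| ≤ 1 / N → |b - N * y| ≤ N * t + 1 := by
    intro x y t b h1 h2
    rw [show b - N * y = N * ((x - y) - (x - b / N)) by field_simp; ring, abs_mul, abs_of_pos hN']
    calc N * |x - y - (x - b / N)| ≤ N * (t + 1 / N) := by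
          gcongr; exact (abs_sub _ _).trans (add_le_add h1 h2)
      _ = N * t + 1 := by field_simp
  exact ⟨scale _ _ _ _ e1 e3, scale _ _ _ _ e2 e4⟩

variable {W : Type*} [MeasurableSpace W] {X : ℝ≥0 → W → Config} {P : Config → Measure W}

/-- The averaged drift as a sum over the steps of the interface. -/
theorem averagedDrift_eq_step_sum (hC : GraphChart D u β g ξ ρ c) (hX : IsGlauberDynamics X P)
    {r δ ξ₀ ξ₁ : ℝ} (h0 : ‖graphPoint u β g ξ₀ - graphPoint u β g ξ‖ = r)
    (h1 : ‖graphPoint u β g ξ₁ - graphPoint u β g ξ‖ = r) (hδr : δ ≤ r) (hδ : 0 < δ)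
    (hr : 16 * r ≤ ρ) {N : ℕ} (hN : 40 ≤ ρ * N) {lo : ℤ} {A : ℕ}
    (hlo1 : N * (ξ - ρ / 2) - 3 ≤ lo) (hlo2 : lo ≤ N * (ξ - ρ / 2))
    (hhi1 : N * (ξ + ρ / 2) ≤ lo + A) (hhi2 : lo + A ≤ N * (ξ + ρ / 2) + 3) :
    ∃ h : ℤ → ℤ, IsHeight N g h ∧
      averagedDrift X P N (initialConfig D N) (graphPoint u β g ξ) (graphPoint u β g ξ₀)
        (graphPoint u β g ξ₁) r δ =
        1 / 2 * ∑ k ∈ Finset.range A, ((h (lo + k + 1) - h (lo + k) : ℤ) : ℝ) *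
          stepIncrement u β h (averageWeight N (graphPoint u β g ξ) (graphPoint u β g ξ₀)
            (graphPoint u β g ξ₁) r δ) (lo + k) ∧
      (∀ a, averageWeight N (graphPoint u β g ξ) (graphPoint u β g ξ₀) (graphPoint u β g ξ₁) r δ
        (site u β lo a) = 0) ∧
      ∀ a, averageWeight N (graphPoint u β g ξ) (graphPoint u β g ξ₀) (graphPoint u β g ξ₁) r δ
        (site u β (lo + A) a) = 0 := by
  have hρ := hC.radius_pos
  have hN0 : 0 < N := by
    rcases Nat.eq_zero_or_pos N with rfl | h
    · norm_num at hN
    · exact h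
  have hN' : (0 : ℝ) < N := by exact_mod_cast hN0
  have hrN := mul_le_mul_of_nonneg_right hr hN'.le
  obtain ⟨h, hbox, hnear, hshift⟩ := exists_height hN0 hC.unit hC.shear hC.abs_sub_le
  have hh : IsHeight N g h := ⟨hnear, hshift⟩
  set w := averageWeight N (graphPoint u β g ξ) (graphPoint u β g ξ₀) (graphPoint u β g ξ₁) r δ
    with hw
  have hmeet := fun n a => hC.site_near_of_weight_ne_zero h0 h1 hδr hδ hN0 (n := n) (a := a)
  have hw0 : ∀ a, w (site u β lo a) = 0 := by
    intro a
    by_contra hne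
    have := abs_le.1 (hmeet _ _ (averageWeight_ne_zero hN0 hδ hne)).1
    linarith
  have hw1 : ∀ a, w (site u β (lo + A) a) = 0 := by
    intro a
    by_contra hne
    have := abs_le.1 (hmeet _ _ (averageWeight_ne_zero hN0 hδ hne)).1
    push_cast at this
    linarith
  refine ⟨h, hh, ?_, hw0, hw1⟩
  -- Since `g` is 1-Lipschitz and the columns stay within about `ρ/2` of `ξ`, the interface stays in
  -- these rows. The boxes of these rows still lie where `D` is known to be the epigraph.
  obtain ⟨alo, halo⟩ : ∃ alo : ℤ, alo = ⌊N * (g ξ - ρ)⌋ := ⟨_, rfl⟩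
  obtain ⟨ahi, hahi⟩ : ∃ ahi : ℤ, ahi = ⌈N * (g ξ + ρ)⌉ := ⟨_, rfl⟩
  have alo1 : (alo : ℝ) ≤ N * (g ξ - ρ) := halo ▸ Int.floor_le _
  have alo2 : N * (g ξ - ρ) - 1 < alo := by rw [halo]; exact Int.sub_one_lt_floor _
  have ahi1 : N * (g ξ + ρ) ≤ ahi := hahi ▸ Int.le_ceil _
  have ahi2 : ahi < N * (g ξ + ρ) + 1 := by rw [hahi]; exact Int.ceil_lt_add_one _
  have hσ : ∀ n a, lo - 1 ≤ n → n ≤ lo + A → alo - 1 ≤ a → a ≤ ahi + 1 →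
      (initialConfig D N (site u β n a) = true ↔ h n ≤ a) := by
    intro n a hn1 hn2 ha1 ha2
    have hn1' : (lo : ℝ) - 1 ≤ n := by exact_mod_cast hn1
    have hn2' : (n : ℝ) ≤ lo + A := by exact_mod_cast hn2
    have ha1' : (alo : ℝ) - 1 ≤ a := by exact_mod_cast ha1
    have ha2' : (a : ℝ) ≤ ahi + 1 := by exact_mod_cast ha2
    rw [← hbox]
    have heq : latticeBox N (site u β n a) ∩ D =
        latticeBox N (site u β n a) ∩ chartEpigraph u β g := by
      ext z
      refine and_congr_right fun hz => hC.mem_iff z ?_ ?_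
      · have e := abs_le.1 (abs_chart_sub_le hN0 hC.unit hC.shear hz).1
        have e1 : n / N ≤ ξ + ρ / 2 + 3 / N := by rw [div_le_iff₀ hN']; field_simp; linarith
        have e2 : ξ - ρ / 2 - 4 / N ≤ n / N := by rw [le_div_iff₀ hN']; field_simp; linarith
        have e3 : 5 / N < ρ / 2 := by rw [div_lt_iff₀ hN']; linarith
        have e4 : (5 : ℝ) / N = 4 / N + 1 / N := by ring
        have e5 : (4 : ℝ) / N = 3 / N + 1 / N := by ring
        have e6 : (0 : ℝ) < 1 / N := by positivity
        rw [abs_lt]; constructor <;> linarith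
      · have e := abs_le.1 (abs_chart_sub_le hN0 hC.unit hC.shear hz).2
        have e1 : a / N ≤ g ξ + ρ + 2 / N := by rw [div_le_iff₀ hN']; field_simp; linarith
        have e2 : g ξ - ρ - 2 / N ≤ a / N := by rw [le_div_iff₀ hN']; field_simp; linarith
        have e3 : 3 / N < ρ := by rw [div_lt_iff₀ hN']; linarith
        have e4 : (3 : ℝ) / N = 2 / N + 1 / N := by ring
        rw [abs_lt]; constructor <;> linarith
    rw [initialConfig, heq]
    split_ifs with hif
    · exact iff_of_true rfl hif
    · exact iff_of_false (by simp) hif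
  have hrow : ∀ n, lo ≤ n → n < lo + A → alo ≤ h n - 1 ∧ h n ≤ ahi := by
    intro n hn1 hn2
    have hn1' : (lo : ℝ) ≤ n := by exact_mod_cast hn1
    have hn2' : (n : ℝ) ≤ lo + A := by exact_mod_cast hn2.le
    have e1 := abs_le.1 (hnear n)
    have e2 := hC.abs_sub_le (n / N) ξ
    have e3 : N * |(n : ℝ) / N - ξ| ≤ N * (ρ / 2) + 3 := by
      rw [show (n : ℝ) / N - ξ = (n - N * ξ) / N by field_simp, abs_div, abs_of_pos hN',
        mul_div_cancel₀ _ hN'.ne', abs_le]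
      constructor <;> linarith
    have e4 : |N * (g (n / N) - g ξ)| ≤ N * (ρ / 2) + 3 := by
      rw [abs_mul, abs_of_pos hN']
      exact (mul_le_mul_of_nonneg_left e2 hN'.le).trans e3
    rw [abs_le] at e4
    constructor
    · have : (alo : ℝ) ≤ h n - 1 := by linarith
      exact_mod_cast this
    · have : (h n : ℝ) ≤ ahi := by linarith
      exact_mod_cast this
  have hpath := flipDrift_path_sum hC.unit hC.shear (hC.step_bounds hN0 hh)
    (fun n a => w (site u β n a)) lo A alo ahi hσ hrow hw0 hw1
  have hF : ∀ x, (latticeBox N x ∩ threeBalls (graphPoint u β g ξ) (graphPoint u β g ξ₀)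
      (graphPoint u β g ξ₁) r δ δ).Nonempty →
      x ∈ (Finset.range A ×ˢ Finset.Icc alo ahi).image fun q => site u β (lo + q.1) q.2 := by
    intro x hx
    obtain ⟨n, a, rfl⟩ := hC.unit.exists_site_eq β x
    obtain ⟨e1, e2⟩ := hmeet n a hx
    rw [abs_le] at e1 e2
    have n1 : (lo : ℝ) < n := by linarith
    have n2 : (n : ℝ) < lo + A := by linarith
    have a1 : (alo : ℝ) ≤ a := by linarith
    have a2 : (a : ℝ) ≤ ahi := by linarith
    norm_cast at n1 n2 a1 a2
    rw [Finset.mem_image]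
    refine ⟨((n - lo).toNat, a), ?_, ?_⟩
    · rw [Finset.mem_product, Finset.mem_range, Finset.mem_Icc]
      exact ⟨by dsimp only; omega, a1, a2⟩
    · dsimp only
      congr 1
      omega
  rw [hX.averagedDrift_eq hN0 _ _ _ _ r hδ hF, Finset.sum_image, Finset.sum_product]
  · exact hpath
  · rintro ⟨k, a⟩ - ⟨k', a'⟩ - he
    have := hC.unit.site_injective β (a₁ := (lo + k, a)) (a₂ := (lo + k', a')) he
    simp only [Prod.mk.injEq, add_right_inj, Nat.cast_inj] at this
    exact Prod.ext this.1 this.2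

/-- The offset is nonzero only in the sheared chart, where the outer site of a step is the inner
site of the next one, so the constant part of the steps telescopes. -/
theorem offset_sum (hC : GraphChart D u β g ξ ρ c) (h : ℤ → ℤ) (w : ℤ × ℤ → ℝ) (m : ℝ) (b : ℤ)
    (M : ℕ) : ∑ k ∈ Finset.range M, (stepOffset β m : ℝ) * stepIncrement u β h w (b + k) =
      stepOffset β m * (w (site u β (b + M) (innerRow β h (b + M))) -
        w (site u β b (innerRow β h b))) := by
  rw [← Finset.mul_sum]
  rcases hC.shear with rfl | rfl
  · simp [stepOffset]
  · have := Finset.sum_range_sub (fun k : ℕ => w (site u 1 (b + k) (innerRow 1 h (b + k)))) M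
    simp only [Nat.cast_zero, add_zero] at this
    rw [← this]
    congr 1
    refine Finset.sum_congr rfl fun k _ => ?_
    simp only [stepIncrement, outerRow, one_ne_zero, if_false]
    push_cast
    simp only [add_assoc]

/-- The averaged drift around a point of the interface is half the difference of the fluxes through
the two ends. -/
theorem averagedDrift_limit (hC : GraphChart D u β g ξ ρ c) (hX : IsGlauberDynamics X P)
    {m₀ m₁ r ξ₀ ξ₁ : ℝ} (hm₀ : |m₀| ≤ 1) (hm₁ : |m₁| ≤ 1) (hm₀β : β = 1 → 0 ≤ m₀)
    (hm₁β : β = 1 → 0 ≤ m₁) (hreg₀ : RegularAt g m₀ ξ₀) (hreg₁ : RegularAt g m₁ ξ₁)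
    (h0 : ‖graphPoint u β g ξ₀ - graphPoint u β g ξ‖ = r)
    (h1 : ‖graphPoint u β g ξ₁ - graphPoint u β g ξ‖ = r)
    (hr0 : 0 < r) (hr : 16 * r ≤ ρ) (h0ξ : ξ₀ < ξ) (h1ξ : ξ < ξ₁) {ε : ℝ} (hε : 0 < ε) :
    ∀ᶠ δ in 𝓝[>] 0, ∀ᶠ N : ℕ in atTop,
      |averagedDrift X P N (initialConfig D N) (graphPoint u β g ξ) (graphPoint u β g ξ₀)
        (graphPoint u β g ξ₁) r δ + 1 / 2 * (endFlux β m₁ - endFlux β m₀)| ≤ ε := by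
  have hρ := hC.radius_pos
  have hc := hC.growth_pos
  have b0 : ξ - ρ / 8 ≤ ξ₀ := by
    have := abs_le.1 (hC.abs_sub_le_norm ξ₀ ξ)
    rw [h0] at this
    linarith
  have b1 : ξ₁ ≤ ξ + ρ / 8 := by
    have := abs_le.1 (hC.abs_sub_le_norm ξ₁ ξ)
    rw [h1] at this
    linarith
  obtain ⟨δ₀, hδ₀, hleft⟩ := hC.left_half_flux hm₀ hm₀β hreg₀ h0 h1 b0 h0ξ h1ξ b1 ε hε
  obtain ⟨δ₁, hδ₁, hright⟩ := hC.right_half_flux hm₁ hm₁β hreg₁ h0 h1 b0 h0ξ h1ξ b1 ε hε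
  filter_upwards [Ioo_mem_nhdsGT (lt_min hδ₀ (lt_min hδ₁ hr0))] with δ hδ
  obtain ⟨hδ0, hδ1⟩ := hδ
  simp only [lt_min_iff] at hδ1
  obtain ⟨d0, d1, d2⟩ := hδ1
  filter_upwards [hleft δ hδ0 d0, hright δ hδ0 d1, eventually_gt_atTop 0,
    eventually_le_mul_natCast hρ 40, eventually_le_mul_natCast (sub_pos.2 h0ξ) (8 / c + 1),
    eventually_le_mul_natCast (sub_pos.2 h1ξ) (8 / c + 1)] with N hleft hright hN hρN hN0 hN1
  have hN' : (0 : ℝ) < N := by exact_mod_cast hN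
  obtain ⟨lo, hlo⟩ : ∃ lo : ℤ, lo = ⌊N * (ξ - ρ / 2)⌋ := ⟨_, rfl⟩
  obtain ⟨a, ha⟩ : ∃ a : ℤ, a = ⌈N * ξ⌉ := ⟨_, rfl⟩
  obtain ⟨hi, hhi⟩ : ∃ hi : ℤ, hi = ⌈N * (ξ + ρ / 2)⌉ := ⟨_, rfl⟩
  have lo1 : (lo : ℝ) ≤ N * (ξ - ρ / 2) := hlo ▸ Int.floor_le _
  have lo2 : N * (ξ - ρ / 2) - 1 < lo := by rw [hlo]; exact Int.sub_one_lt_floor _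
  have a1 : N * ξ ≤ a := ha ▸ Int.le_ceil _
  have a2 : a < N * ξ + 1 := by rw [ha]; exact Int.ceil_lt_add_one _
  have hi1 : N * (ξ + ρ / 2) ≤ hi := hhi ▸ Int.le_ceil _
  have hi2 : hi < N * (ξ + ρ / 2) + 1 := by rw [hhi]; exact Int.ceil_lt_add_one _
  have hloa : lo ≤ a := by
    have : (lo : ℝ) ≤ a := by linarith
    exact_mod_cast this
  have hahi : a ≤ hi := by
    have : (a : ℝ) ≤ hi := by linarith
    exact_mod_cast this
  obtain ⟨A₁, rfl⟩ : ∃ A₁ : ℕ, a = lo + A₁ := ⟨(a - lo).toNat, by omega⟩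
  obtain ⟨A₂, rfl⟩ : ∃ A₂ : ℕ, hi = lo + A₁ + A₂ := ⟨(hi - (lo + A₁)).toNat, by omega⟩
  push_cast at a1 a2 hi1 hi2
  obtain ⟨h, hh, hsum, hw0, hw1⟩ := hC.averagedDrift_eq_step_sum hX h0 h1 d2.le hδ0 hr hρN (lo := lo)
    (A := A₁ + A₂) (by linarith) lo1 (by push_cast; linarith) (by push_cast; linarith)
  set w := averageWeight N (graphPoint u β g ξ) (graphPoint u β g ξ₀) (graphPoint u β g ξ₁) r δ
    with hw
  have hL := hleft h hh lo A₁ a1 a2.le (by linarith) lo1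
  have hR := hright h hh (lo + A₁) A₂ (by push_cast; exact a1) (by push_cast; exact a2.le)
    (by push_cast; exact hi1) (by push_cast; linarith)
  have hmid : w (site u β (lo + A₁) (innerRow β h (lo + A₁))) = 1 :=
    hC.weight_eq_one hN (hC.innerRow_near hN hh _) h0 h1 (by linarith) (by linarith)
      (by push_cast; linarith) (by push_cast; linarith) _ _
  -- The offsets may differ at the two ends, so the sum is cut at a column where the weight is `1`.
  -- The telescoped part then equals the offset on the left and its negative on the right, which
  -- completes `endFlux`.
  have split : ∀ (m : ℝ) (b : ℤ) (M : ℕ),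
      ∑ k ∈ Finset.range M, ((h (b + k + 1) - h (b + k) : ℤ) : ℝ) * stepIncrement u β h w (b + k) =
      ∑ k ∈ Finset.range M, (((h (b + k + 1) - h (b + k) : ℤ) : ℝ) - stepOffset β m) *
        stepIncrement u β h w (b + k) + stepOffset β m *
        (w (site u β (b + M) (innerRow β h (b + M))) - w (site u β b (innerRow β h b))) := by
    intro m b M
    rw [← hC.offset_sum, ← Finset.sum_add_distrib]
    exact Finset.sum_congr rfl fun k _ => by ring
  rw [Nat.cast_add, ← add_assoc] at hw1
  have hR' := split m₁ (lo + A₁) A₂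
  have hL' := split m₀ lo A₁
  rw [hmid, hw1] at hR'
  rw [hmid, hw0] at hL'
  rw [hsum, Finset.sum_range_add, hL']
  simp only [Nat.cast_add, ← add_assoc]
  rw [hR', endFlux, endFlux]
  rw [abs_le] at hL hR ⊢
  constructor <;> linarith

end GraphChart

/-! ### Local graphs -/

theorem HasStrictDerivAt.exists_slope_near {G : ℝ → ℝ} {m ξ : ℝ} (hG : HasStrictDerivAt G m ξ)
    {η : ℝ} (hη : 0 < η) : ∃ ρ > 0, ∀ x y, |x - ξ| < ρ → |y - ξ| < ρ → x ≤ y →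
      |G y - G x - m * (y - x)| ≤ η * (y - x) := by
  have h := hG.isLittleO.def hη
  obtain ⟨ρ, hρ, hball⟩ := Metric.eventually_nhds_iff.1 h
  refine ⟨ρ, hρ, fun x y hx hy hxy => ?_⟩
  have := @hball (y, x) (by
    rw [Prod.dist_eq, max_lt_iff, Real.dist_eq, Real.dist_eq]; exact ⟨hy, hx⟩)
  simp only [ContinuousLinearMap.toSpanSingleton_apply, smul_eq_mul, Real.norm_eq_abs] at this
  rw [abs_of_nonneg (sub_nonneg.2 hxy), mul_comm (y - x)] at this
  exact this

theorem RegularAt.of_hasStrictDerivAt {g : ℝ → ℝ} {m ξ : ℝ} (hg : HasStrictDerivAt g m ξ) :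
    RegularAt g m ξ := by
  refine ⟨hg.hasDerivAt, ?_⟩
  rcases eq_or_ne m (1 / 2) with rfl | hm
  · exact ⟨1, one_pos, fun x y _ _ _ => ⟨fun h => absurd h (lt_irrefl _),
      fun h => absurd h (lt_irrefl _)⟩⟩
  · obtain ⟨ρ, hρ, h⟩ := hg.exists_slope_near (abs_pos.2 (sub_ne_zero.2 hm))
    refine ⟨ρ, hρ, fun x y hx hy hxy => ?_⟩
    have h1 := abs_le.1 (h x y hx hy hxy)
    constructor
    · intro hlt
      rw [abs_of_neg (sub_neg.2 hlt)] at h1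
      linarith
    · intro hlt
      rw [abs_of_pos (sub_pos.2 hlt)] at h1
      linarith

theorem exists_local_inverse {A : ℝ → ℝ} (hA : ContDiff ℝ 2 A) {t : ℝ} (ht : deriv A t ≠ 0) :
    ∃ φ : ℝ → ℝ, φ (A t) = t ∧ (∀ᶠ x in 𝓝 (A t), A (φ x) = x) ∧ (∀ᶠ τ in 𝓝 t, φ (A τ) = τ) ∧
      ContDiffAt ℝ 2 φ (A t) := by
  have hd : HasDerivAt A (deriv A t) t := (hA.differentiable (by norm_num) t).hasDerivAt
  have hf := hd.hasFDerivAt_equiv ht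
  refine ⟨hA.contDiffAt.localInverse hf (by norm_num), hA.contDiffAt.localInverse_apply_image hf _,
    (hA.contDiffAt.hasStrictFDerivAt' hf (by norm_num)).eventually_right_inverse,
    (hA.contDiffAt.hasStrictFDerivAt' hf (by norm_num)).eventually_left_inverse,
    hA.contDiffAt.to_localInverse hf _⟩

theorem hasDerivAt_local_graph {A B φ : ℝ → ℝ} (hA : ContDiff ℝ 2 A) (hB : ContDiff ℝ 2 B) {x : ℝ}
    (hx : deriv A (φ x) ≠ 0) (hφ : ContinuousAt φ x) (hAφ : ∀ᶠ y in 𝓝 x, A (φ y) = y) :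
    HasDerivAt φ (deriv A (φ x))⁻¹ x ∧
    HasDerivAt (fun y => B (φ y)) (deriv B (φ x) / deriv A (φ x)) x := by
  have h1 : HasDerivAt φ (deriv A (φ x))⁻¹ x := HasDerivAt.of_local_left_inverse hφ
    (hA.differentiable (by norm_num) _).hasDerivAt hx hAφ
  exact ⟨h1, (hB.differentiable (by norm_num) _).hasDerivAt.comp x h1⟩

theorem hasDerivAt_local_slope {A B φ : ℝ → ℝ} (hA : ContDiff ℝ 2 A) (hB : ContDiff ℝ 2 B) {x : ℝ}
    (hx : deriv A (φ x) ≠ 0) (hφ : ContinuousAt φ x) (hAφ : ∀ᶠ y in 𝓝 x, A (φ y) = y) :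
    HasDerivAt (fun y => deriv B (φ y) / deriv A (φ y))
      ((deriv A (φ x) * deriv (deriv B) (φ x) - deriv (deriv A) (φ x) * deriv B (φ x)) /
        deriv A (φ x) ^ 3) x := by
  have h1 := (hasDerivAt_local_graph hA hB hx hφ hAφ).1
  have h2 : ∀ F : ℝ → ℝ, ContDiff ℝ 2 F →
      HasDerivAt (fun y => deriv F (φ y)) (deriv (deriv F) (φ x) * (deriv A (φ x))⁻¹) x := by
    intro F hF
    have : ContDiff ℝ 1 (deriv F) := ((contDiff_succ_iff_deriv (n := 1)).1 (by
      simpa [one_add_one_eq_two] using hF)).2.2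
    exact HasDerivAt.comp x (this.differentiable (by norm_num) _).hasDerivAt h1
  refine ((h2 B hB).div (h2 A hA) hx).congr_deriv ?_
  field_simp

/-- Every direction is strictly closer to an axis direction than to the diagonals, or is diagonal. -/
theorem exists_unit_chart {V : ℂ} (hV : V ≠ 0) : ∃ u, IsUnitVector u ∧ ∃ β : ℤ,
    (β = 0 ∧ |chartSnd u V| < chartFst u β V) ∨
      (β = 1 ∧ 0 < chartSnd u V ∧ chartFst u β V = 2 * chartSnd u V) := by
  have hne : ¬ (V.re = 0 ∧ V.im = 0) := fun h => hV (Complex.ext h.1 h.2)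
  rcases lt_trichotomy |V.re| |V.im| with h | h | h
  · rcases lt_or_ge 0 V.im with h2 | h2
    · refine ⟨(0, 1), by simp [IsUnitVector], 0, Or.inl ⟨rfl, ?_⟩⟩
      rw [abs_of_pos h2] at h
      simpa [chartSnd, chartFst] using h
    · refine ⟨(0, -1), by simp [IsUnitVector], 0, Or.inl ⟨rfl, ?_⟩⟩
      rw [abs_of_nonpos h2] at h
      simpa [chartSnd, chartFst] using h
  · rcases lt_trichotomy V.re 0 with h1 | h1 | h1
    · rcases lt_or_ge 0 V.im with h2 | h2
      · rw [abs_of_neg h1, abs_of_pos h2] at h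
        refine ⟨(0, 1), by simp [IsUnitVector], 1, Or.inr ⟨rfl, ?_⟩⟩
        simp only [chartSnd, chartFst]; push_cast
        constructor <;> linarith
      · rw [abs_of_neg h1, abs_of_nonpos h2] at h
        refine ⟨(-1, 0), by simp [IsUnitVector], 1, Or.inr ⟨rfl, ?_⟩⟩
        simp only [chartSnd, chartFst]; push_cast
        constructor <;> linarith
    · rw [h1, abs_zero, eq_comm, abs_eq_zero] at h
      exact absurd ⟨h1, h⟩ hne
    · rcases lt_or_ge 0 V.im with h2 | h2
      · rw [abs_of_pos h1, abs_of_pos h2] at h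
        refine ⟨(1, 0), by simp [IsUnitVector], 1, Or.inr ⟨rfl, ?_⟩⟩
        simp only [chartSnd, chartFst]; push_cast
        constructor <;> linarith
      · rw [abs_of_pos h1, abs_of_nonpos h2] at h
        refine ⟨(0, -1), by simp [IsUnitVector], 1, Or.inr ⟨rfl, ?_⟩⟩
        simp only [chartSnd, chartFst]; push_cast
        constructor <;> linarith
  · rcases lt_or_ge 0 V.re with h2 | h2
    · refine ⟨(1, 0), by simp [IsUnitVector], 0, Or.inl ⟨rfl, ?_⟩⟩
      rw [abs_of_pos h2] at h
      simpa [chartSnd, chartFst] using h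
    · refine ⟨(-1, 0), by simp [IsUnitVector], 0, Or.inl ⟨rfl, ?_⟩⟩
      rw [abs_of_nonpos h2] at h
      simpa [chartSnd, chartFst] using h

/-! ### Parameters of the Jordan curve -/

namespace IsC2JordanCurve

variable {γ : ℝ → ℂ} {T : ℝ}

theorem exists_zsmul_of_eq (hγ : IsC2JordanCurve γ T) {τ τ' : ℝ} (h : γ τ = γ τ') :
    ∃ n : ℤ, τ - τ' = n * T := by
  have hT := hγ.period_pos
  have key : ∀ τ, γ (toIcoMod hT 0 τ) = γ τ := fun τ => by
    rw [← self_sub_toIcoDiv_zsmul]; exact hγ.periodic.sub_zsmul_eq _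
  have h1 := hγ.injOn (toIcoMod_mem_Ico' hT τ) (toIcoMod_mem_Ico' hT τ')
    ((key τ).trans (h.trans (key τ').symm))
  rw [← self_sub_toIcoDiv_zsmul, ← self_sub_toIcoDiv_zsmul, zsmul_eq_mul, zsmul_eq_mul] at h1
  refine ⟨toIcoDiv hT 0 τ - toIcoDiv hT 0 τ', ?_⟩
  push_cast
  linarith

theorem eq_of_abs_sub_lt (hγ : IsC2JordanCurve γ T) {τ τ' : ℝ} (h : γ τ = γ τ')
    (hlt : |τ - τ'| < T) : τ = τ' := by
  obtain ⟨n, hn⟩ := hγ.exists_zsmul_of_eq h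
  have hT := hγ.period_pos
  rw [hn, abs_mul, abs_of_pos hT] at hlt
  have : |(n : ℝ)| < 1 := by
    by_contra! h1
    nlinarith
  have : n = 0 := by
    have h2 : |n| < 1 := by exact_mod_cast this
    exact Int.abs_lt_one_iff.1 h2
  rw [this, Int.cast_zero, zero_mul] at hn
  exact sub_eq_zero.1 hn

/-- Within one period, the arc of parameters away from `t` is compact and misses `γ t`, hence stays
at a positive distance. No other branch of the curve comes near the base point. -/
theorem exists_near_parameter (hγ : IsC2JordanCurve γ T) (t : ℝ) {κ : ℝ} (hκ : 0 < κ) :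
    ∃ d > 0, ∀ τ, ‖γ τ - γ t‖ < d → ∃ τ', |τ' - t| < κ ∧ γ τ' = γ τ := by
  have hT := hγ.period_pos
  have hK : IsCompact (γ '' (Icc (t - T / 2) (t + T / 2) \ Ioo (t - κ) (t + κ))) :=
    (isCompact_Icc.diff isOpen_Ioo).image hγ.contDiff.continuous
  have ht : γ t ∉ γ '' (Icc (t - T / 2) (t + T / 2) \ Ioo (t - κ) (t + κ)) := by
    rintro ⟨τ, ⟨h1, h2⟩, h3⟩
    have := hγ.eq_of_abs_sub_lt h3 (by
      rw [abs_lt]; constructor <;> linarith [h1.1, h1.2])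
    rw [this] at h2
    exact h2 ⟨by linarith, by linarith⟩
  obtain ⟨d, hd, hball⟩ := Metric.isOpen_iff.1 hK.isClosed.isOpen_compl (γ t) ht
  refine ⟨d, hd, fun τ hτ => ⟨toIcoMod hT (t - T / 2) τ, ?_, ?_⟩⟩
  · by_contra! hge
    refine hball (a := γ τ) (by rwa [Metric.mem_ball, dist_eq_norm])
      ⟨toIcoMod hT (t - T / 2) τ, ⟨?_, ?_⟩, ?_⟩
    · have := toIcoMod_mem_Ico hT (t - T / 2) τ
      exact ⟨this.1, by linarith [this.2]⟩
    · rintro ⟨h1, h2⟩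
      exact absurd hge (not_le.2 (by rw [abs_lt]; constructor <;> linarith))
    · rw [← self_sub_toIcoDiv_zsmul]; exact hγ.periodic.sub_zsmul_eq _
  · rw [← self_sub_toIcoDiv_zsmul]; exact hγ.periodic.sub_zsmul_eq _

end IsC2JordanCurve

theorem HasDerivAt.chartFst {f : ℝ → ℂ} {f' : ℂ} {τ : ℝ} (hf : HasDerivAt f f' τ) (u : ℤ × ℤ)
    (β : ℤ) : HasDerivAt (fun τ => _root_.chartFst u β (f τ)) (_root_.chartFst u β f') τ := by
  have hre : HasDerivAt (fun τ => (f τ).re) f'.re τ := Complex.reCLM.hasFDerivAt.comp_hasDerivAt τ hf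
  have him : HasDerivAt (fun τ => (f τ).im) f'.im τ := Complex.imCLM.hasFDerivAt.comp_hasDerivAt τ hf
  exact ((hre.mul_const _).add (him.mul_const _)).add
    (((him.mul_const _).sub (hre.mul_const _)).const_mul _)

theorem HasDerivAt.chartSnd {f : ℝ → ℂ} {f' : ℂ} {τ : ℝ} (hf : HasDerivAt f f' τ) (u : ℤ × ℤ) :
    HasDerivAt (fun τ => _root_.chartSnd u (f τ)) (_root_.chartSnd u f') τ := by
  have hre : HasDerivAt (fun τ => (f τ).re) f'.re τ := Complex.reCLM.hasFDerivAt.comp_hasDerivAt τ hf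
  have him : HasDerivAt (fun τ => (f τ).im) f'.im τ := Complex.imCLM.hasFDerivAt.comp_hasDerivAt τ hf
  exact (him.mul_const _).sub (hre.mul_const _)

theorem ContDiff.chartFst {f : ℝ → ℂ} {n : WithTop ℕ∞} (hf : ContDiff ℝ n f) (u : ℤ × ℤ) (β : ℤ) :
    ContDiff ℝ n fun τ => _root_.chartFst u β (f τ) := by
  have hre : ContDiff ℝ n fun τ => (f τ).re := Complex.reCLM.contDiff.comp hf
  have him : ContDiff ℝ n fun τ => (f τ).im := Complex.imCLM.contDiff.comp hf
  exact ((hre.mul contDiff_const).add (him.mul contDiff_const)).add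
    (contDiff_const.mul ((him.mul contDiff_const).sub (hre.mul contDiff_const)))

theorem ContDiff.chartSnd {f : ℝ → ℂ} {n : WithTop ℕ∞} (hf : ContDiff ℝ n f) (u : ℤ × ℤ) :
    ContDiff ℝ n fun τ => _root_.chartSnd u (f τ) := by
  have hre : ContDiff ℝ n fun τ => (f τ).re := Complex.reCLM.contDiff.comp hf
  have him : ContDiff ℝ n fun τ => (f τ).im := Complex.imCLM.contDiff.comp hf
  exact (him.mul contDiff_const).sub (hre.mul contDiff_const)

/-! ### The curve as a graph in a lattice chart -/

/-- Near the parameter `t`, the curve `γ` is the graph of `g` in a lattice chart, and `φ` is the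
parameter as a function of the first coordinate. -/
structure CurveChart (γ : ℝ → ℂ) (T t : ℝ) (u : ℤ × ℤ) (β : ℤ) (g φ : ℝ → ℝ) (ξ ρ : ℝ) : Prop where
  unit : IsUnitVector u
  direction : (β = 0 ∧ |chartSnd u (deriv γ t)| < chartFst u β (deriv γ t)) ∨
    (β = 1 ∧ 0 < chartSnd u (deriv γ t) ∧
      chartFst u β (deriv γ t) = 2 * chartSnd u (deriv γ t))
  radius_pos : 0 < ρ
  slope : ∀ x y, x ≤ y → -(1 - β) * (y - x) ≤ g y - g x ∧ g y - g x ≤ y - x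
  near : ∀ x y, |x - ξ| ≤ ρ → |y - ξ| ≤ ρ → x ≤ y → |g y - g x - deriv g ξ * (y - x)| ≤ (y - x) / 4
  base : φ ξ = t
  curve : ∀ x, |x - ξ| ≤ ρ → γ (φ x) = graphPoint u β g x
  parameter : ∀ x, |x - ξ| ≤ ρ → |φ x - t| < T / 2 ∧ (x < ξ → φ x < t) ∧ (ξ < x → t < φ x)
  cover : ∀ τ, ‖γ τ - γ t‖ ≤ 6 * ρ → γ τ = graphPoint u β g (chartFst u β (γ τ))
  regular : ∀ x, |x - ξ| ≤ ρ →
    RegularAt g (deriv g x) x ∧ |deriv g x| ≤ 1 ∧ (β = 1 → 0 ≤ deriv g x)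
  deriv_eq : deriv g ξ = chartSnd u (deriv γ t) / chartFst u β (deriv γ t)
  hasDerivAt_deriv : HasDerivAt (deriv g)
    ((chartFst u β (deriv γ t) * chartSnd u (deriv (deriv γ) t) -
      chartFst u β (deriv (deriv γ) t) * chartSnd u (deriv γ t)) / chartFst u β (deriv γ t) ^ 3) ξ

/-- The first coordinate has positive derivative at `t` by the choice of chart, so it can serve as a
local parameter. The slope lies strictly inside the interval allowed by `β`, which leaves room for a
neighbourhood. -/
theorem exists_curveChart {γ : ℝ → ℂ} {T : ℝ} (hγ : IsC2JordanCurve γ T) (t : ℝ) :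
    ∃ u β g φ ρ, CurveChart γ T t u β g φ (chartFst u β (γ t)) ρ := by
  obtain ⟨u, hu, β, hdir⟩ := exists_unit_chart (hγ.regular t)
  set A : ℝ → ℝ := fun τ => chartFst u β (γ τ) with hAdef
  set B : ℝ → ℝ := fun τ => chartSnd u (γ τ) with hBdef
  have hA : ContDiff ℝ 2 A := hγ.contDiff.chartFst u β
  have hB : ContDiff ℝ 2 B := hγ.contDiff.chartSnd u
  have hγ' : ∀ τ, HasDerivAt γ (deriv γ τ) τ := fun τ =>
    (hγ.contDiff.differentiable (by norm_num) τ).hasDerivAt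
  have hγ1 : ContDiff ℝ 1 (deriv γ) := ((contDiff_succ_iff_deriv (n := 1)).1 (by
      simpa [one_add_one_eq_two] using hγ.contDiff)).2.2
  have hγ'' : ∀ τ, HasDerivAt (deriv γ) (deriv (deriv γ) τ) τ := fun τ =>
    (hγ1.differentiable (by norm_num) τ).hasDerivAt
  have dA : deriv A = fun τ => chartFst u β (deriv γ τ) := funext fun τ => ((hγ' τ).chartFst u β).deriv
  have dB : deriv B = fun τ => chartSnd u (deriv γ τ) := funext fun τ => ((hγ' τ).chartSnd u).deriv
  have ddA : deriv (deriv A) t = chartFst u β (deriv (deriv γ) t) := by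
    rw [dA]; exact ((hγ'' t).chartFst u β).deriv
  have ddB : deriv (deriv B) t = chartSnd u (deriv (deriv γ) t) := by
    rw [dB]; exact ((hγ'' t).chartSnd u).deriv
  have hdir' : (β = 0 ∧ |deriv B t| < deriv A t) ∨
      (β = 1 ∧ 0 < deriv B t ∧ deriv A t = 2 * deriv B t) := by rw [dA, dB]; exact hdir
  have hapos : 0 < deriv A t := by
    rcases hdir' with ⟨-, h⟩ | ⟨-, h1, h2⟩
    · exact (abs_nonneg _).trans_lt h
    · linarith
  have hβ : β = 0 ∨ β = 1 := hdir.imp And.left And.left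
  set m := deriv B t / deriv A t with hm
  have hm1 : -(1 - β : ℝ) < m ∧ m < 1 := by
    rw [hm, lt_div_iff₀ hapos, div_lt_one hapos]
    rcases hdir' with ⟨rfl, h⟩ | ⟨rfl, h1, h2⟩
    · have := abs_lt.1 h
      push_cast; constructor <;> linarith
    · push_cast; constructor <;> linarith
  obtain ⟨φ, hφt, hAφ, hφA, hφ⟩ := exists_local_inverse hA hapos.ne'
  set ξ := A t with hξ
  have hT := hγ.period_pos
  have hcont : ContinuousAt φ ξ := hφ.continuousAt
  have hdAc : Continuous (deriv A) := hA.continuous_deriv (by norm_num)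
  have hslopeD := hasDerivAt_local_slope hA hB (x := ξ) (by rw [hφt]; exact hapos.ne') hcont hAφ
  have hφs : HasStrictDerivAt φ (deriv A t)⁻¹ ξ := by
    refine hφ.hasStrictDerivAt' ?_ (by norm_num)
    have := (hasDerivAt_local_graph hA hB (x := ξ) (by rw [hφt]; exact hapos.ne') hcont hAφ).1
    rwa [hφt] at this
  have hGs : ∀ᶠ x in 𝓝 ξ, HasStrictDerivAt (fun y => B (φ y)) (deriv B (φ x) / deriv A (φ x)) x := by
    filter_upwards [hφ.eventually (by simp), hAφ.eventually_nhds,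
      (hdAc.continuousAt.comp hcont).eventually_ne (by
        simp only [Function.comp, hφt]; exact hapos.ne')] with x h1 h2 h3
    exact ContDiffAt.hasStrictDerivAt' (hB.contDiffAt.comp x h1)
      (hasDerivAt_local_graph hA hB h3 h1.continuousAt h2).2 (by norm_num)
  have hGξ := hGs.self_of_nhds
  rw [hφt] at hGξ
  -- The bound `1/4` serves `near`; the other two keep all nearby slopes between `-(1 - β)` and `1`.
  obtain ⟨η, hη, hη1, hη2, hη3⟩ : ∃ η > 0, η ≤ 1 / 4 ∧ η ≤ m + (1 - β) ∧ η ≤ 1 - m :=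
    ⟨min (1 / 4) (min (m + (1 - β)) (1 - m)), lt_min (by norm_num) (lt_min (by linarith) (by linarith)),
      min_le_left _ _, (min_le_right _ _).trans (min_le_left _ _),
      (min_le_right _ _).trans (min_le_right _ _)⟩
  obtain ⟨ρ₃, hρ₃, hGnear⟩ := hGξ.exists_slope_near hη
  obtain ⟨ρ₄, hρ₄, hφnear⟩ := hφs.exists_slope_near (half_pos (inv_pos.2 hapos))
  have hSξ : (fun y => deriv B (φ y) / deriv A (φ y)) ξ = m := by simp only [hφt, hm]
  have hSc := hslopeD.continuousAt
  have hev : ∀ᶠ x in 𝓝 ξ, A (φ x) = x ∧ |φ x - t| < T / 2 ∧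
      HasStrictDerivAt (fun y => B (φ y)) (deriv B (φ x) / deriv A (φ x)) x ∧
      deriv B (φ x) / deriv A (φ x) ∈ Ioo (-(1 - β : ℝ)) 1 := by
    refine hAφ.and (Eventually.and ?_ (hGs.and ?_))
    · refine (hcont.sub continuousAt_const).abs.eventually_lt continuousAt_const ?_
      rw [Pi.sub_apply, hφt, sub_self, abs_zero]; positivity
    · exact hSc.eventually_mem (by simp only [hSξ]; exact Ioo_mem_nhds hm1.1 hm1.2)
  obtain ⟨ρ₂, hρ₂, hball⟩ := Metric.eventually_nhds_iff.1 hev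
  obtain ⟨ρ₁, hρ₁, l2, l3, l4⟩ : ∃ ρ₁ > 0, ρ₁ < ρ₂ ∧ ρ₁ < ρ₃ ∧ ρ₁ < ρ₄ :=
    ⟨min ρ₂ (min ρ₃ ρ₄) / 2, by positivity,
      (half_lt_self (by positivity)).trans_le (min_le_left _ _),
      (half_lt_self (by positivity)).trans_le ((min_le_right _ _).trans (min_le_left _ _)),
      (half_lt_self (by positivity)).trans_le ((min_le_right _ _).trans (min_le_right _ _))⟩
  -- Clamping the argument extends the local graph to the whole line by constants. Slope `0` is
  -- allowed for both values of `β`, so the global slope bounds survive.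
  set cl : ℝ → ℝ := fun x => max (ξ - ρ₁) (min x (ξ + ρ₁)) with hcl
  have hcl1 : ∀ x, |cl x - ξ| ≤ ρ₁ := fun x => by
    rw [abs_le]
    have h1 : ξ - ρ₁ ≤ cl x := le_max_left _ _
    have h2 : cl x ≤ ξ + ρ₁ := max_le (by linarith) (min_le_right _ _)
    constructor <;> linarith
  have hcl2 : ∀ x y, x ≤ y → cl x ≤ cl y ∧ cl y - cl x ≤ y - x := fun x y hxy => by
    refine ⟨max_le_max le_rfl (min_le_min hxy le_rfl), ?_⟩
    rw [sub_le_iff_le_add]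
    refine max_le ?_ ?_
    · have : ξ - ρ₁ ≤ cl x := le_max_left _ _
      linarith
    · have : min x (ξ + ρ₁) ≤ cl x := le_max_right _ _
      rcases le_total x (ξ + ρ₁) with h | h
      · rw [min_eq_left h] at this
        exact (min_le_left _ _).trans (by linarith)
      · rw [min_eq_right h] at this
        exact (min_le_right _ _).trans (by linarith)
  have hcl3 : ∀ x, |x - ξ| ≤ ρ₁ → cl x = x := fun x hx => by
    rw [abs_le] at hx
    simp only [hcl]
    rw [min_eq_left (by linarith), max_eq_right (by linarith)]
  set G : ℝ → ℝ := fun y => B (φ y) with hGdef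
  set g : ℝ → ℝ := fun x => G (cl x) with hg
  have hgG : ∀ x, |x - ξ| < ρ₁ → g =ᶠ[𝓝 x] G := fun x hx => by
    filter_upwards [(continuous_abs.comp (continuous_sub_right ξ)).isOpen_preimage _ isOpen_Iio
      |>.mem_nhds hx] with y hy
    simp only [hg, hcl3 y (le_of_lt hy)]
  have hgs : ∀ x, |x - ξ| < ρ₁ → HasStrictDerivAt g (deriv B (φ x) / deriv A (φ x)) x :=
    fun x hx => (hball (by rw [Real.dist_eq]; linarith)).2.2.1.congr_of_eventuallyEq (hgG x hx).symm
  have hgd : ∀ x, |x - ξ| < ρ₁ → deriv g x = deriv B (φ x) / deriv A (φ x) :=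
    fun x hx => (hgs x hx).hasDerivAt.deriv
  have hξξ : |ξ - ξ| < ρ₁ := by rwa [sub_self, abs_zero]
  have hgξ : deriv g ξ = m := by rw [hgd ξ hξξ, hφt]
  have hgd' : deriv g =ᶠ[𝓝 ξ] fun x => deriv B (φ x) / deriv A (φ x) := by
    filter_upwards [Metric.ball_mem_nhds ξ hρ₁] with x hx
    rw [Metric.mem_ball, Real.dist_eq] at hx
    exact hgd x hx
  have hGraph : ∀ x, |x - ξ| ≤ ρ₁ → γ (φ x) = graphPoint u β g x := by
    intro x hx
    rw [graphPoint, ← chartPoint_chart hu β (γ (φ x))]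
    have h1 : chartFst u β (γ (φ x)) = x := (hball (by rw [Real.dist_eq]; linarith)).1
    rw [h1]
    simp only [hg, hcl3 x hx, hGdef, hBdef]
  obtain ⟨κ, hκ, hκball⟩ := Metric.eventually_nhds_iff.1 (hφA.and
    (((hA.continuous.sub continuous_const).abs.continuousAt (x := t)).eventually_lt
      (continuousAt_const (y := ρ₁)) hξξ))
  obtain ⟨d, hd, hnear⟩ := hγ.exists_near_parameter t hκ
  -- Half of `ρ₁` stays strictly inside the clamped interval, so `g` agrees with the true graph in a
  -- neighbourhood of each point. The bound `d / 7` gives `6ρ < d`, as `cover` requires.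
  refine ⟨u, β, g, φ, min (ρ₁ / 2) (d / 7), ?_⟩
  have hρle : ∀ {x}, |x - ξ| ≤ min (ρ₁ / 2) (d / 7) → |x - ξ| < ρ₁ := fun hx => by
    have := hx.trans (min_le_left _ _)
    linarith
  refine
    { unit := hu
      direction := hdir
      radius_pos := by positivity
      slope := ?_
      near := ?_
      base := hφt
      curve := fun x hx => hGraph x (hρle hx).le
      parameter := ?_
      cover := ?_
      regular := ?_
      deriv_eq := by rw [hgξ, hm, dA, dB]
      hasDerivAt_deriv := ?_ }
  · intro x y hxy
    obtain ⟨h1, h2⟩ := hcl2 x y hxy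
    have h3 := abs_le.1 (hGnear (cl x) (cl y) ((hcl1 x).trans_lt l3) ((hcl1 y).trans_lt l3) h1)
    have h4 : η * (cl y - cl x) ≤ (m + (1 - β)) * (cl y - cl x) := by gcongr
    have h5 : η * (cl y - cl x) ≤ (1 - m) * (cl y - cl x) := by gcongr
    have hβ0 : (0 : ℝ) ≤ 1 - β := by rcases hβ with rfl | rfl <;> norm_num
    have h6 : (1 - β) * (cl y - cl x) ≤ (1 - β) * (y - x) := by gcongr
    simp only [hg]
    constructor <;> linarith
  · intro x y hx hy hxy
    have h3 := hGnear x y ((hρle hx).trans l3) ((hρle hy).trans l3) hxy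
    rw [hgξ]
    simp only [hg, hcl3 x (hρle hx).le, hcl3 y (hρle hy).le]
    refine h3.trans ?_
    have : η * (y - x) ≤ 1 / 4 * (y - x) := by gcongr
    linarith
  · intro x hx
    refine ⟨(hball (by rw [Real.dist_eq]; linarith [hρle hx])).2.1, fun h => ?_, fun h => ?_⟩
    · have := (abs_le.1 (hφnear x ξ ((hρle hx).trans l4) (by simpa using hρ₄) h.le)).1
      have h2 : 0 < (deriv A t)⁻¹ * (ξ - x) := mul_pos (inv_pos.2 hapos) (sub_pos.2 h)
      rw [hφt] at this
      linarith
    · have := (abs_le.1 (hφnear ξ x (by simpa using hρ₄) ((hρle hx).trans l4) h.le)).1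
      have h2 : 0 < (deriv A t)⁻¹ * (x - ξ) := mul_pos (inv_pos.2 hapos) (sub_pos.2 h)
      rw [hφt] at this
      linarith
  · intro τ hτ
    obtain ⟨τ', h1, h2⟩ := hnear τ (hτ.trans_lt (by
      have := min_le_right (ρ₁ / 2) (d / 7)
      linarith))
    obtain ⟨h3, h4⟩ := hκball (by rwa [Real.dist_eq] : dist τ' t < κ)
    rw [← h2, ← hGraph _ h4.le]
    exact congrArg γ h3.symm
  · intro x hx
    rw [hgd x (hρle hx)]
    refine ⟨.of_hasStrictDerivAt (hgs x (hρle hx)), ?_⟩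
    obtain ⟨h1, h2⟩ := (hball (by rw [Real.dist_eq]; linarith [hρle hx]) : _ ∧ _ ∧ _ ∧ _).2.2.2
    constructor
    · rw [abs_le]
      refine ⟨?_, h2.le⟩
      rcases hβ with rfl | rfl
      · push_cast at h1; linarith
      · push_cast at h1; linarith
    · rintro rfl
      push_cast at h1
      linarith
  · refine (hslopeD.congr_of_eventuallyEq hgd').congr_deriv ?_
    rw [hφt, ddA, ddB, dA, dB]

/-! ### The enclosed set as an epigraph -/

theorem IsPreconnected.subset_interior_or_subset_compl {E : Type*} [TopologicalSpace E] {S D : Set E}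
    (hS : IsPreconnected S) (hSD : Disjoint S (frontier D)) : S ⊆ interior D ∨ S ⊆ Dᶜ := by
  have h := hS.subset_or_subset (u := interior D) (v := (closure D)ᶜ) isOpen_interior
    isClosed_closure.isOpen_compl
    (disjoint_compl_right.mono_left (interior_subset.trans subset_closure)) fun z hz => by
      by_contra hne
      rw [mem_union, not_or, mem_compl_iff, not_not] at hne
      exact disjoint_left.1 hSD hz ⟨hne.2, hne.1⟩
  exact h.imp_right fun h => h.trans (compl_subset_compl.2 subset_closure)

theorem continuous_chartFst (u : ℤ × ℤ) (β : ℤ) : Continuous (chartFst u β) := by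
  unfold chartFst; fun_prop

theorem continuous_chartSnd (u : ℤ × ℤ) : Continuous (chartSnd u) := by
  unfold chartSnd; fun_prop

theorem chartPoint_eq (u : ℤ × ℤ) (β : ℤ) (x y : ℝ) : chartPoint u β x y =
    (((x - β * y) * u.1 - y * u.2 : ℝ) : ℂ) + (((x - β * y) * u.2 + y * u.1 : ℝ) : ℂ) * Complex.I := by
  apply Complex.ext <;> simp [chartPoint]

theorem Continuous.chartPoint {E : Type*} [TopologicalSpace E] {f g : E → ℝ} (hf : Continuous f)
    (hg : Continuous g) (u : ℤ × ℤ) (β : ℤ) : Continuous fun z => chartPoint u β (f z) (g z) := by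
  simp only [chartPoint_eq]
  fun_prop

theorem chartFst_graphPoint {u : ℤ × ℤ} (hu : IsUnitVector u) (β : ℤ) (g : ℝ → ℝ) (x : ℝ) :
    chartFst u β (graphPoint u β g x) = x := chartFst_chartPoint hu β _ _

theorem chartSnd_graphPoint {u : ℤ × ℤ} (hu : IsUnitVector u) (β : ℤ) (g : ℝ → ℝ) (x : ℝ) :
    chartSnd u (graphPoint u β g x) = g x := chartSnd_chartPoint hu β _ _

/-- The points between the graph of `g` and the line at height `b`. -/
def betweenRegion (u : ℤ × ℤ) (β : ℤ) (g : ℝ → ℝ) (ξ ρ b : ℝ) : Set ℂ :=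
  (fun q : ℝ × ℝ => chartPoint u β q.1 (g q.1 + q.2 * (b - g q.1))) ''
    (Ioo (ξ - ρ) (ξ + ρ) ×ˢ Ioo 0 1)

theorem isPreconnected_betweenRegion (u : ℤ × ℤ) (β : ℤ) {g : ℝ → ℝ} (hg : Continuous g)
    (ξ ρ b : ℝ) : IsPreconnected (betweenRegion u β g ξ ρ b) := by
  refine (isPreconnected_Ioo.prod isPreconnected_Ioo).image _ (Continuous.continuousOn ?_)
  exact Continuous.chartPoint continuous_fst (by fun_prop) u β

theorem mem_betweenRegion {u : ℤ × ℤ} (hu : IsUnitVector u) {β : ℤ} {g : ℝ → ℝ} {ξ ρ b : ℝ} {z : ℂ} :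
    z ∈ betweenRegion u β g ξ ρ b ↔ |chartFst u β z - ξ| < ρ ∧
      ∃ l ∈ Ioo (0 : ℝ) 1, chartSnd u z = g (chartFst u β z) + l * (b - g (chartFst u β z)) := by
  constructor
  · rintro ⟨⟨x, l⟩, ⟨hx, hl⟩, rfl⟩
    dsimp only at hx hl ⊢
    rw [chartFst_chartPoint hu, chartSnd_chartPoint hu]
    exact ⟨by rw [abs_lt]; constructor <;> linarith [hx.1, hx.2], l, hl, rfl⟩
  · rintro ⟨hx, l, hl, h⟩
    rw [abs_lt] at hx
    refine ⟨(chartFst u β z, l), ⟨⟨by linarith, by linarith⟩, hl⟩, ?_⟩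
    dsimp only
    rw [← h, chartPoint_chart hu]

/-- Consecutive chords with slopes within `1/2` of each other have scalar product at least `3/8 h
k`: for `β = 1` the factor is `((a + b - 1)² + 1 - (a - b)²)/2`. Projecting the sum onto the first
chord, of norm at most `3|h|`, gives the rate `1/8`. -/
theorem norm_chartPoint_growth {u : ℤ × ℤ} (hu : IsUnitVector u) {β : ℤ} (hβ : β = 0 ∨ β = 1)
    {h k a b : ℝ} (ha : |a| ≤ 1) (hab : |a - b| ≤ 1 / 2) (hhk : 0 ≤ h * k) :
    ‖chartPoint u β h (a * h)‖ + 1 / 8 * |k| ≤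
      ‖chartPoint u β h (a * h) + chartPoint u β k (b * k)‖ := by
  set p := chartPoint u β h (a * h) with hp
  set q := chartPoint u β k (b * k) with hq
  have hdot : 3 / 8 * (h * k) ≤ dot q p := by
    rw [hp, hq, dot_chartPoint hu]
    have hab2 : (a - b) ^ 2 ≤ 1 / 4 := by
      rw [← sq_abs]; nlinarith [abs_nonneg (a - b)]
    rcases hβ with rfl | rfl
    · have : 3 / 8 ≤ 1 + a * b := by nlinarith [sq_nonneg (a + b)]
      have := mul_le_mul_of_nonneg_right this hhk
      push_cast
      linarith
    · have : 3 / 8 ≤ (1 - a) * (1 - b) + a * b := by nlinarith [sq_nonneg (a + b - 1)]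
      have := mul_le_mul_of_nonneg_right this hhk
      push_cast
      linarith
  rcases eq_or_ne h 0 with rfl | hh
  · have hp0 : p = 0 := by
      rw [hp, mul_zero]
      apply Complex.ext <;> simp [chartPoint]
    rw [hp0, norm_zero, zero_add, zero_add]
    have := abs_chartFst_le hu hβ q
    rw [hq, chartFst_chartPoint hu, ← hq] at this
    linarith [norm_nonneg q]
  · have hp3 : ‖p‖ ≤ 3 * |h| := by
      refine (norm_chartPoint_le hu hβ _ _).trans ?_
      rw [abs_mul]
      nlinarith [abs_nonneg h]
    have hp0 : 0 < ‖p‖ := by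
      have := abs_chartFst_le hu hβ p
      rw [hp, chartFst_chartPoint hu, ← hp] at this
      linarith [abs_pos.2 hh]
    have h1 := (abs_le.1 (abs_dot_le (p + q) p)).2
    have h2 : dot (p + q) p = ‖p‖ ^ 2 + dot q p := by
      rw [← dot_self]; simp only [dot, Complex.add_re, Complex.add_im]; ring
    have h3 : h * k = |h| * |k| := by rw [← abs_mul, abs_of_nonneg hhk]
    have h4 : ‖p‖ * |k| ≤ 3 * |h| * |k| := by gcongr
    refine le_of_mul_le_mul_right ?_ hp0
    rw [h3] at hdot
    linarith

namespace CurveChart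

variable {γ : ℝ → ℂ} {T t : ℝ} {u : ℤ × ℤ} {β : ℤ} {g φ : ℝ → ℝ} {ξ ρ : ℝ}

theorem shear (hC : CurveChart γ T t u β g φ ξ ρ) : β = 0 ∨ β = 1 :=
  hC.direction.imp And.left And.left

theorem graphPoint_base (hC : CurveChart γ T t u β g φ ξ ρ) : graphPoint u β g ξ = γ t := by
  rw [← hC.curve ξ (by simpa using hC.radius_pos.le), hC.base]

theorem abs_sub_le (hC : CurveChart γ T t u β g φ ξ ρ) (x y : ℝ) : |g x - g y| ≤ |x - y| := by
  have key : ∀ x y, x ≤ y → |g x - g y| ≤ |x - y| := by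
    intro x y hxy
    obtain ⟨h1, h2⟩ := hC.slope x y hxy
    rw [abs_of_nonpos (sub_nonpos.2 hxy), abs_le]
    rcases hC.shear with rfl | rfl
    · push_cast at h1; constructor <;> linarith
    · push_cast at h1; constructor <;> linarith
  rcases le_total x y with h | h
  · exact key x y h
  · rw [abs_sub_comm (g x), abs_sub_comm x]; exact key y x h

theorem continuous (hC : CurveChart γ T t u β g φ ξ ρ) : Continuous g := by
  refine (LipschitzWith.of_dist_le_mul (K := 1) fun x y => ?_).continuous
  rw [Real.dist_eq, Real.dist_eq, NNReal.coe_one, one_mul]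
  exact hC.abs_sub_le x y

theorem abs_near (hC : CurveChart γ T t u β g φ ξ ρ) {x y : ℝ} (hx : |x - ξ| ≤ ρ)
    (hy : |y - ξ| ≤ ρ) : |g y - g x - deriv g ξ * (y - x)| ≤ |y - x| / 4 := by
  rcases le_total x y with h | h
  · rw [abs_of_nonneg (sub_nonneg.2 h)]
    exact hC.near x y hx hy h
  · rw [abs_of_nonpos (sub_nonpos.2 h), neg_sub, ← abs_neg,
      show -(g y - g x - deriv g ξ * (y - x)) = g x - g y - deriv g ξ * (x - y) by ring]
    exact hC.near y x hy hx h

theorem abs_self_sub (hC : CurveChart γ T t u β g φ ξ ρ) : |ξ - ξ| ≤ ρ := by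
  simpa using hC.radius_pos.le

theorem exists_slope (hC : CurveChart γ T t u β g φ ξ ρ) {x y : ℝ} (hx : |x - ξ| ≤ ρ)
    (hy : |y - ξ| ≤ ρ) : ∃ a, g y - g x = a * (y - x) ∧ |a - deriv g ξ| ≤ 1 / 4 ∧ |a| ≤ 1 := by
  rcases eq_or_ne x y with rfl | hne
  · exact ⟨deriv g ξ, by simp, by simp, (hC.regular ξ hC.abs_self_sub).2.1⟩
  · have h0 : 0 < |y - x| := abs_pos.2 (sub_ne_zero.2 hne.symm)
    have h1 : y - x ≠ 0 := abs_pos.1 h0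
    refine ⟨(g y - g x) / (y - x), (div_mul_cancel₀ _ h1).symm, ?_, ?_⟩
    · rw [show (g y - g x) / (y - x) - deriv g ξ = (g y - g x - deriv g ξ * (y - x)) / (y - x) by
        field_simp, abs_div, div_le_iff₀ h0]
      have := hC.abs_near hx hy
      linarith
    · rw [abs_div, div_le_one h0]
      exact hC.abs_sub_le y x

theorem norm_sub_le (hC : CurveChart γ T t u β g φ ξ ρ) {z : ℂ} (h1 : |chartFst u β z - ξ| < ρ)
    (h2 : |chartSnd u z - g ξ| < 2 * ρ) : ‖z - γ t‖ ≤ 6 * ρ := by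
  rw [← hC.graphPoint_base, graphPoint, ← chartPoint_chart hC.unit β z, chartPoint_sub]
  refine (norm_chartPoint_le hC.unit hC.shear _ _).trans ?_
  have := hC.radius_pos
  linarith

theorem mem_frontier_iff (hC : CurveChart γ T t u β g φ ξ ρ) {D : Set ℂ}
    (hD : EnclosesCounterclockwise γ D) {z : ℂ} (h1 : |chartFst u β z - ξ| < ρ)
    (h2 : |chartSnd u z - g ξ| < 2 * ρ) : z ∈ frontier D ↔ g (chartFst u β z) = chartSnd u z := by
  rw [hD.frontier_eq]
  constructor
  · rintro ⟨τ, rfl⟩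
    have := congrArg (chartSnd u) (hC.cover τ (hC.norm_sub_le h1 h2))
    rw [this, chartSnd_graphPoint hC.unit]
  · intro h
    refine ⟨φ (chartFst u β z), ?_⟩
    rw [hC.curve _ h1.le, graphPoint, h, chartPoint_chart hC.unit]

theorem between_bounds (hC : CurveChart γ T t u β g φ ξ ρ) {b : ℝ} (hb : |b - g ξ| = 2 * ρ) {z : ℂ}
    (hz : z ∈ betweenRegion u β g ξ ρ b) : |chartFst u β z - ξ| < ρ ∧
      |chartSnd u z - g ξ| < 2 * ρ ∧ g (chartFst u β z) ≠ chartSnd u z := by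
  obtain ⟨h1, l, hl, h2⟩ := (mem_betweenRegion hC.unit).1 hz
  have h3 := abs_lt.1 ((hC.abs_sub_le (chartFst u β z) ξ).trans_lt h1)
  have hρ := hC.radius_pos
  refine ⟨h1, ?_, ?_⟩
  · rw [h2, show g (chartFst u β z) + l * (b - g (chartFst u β z)) - g ξ =
      (1 - l) * (g (chartFst u β z) - g ξ) + l * (b - g ξ) by ring]
    refine (abs_add_le _ _).trans_lt ?_
    rw [abs_mul, abs_mul, hb, abs_of_pos hl.1, abs_of_pos (sub_pos.2 hl.2)]
    have : (1 - l) * |g (chartFst u β z) - g ξ| < (1 - l) * (2 * ρ) :=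
      mul_lt_mul_of_pos_left (by rw [abs_lt]; constructor <;> linarith) (sub_pos.2 hl.2)
    linarith
  · intro h
    rw [← h, left_eq_add, mul_eq_zero] at h2
    rcases h2 with h2 | h2
    · exact hl.1.ne' h2
    · rw [sub_eq_zero.1 h2] at hb
      have := abs_lt.2 h3
      linarith

theorem mem_between_of_lt (hC : CurveChart γ T t u β g φ ξ ρ) {z : ℂ}
    (h1 : |chartFst u β z - ξ| < ρ) (h2 : |chartSnd u z - g ξ| < 2 * ρ) :
    (g (chartFst u β z) < chartSnd u z → z ∈ betweenRegion u β g ξ ρ (g ξ + 2 * ρ)) ∧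
    (chartSnd u z < g (chartFst u β z) → z ∈ betweenRegion u β g ξ ρ (g ξ - 2 * ρ)) := by
  have h3 := abs_lt.1 ((hC.abs_sub_le (chartFst u β z) ξ).trans_lt h1)
  have hρ := hC.radius_pos
  have h2' := abs_lt.1 h2
  constructor
  · intro h
    have hpos : 0 < g ξ + 2 * ρ - g (chartFst u β z) := by linarith
    refine (mem_betweenRegion hC.unit).2 ⟨h1, (chartSnd u z - g (chartFst u β z)) /
      (g ξ + 2 * ρ - g (chartFst u β z)), ⟨div_pos (sub_pos.2 h) hpos, ?_⟩, ?_⟩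
    · rw [div_lt_one hpos]; linarith
    · rw [div_mul_cancel₀ _ hpos.ne']; ring
  · intro h
    have hpos : 0 < g (chartFst u β z) - (g ξ - 2 * ρ) := by linarith
    refine (mem_betweenRegion hC.unit).2 ⟨h1, (g (chartFst u β z) - chartSnd u z) /
      (g (chartFst u β z) - (g ξ - 2 * ρ)), ⟨div_pos (sub_pos.2 h) hpos, ?_⟩, ?_⟩
    · rw [div_lt_one hpos]; linarith
    · rw [← neg_sub (g (chartFst u β z)) (g ξ - 2 * ρ), mul_neg, div_mul_cancel₀ _ hpos.ne']; ring

/-- The left side of the curve lies above the graph. -/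
theorem exists_interior_above (hC : CurveChart γ T t u β g φ ξ ρ) {D : Set ℂ}
    (hD : EnclosesCounterclockwise γ D) : ∃ z ∈ interior D, |chartFst u β z - ξ| < ρ ∧
      |chartSnd u z - g ξ| < 2 * ρ ∧ g (chartFst u β z) < chartSnd u z := by
  have hρ := hC.radius_pos
  set V := deriv γ t with hV
  set p := chartFst u β (Complex.I * V) with hp
  set q := chartSnd u (Complex.I * V) with hq
  have hq1 : q = chartFst u β V - β * chartSnd u V := by
    simp only [hq, chartSnd, chartFst, Complex.mul_re, Complex.mul_im, Complex.I_re, Complex.I_im]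
    ring
  have hp1 : p = -chartSnd u V + β * q := by
    simp only [hp, hq, chartSnd, chartFst, Complex.mul_re, Complex.mul_im, Complex.I_re,
      Complex.I_im]
    ring
  -- The left normal points strictly above the graph. The summand `|p| / 4` absorbs the deviation of
  -- `g` from its tangent allowed by `near`; for `β = 1` the normal is vertical in the chart and `p
  -- = 0`.
  have hpq : deriv g ξ * p + |p| / 4 < q := by
    rw [hC.deriv_eq]
    rcases hC.direction with ⟨rfl, h⟩ | ⟨rfl, h1, h2⟩
    · rw [Int.cast_zero, zero_mul, sub_zero] at hq1
      rw [Int.cast_zero, zero_mul, add_zero] at hp1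
      rw [hp1, hq1, abs_neg]
      have hpos := (abs_nonneg _).trans_lt h
      have : chartSnd u V / chartFst u 0 V * -chartSnd u V ≤ 0 := by
        rw [div_mul_eq_mul_div, mul_neg]
        exact div_nonpos_of_nonpos_of_nonneg (neg_nonpos.2 (mul_self_nonneg _)) hpos.le
      linarith
    · rw [← hV] at h1 h2
      rw [Int.cast_one, one_mul] at hq1 hp1
      have hq2 : q = chartSnd u V := by linarith
      have hp2 : p = 0 := by linarith
      rw [hp2, hq2]
      simpa using h1
  have hfst : ∀ ε : ℝ, chartFst u β (γ t + ε * (Complex.I * V)) = ξ + ε * p := by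
    intro ε
    rw [← chartFst_graphPoint hC.unit β g ξ, hC.graphPoint_base, hp]
    simp only [chartFst, Complex.add_re, Complex.add_im, Complex.re_ofReal_mul,
      Complex.im_ofReal_mul]
    ring
  have hsnd : ∀ ε : ℝ, chartSnd u (γ t + ε * (Complex.I * V)) = g ξ + ε * q := by
    intro ε
    rw [← chartSnd_graphPoint hC.unit β g ξ, hC.graphPoint_base, hq]
    simp only [chartSnd, Complex.add_re, Complex.add_im, Complex.re_ofReal_mul,
      Complex.im_ofReal_mul]
    ring
  have hsmall : ∀ x : ℝ, ∀ r > 0, ∀ᶠ ε : ℝ in 𝓝[>] 0, |ε * x| < r := by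
    intro x r hr
    refine nhdsWithin_le_nhds (((continuous_id.mul continuous_const).abs.continuousAt
      (x := (0 : ℝ))).eventually_lt (continuousAt_const (y := r)) ?_)
    simpa using hr
  obtain ⟨ε, h1, h2, h3, h4⟩ := ((hD.left_mem t).and ((hsmall p ρ hρ).and
    ((hsmall q (2 * ρ) (by positivity)).and (eventually_mem_nhdsWithin (a := (0 : ℝ)))))).exists
  refine ⟨_, h1, ?_, ?_, ?_⟩
  · rwa [hfst, add_sub_cancel_left]
  · rwa [hsnd, add_sub_cancel_left]
  · rw [hfst, hsnd]
    have h5 := (abs_le.1 (hC.abs_near hC.abs_self_sub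
      (by rw [add_sub_cancel_left]; exact h2.le : |ξ + ε * p - ξ| ≤ ρ))).2
    rw [add_sub_cancel_left, abs_mul, abs_of_pos h4] at h5
    have := mul_lt_mul_of_pos_left hpq h4
    linarith

/-- In the window the frontier of `D` is exactly the graph, so each of the connected regions above
and below lies in the interior or in the complement of `D`. The orientation decides the region
above. -/
theorem mem_iff (hC : CurveChart γ T t u β g φ ξ ρ) {D : Set ℂ} (hD : EnclosesCounterclockwise γ D)
    {z : ℂ} (h1 : |chartFst u β z - ξ| < ρ) (h2 : |chartSnd u z - g ξ| < 2 * ρ) :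
    z ∈ D ↔ g (chartFst u β z) ≤ chartSnd u z := by
  have hρ := hC.radius_pos
  have hdisj : ∀ b, |b - g ξ| = 2 * ρ → Disjoint (betweenRegion u β g ξ ρ b) (frontier D) := by
    intro b hb
    refine disjoint_left.2 fun z hz hzD => ?_
    obtain ⟨e1, e2, e3⟩ := hC.between_bounds hb hz
    exact e3 ((hC.mem_frontier_iff hD e1 e2).1 hzD)
  have hupper : betweenRegion u β g ξ ρ (g ξ + 2 * ρ) ⊆ D := by
    obtain ⟨z, hz, e1, e2, e3⟩ := hC.exists_interior_above hD
    have hz' := (hC.mem_between_of_lt e1 e2).1 e3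
    rcases (isPreconnected_betweenRegion u β hC.continuous ξ ρ _).subset_interior_or_subset_compl
      (hdisj (g ξ + 2 * ρ) (by rw [add_sub_cancel_left, abs_of_pos (by positivity)])) with h | h
    · exact h.trans interior_subset
    · exact absurd (interior_subset hz) (h hz')
  have hDc : IsClosed D := hD.isCompact.isClosed
  -- As a frontier point, `γ t` is a limit of points outside `D`. Such points are neither above the
  -- graph nor on it, so the region below meets the complement.
  have hlower : betweenRegion u β g ξ ρ (g ξ - 2 * ρ) ⊆ Dᶜ := by
    have hopen : IsOpen {z | |chartFst u β z - ξ| < ρ ∧ |chartSnd u z - g ξ| < 2 * ρ} :=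
      (isOpen_lt ((continuous_chartFst u β).sub continuous_const).abs continuous_const).inter
        (isOpen_lt ((continuous_chartSnd u).sub continuous_const).abs continuous_const)
    have hmem : γ t ∈ {z | |chartFst u β z - ξ| < ρ ∧ |chartSnd u z - g ξ| < 2 * ρ} := by
      rw [← hC.graphPoint_base, mem_ofPred_eq, chartFst_graphPoint hC.unit,
        chartSnd_graphPoint hC.unit, sub_self, sub_self, abs_zero]
      constructor <;> linarith
    have hfr : γ t ∈ closure Dᶜ := by
      have : γ t ∈ frontier D := by rw [hD.frontier_eq]; exact mem_range_self t
      rw [frontier_eq_closure_inter_closure] at this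
      exact this.2
    obtain ⟨z, ⟨e1, e2⟩, hz⟩ := mem_closure_iff.1 hfr _ hopen hmem
    have hzS : z ∈ betweenRegion u β g ξ ρ (g ξ - 2 * ρ) := by
      rcases lt_trichotomy (g (chartFst u β z)) (chartSnd u z) with h | h | h
      · exact absurd (hupper ((hC.mem_between_of_lt e1 e2).1 h)) hz
      · exact absurd (hDc.frontier_subset ((hC.mem_frontier_iff hD e1 e2).2 h)) hz
      · exact (hC.mem_between_of_lt e1 e2).2 h
    rcases (isPreconnected_betweenRegion u β hC.continuous ξ ρ _).subset_interior_or_subset_compl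
      (hdisj (g ξ - 2 * ρ) (by rw [sub_sub_cancel_left, abs_neg, abs_of_pos (by positivity)]))
      with h | h
    · exact absurd (interior_subset (h hzS)) hz
    · exact h
  constructor
  · intro hz
    by_contra! h
    exact hlower ((hC.mem_between_of_lt h1 h2).2 h) hz
  · intro h
    rcases h.lt_or_eq with h | h
    · exact hupper ((hC.mem_between_of_lt h1 h2).1 h)
    · exact hDc.frontier_subset ((hC.mem_frontier_iff hD h1 h2).2 h)

/-- Every chord has slope within `1/4` of the tangent slope at the base point, so two chords differ
by at most `1/2`, which is what `norm_chartPoint_growth` requires. -/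
theorem graphChart (hC : CurveChart γ T t u β g φ ξ ρ) {D : Set ℂ}
    (hD : EnclosesCounterclockwise γ D) : GraphChart D u β g ξ ρ (1 / 8) := by
  have hρ := hC.radius_pos
  have grow : ∀ x y, |x - ξ| ≤ ρ → |y - ξ| ≤ ρ → 0 ≤ (x - ξ) * (y - x) →
      ‖graphPoint u β g x - graphPoint u β g ξ‖ + 1 / 8 * |y - x| ≤
        ‖graphPoint u β g y - graphPoint u β g ξ‖ := by
    intro x y hx hy h
    obtain ⟨a, ha, ha1, ha2⟩ := hC.exists_slope hC.abs_self_sub hx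
    obtain ⟨b, hb, hb1, -⟩ := hC.exists_slope hx hy
    have e : graphPoint u β g y - graphPoint u β g ξ = (graphPoint u β g x - graphPoint u β g ξ) +
      (graphPoint u β g y - graphPoint u β g x) := by ring
    rw [e]
    simp only [graphPoint, chartPoint_sub, ha, hb]
    refine norm_chartPoint_growth hC.unit hC.shear ha2 ?_ h
    rw [abs_le] at ha1 hb1 ⊢
    constructor <;> linarith
  refine ⟨hC.unit, hC.shear, hC.slope, hρ, by norm_num, fun z h1 h2 => hC.mem_iff hD h1 h2, ?_, ?_⟩
  · intro x y hx hxy hy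
    have := grow x y (by rw [abs_le]; constructor <;> linarith)
      (by rw [abs_le]; constructor <;> linarith)
      (mul_nonneg (sub_nonneg.2 hx) (sub_nonneg.2 hxy))
    rwa [abs_of_nonneg (sub_nonneg.2 hxy)] at this
  · intro x y hx hxy hy
    have := grow y x (by rw [abs_le]; constructor <;> linarith)
      (by rw [abs_le]; constructor <;> linarith)
      (mul_nonneg_of_nonpos_of_nonpos (sub_nonpos.2 hy) (sub_nonpos.2 hxy))
    rwa [abs_of_nonpos (sub_nonpos.2 hxy), neg_sub] at this

end CurveChart

/-! ### Derivative of the flux and the limit of small radius -/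

theorem tendsto_liminf_limsup_of_eventually {l : Filter ℝ} {a : ℝ → ℕ → ℝ} {c : ℝ}
    (h : ∀ ε > 0, ∀ᶠ δ in l, ∀ᶠ N in atTop, |a δ N - c| ≤ ε) :
    Tendsto (fun δ => liminf (fun N => (a δ N : EReal)) atTop) l (𝓝 (c : EReal)) ∧
    Tendsto (fun δ => limsup (fun N => (a δ N : EReal)) atTop) l (𝓝 (c : EReal)) := by
  have hlow : ∀ b < (c : EReal), ∀ᶠ δ in l, b < liminf (fun N => (a δ N : EReal)) atTop := by
    intro b hb
    obtain ⟨x, hx1, hx2⟩ := EReal.lt_iff_exists_real_btwn.1 hb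
    filter_upwards [h (c - x) (sub_pos.2 (EReal.coe_lt_coe_iff.1 hx2))] with δ hδ
    refine hx1.trans_le (le_liminf_of_le (by isBoundedDefault) (hδ.mono fun N hN => ?_))
    have := (abs_le.1 hN).1
    exact EReal.coe_le_coe_iff.2 (by linarith)
  have hupp : ∀ b > (c : EReal), ∀ᶠ δ in l, limsup (fun N => (a δ N : EReal)) atTop < b := by
    intro b hb
    obtain ⟨x, hx1, hx2⟩ := EReal.lt_iff_exists_real_btwn.1 hb
    filter_upwards [h (x - c) (sub_pos.2 (EReal.coe_lt_coe_iff.1 hx1))] with δ hδ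
    refine (limsup_le_of_le (by isBoundedDefault) (hδ.mono fun N hN => ?_)).trans_lt hx2
    have := (abs_le.1 hN).2
    exact EReal.coe_le_coe_iff.2 (by linarith)
  refine ⟨tendsto_order.2 ⟨hlow, fun b hb => (hupp b hb).mono fun δ hδ => ?_⟩,
    tendsto_order.2 ⟨fun b hb => (hlow b hb).mono fun δ hδ => ?_, hupp⟩⟩
  · exact lt_of_le_of_lt liminf_le_limsup hδ
  · exact lt_of_lt_of_le hδ liminf_le_limsup

theorem hasDerivAt_endFlux_zero (m : ℝ) :
    HasDerivAt (endFlux 0) ((1 - m ^ 2) / (1 + m ^ 2) ^ 2) m := by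
  have e : endFlux 0 = fun m => m / (1 + m ^ 2) := by
    funext m; simp [endFlux, stepDot, stepOffset]
  rw [e]
  have hpos : 1 + m ^ 2 ≠ 0 := by positivity
  refine ((hasDerivAt_id' m).div (((hasDerivAt_id' m).pow 2).const_add 1) hpos).congr_deriv ?_
  congr 1
  norm_num
  ring

/-- The two branches of `endFlux 1` meet at `1/2` with value `1/2`, and deviate from it by `2(x -
1/2)²/((1 - x)² + x²)` with opposite signs. The denominator is at least `1/2`, so the deviation is
at most `4(x - 1/2)²`: the drift vanishes to first order at a diagonal tangent. -/
theorem hasDerivAt_endFlux_one : HasDerivAt (endFlux 1) 0 (1 / 2) := by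
  rw [hasDerivAt_iff_isLittleO]
  refine Asymptotics.IsBigO.trans_isLittleO (Asymptotics.IsBigO.of_bound 4 ?_)
    (Asymptotics.isLittleO_pow_sub_sub (1 / 2 : ℝ) one_lt_two)
  refine Eventually.of_forall fun x => ?_
  have hden : 0 < (1 - x) ^ 2 + x ^ 2 := by nlinarith [sq_nonneg (2 * x - 1)]
  have hden2 : 1 / 2 ≤ (1 - x) ^ 2 + x ^ 2 := by nlinarith [sq_nonneg (2 * x - 1)]
  have hhalf : endFlux 1 (1 / 2) = 1 / 2 := by norm_num [endFlux, stepDot, stepOffset]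
  have key : |2 * (x - 1 / 2) ^ 2 / ((1 - x) ^ 2 + x ^ 2)| ≤ 4 * (x - 1 / 2) ^ 2 := by
    rw [abs_of_nonneg (by positivity), div_le_iff₀ hden]
    nlinarith [sq_nonneg (x - 1 / 2)]
  rw [smul_zero, sub_zero, hhalf, Real.norm_eq_abs, Real.norm_eq_abs, Real.norm_eq_abs, sq_abs,
    abs_of_nonneg (sq_nonneg (x - 1 / 2))]
  by_cases hx : 1 / 2 < x
  · have e : endFlux 1 x - 1 / 2 = 2 * (x - 1 / 2) ^ 2 / ((1 - x) ^ 2 + x ^ 2) := by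
      rw [endFlux, stepDot, stepOffset, if_pos ⟨rfl, hx⟩, if_pos ⟨rfl, hx⟩]
      push_cast
      rw [one_mul]
      field_simp
      ring
    rw [e]
    exact key
  · have e : endFlux 1 x - 1 / 2 = -(2 * (x - 1 / 2) ^ 2 / ((1 - x) ^ 2 + x ^ 2)) := by
      rw [endFlux, stepDot, stepOffset, if_neg (by tauto), if_neg (by tauto)]
      push_cast
      rw [one_mul]
      field_simp
      ring
    rw [e, abs_neg]
    exact key

/-- Rotating by a right angle only changes the sign of `cos 2θ`, so the absolute value is the same
in every axis frame. -/
theorem abs_cos_two_mul_mul_sq {u : ℤ × ℤ} (hu : IsUnitVector u) {V : ℂ} {c θ : ℝ}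
    (h : V = c * Complex.exp (θ * Complex.I)) :
    |Real.cos (2 * θ)| * ‖V‖ ^ 2 = |chartFst u 0 V ^ 2 - chartSnd u V ^ 2| := by
  have hre : V.re = c * Real.cos θ := by
    rw [h, Complex.re_ofReal_mul, Complex.exp_ofReal_mul_I_re]
  have him : V.im = c * Real.sin θ := by
    rw [h, Complex.im_ofReal_mul, Complex.exp_ofReal_mul_I_im]
  have h1 : ‖V‖ ^ 2 = c ^ 2 := by
    rw [← Complex.normSq_eq_norm_sq, Complex.normSq_apply, hre, him]
    linear_combination c ^ 2 * Real.sin_sq_add_cos_sq θ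
  have h2 : V.re ^ 2 - V.im ^ 2 = Real.cos (2 * θ) * ‖V‖ ^ 2 := by
    rw [h1, hre, him, Real.cos_two_mul']
    ring
  have h3 : |chartFst u 0 V ^ 2 - chartSnd u V ^ 2| = |V.re ^ 2 - V.im ^ 2| := by
    rcases hu with rfl | rfl | rfl | rfl <;> simp [chartFst, chartSnd, abs_sub_comm]
  rw [h3, h2, abs_mul, abs_of_nonneg (sq_nonneg ‖V‖)]

theorem hasDerivAt_chartPoint (u : ℤ × ℤ) (β : ℤ) {g : ℝ → ℝ} {m ξ : ℝ} (hg : HasDerivAt g m ξ) :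
    HasDerivAt (graphPoint u β g) (chartPoint u β 1 m) ξ := by
  have e : graphPoint u β g = fun x => chartPoint u β 1 0 * x + chartPoint u β 0 1 * g x := by
    funext x
    apply Complex.ext <;> simp [graphPoint, chartPoint] <;> ring
  rw [e]
  refine (((hasDerivAt_id' ξ).ofReal_comp.const_mul (chartPoint u β 1 0)).add
    (hg.ofReal_comp.const_mul (chartPoint u β 0 1))).congr_deriv ?_
  apply Complex.ext <;> simp [chartPoint] <;> ring

/-- The distance to the base point is `0` at `ξ` and at least `cρ` at `ξ ± ρ`; the intermediate
value theorem gives one crossing on each side. -/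
theorem GraphChart.exists_crossing {D : Set ℂ} {u : ℤ × ℤ} {β : ℤ} {g : ℝ → ℝ}
    {ξ ρ c : ℝ} (hG : GraphChart D u β g ξ ρ c) {r : ℝ}
    (hr : 0 < r) (hrρ : r ≤ c * ρ) : ∃ ξ₀ ξ₁, ξ₀ ∈ Ico (ξ - ρ) ξ ∧ ξ₁ ∈ Ioc ξ (ξ + ρ) ∧
      ‖graphPoint u β g ξ₀ - graphPoint u β g ξ‖ = r ∧
      ‖graphPoint u β g ξ₁ - graphPoint u β g ξ‖ = r := by
  have hρ := hG.radius_pos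
  have hcont : Continuous fun x => ‖graphPoint u β g x - graphPoint u β g ξ‖ := by
    have : Continuous g := (LipschitzWith.of_dist_le_mul (K := 1) fun x y => by
      rw [Real.dist_eq, Real.dist_eq, NNReal.coe_one, one_mul]; exact hG.abs_sub_le x y).continuous
    exact ((continuous_id.chartPoint this u β).sub continuous_const).norm
  have h0 : ‖graphPoint u β g ξ - graphPoint u β g ξ‖ = 0 := by rw [sub_self, norm_zero]
  have hl := hG.growth_left (ξ - ρ) ξ le_rfl (by linarith) le_rfl
  have hr' := hG.growth_right ξ (ξ + ρ) le_rfl (by linarith) le_rfl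
  rw [h0] at hl hr'
  obtain ⟨ξ₀, h1, h2⟩ := intermediate_value_Icc' (by linarith : ξ - ρ ≤ ξ) hcont.continuousOn
    (⟨by rw [h0]; exact hr.le, by rw [sub_sub_cancel] at hl; linarith⟩ : r ∈ Icc _ _)
  obtain ⟨ξ₁, h3, h4⟩ := intermediate_value_Icc (by linarith : ξ ≤ ξ + ρ) hcont.continuousOn
    (⟨by rw [h0]; exact hr.le, by rw [add_sub_cancel_left] at hr'; linarith⟩ : r ∈ Icc _ _)
  refine ⟨ξ₀, ξ₁, ⟨h1.1, h1.2.lt_of_ne ?_⟩, ⟨h3.1.lt_of_ne ?_, h3.2⟩, h2, h4⟩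
  · rintro rfl
    exact hr.ne (h0.symm.trans h2)
  · rintro rfl
    exact hr.ne (h0.symm.trans h4)

namespace CurveChart

variable {γ : ℝ → ℂ} {T t : ℝ} {u : ℤ × ℤ} {β : ℤ} {g φ : ℝ → ℝ} {ξ ρ c : ℝ}

/-- The growth condition makes the distance strictly monotone on each side of `ξ`, so each side has
a single crossing. `cover` excludes crossings with remote parts of the curve. -/
theorem isCrossingPair (hC : CurveChart γ T t u β g φ ξ ρ) {D : Set ℂ}
    (hG : GraphChart D u β g ξ ρ c) {r ξ₀ ξ₁ : ℝ} (hr : 0 < r) (hrρ : 16 * r ≤ ρ)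
    (h0 : ξ₀ ∈ Ico (ξ - ρ) ξ) (h1 : ξ₁ ∈ Ioc ξ (ξ + ρ))
    (h0r : ‖graphPoint u β g ξ₀ - graphPoint u β g ξ‖ = r)
    (h1r : ‖graphPoint u β g ξ₁ - graphPoint u β g ξ‖ = r) :
    IsCrossingPair γ T t r (graphPoint u β g ξ₀) (graphPoint u β g ξ₁) := by
  have hc := hG.growth_pos
  have a0 : |ξ₀ - ξ| ≤ ρ := by rw [abs_le]; constructor <;> linarith [h0.1, h0.2]
  have a1 : |ξ₁ - ξ| ≤ ρ := by rw [abs_le]; constructor <;> linarith [h1.1, h1.2]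
  have p0 := hC.parameter ξ₀ a0
  have p1 := hC.parameter ξ₁ a1
  refine ⟨fun h => ?_, ?_, φ ξ₀, φ ξ₁, p0.2.1 h0.2, p1.2.2 h1.1, ?_, hC.curve _ a0, hC.curve _ a1⟩
  · have := congrArg (chartFst u β) h
    rw [chartFst_graphPoint hC.unit, chartFst_graphPoint hC.unit] at this
    linarith [h0.2, h1.1]
  · ext z
    rw [mem_inter_iff, mem_sphere_iff_norm, mem_insert_iff, mem_singleton_iff]
    constructor
    · rintro ⟨hz, τ, rfl⟩
      have hτ := hC.cover τ (by rw [hz]; linarith)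
      set x := chartFst u β (γ τ)
      rw [hτ, ← hC.graphPoint_base] at hz
      have hx := hG.abs_sub_le_norm x ξ
      rw [hz] at hx
      have hx' := abs_le.1 (hx.trans (by linarith : 2 * r ≤ ρ))
      rw [hτ]
      rcases lt_trichotomy x ξ with h | h | h
      · left
        rcases le_total x ξ₀ with h2 | h2
        · have := hG.growth_left x ξ₀ (by linarith) h2 h0.2.le
          rw [show x = ξ₀ by nlinarith]
        · have := hG.growth_left ξ₀ x h0.1 h2 h.le
          rw [show x = ξ₀ by nlinarith]
      · rw [h, sub_self, norm_zero] at hz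
        exact absurd hz hr.ne
      · right
        rcases le_total x ξ₁ with h2 | h2
        · have := hG.growth_right x ξ₁ h.le h2 h1.2
          rw [show x = ξ₁ by nlinarith]
        · have := hG.growth_right ξ₁ x h1.1.le h2 (by linarith)
          rw [show x = ξ₁ by nlinarith]
    · rw [← hC.graphPoint_base]
      rintro (rfl | rfl)
      · exact ⟨h0r, _, hC.curve _ a0⟩
      · exact ⟨h1r, _, hC.curve _ a1⟩
  · have := (abs_lt.1 p0.1).1
    have := (abs_lt.1 p1.1).2
    linarith

/-- The limit of the difference quotients of a function of the first coordinate, with respect to the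
distance from the base point. -/
theorem tendsto_crossing_quotient (hC : CurveChart γ T t u β g φ ξ ρ) {D : Set ℂ}
    (hG : GraphChart D u β g ξ ρ c) {Ξ₀ Ξ₁ : ℝ → ℝ}
    (hΞ : ∀ᶠ r in 𝓝[>] 0, Ξ₀ r < ξ ∧ ξ < Ξ₁ r ∧
      ‖graphPoint u β g (Ξ₀ r) - graphPoint u β g ξ‖ = r ∧
      ‖graphPoint u β g (Ξ₁ r) - graphPoint u β g ξ‖ = r)
    {Φ : ℝ → ℝ} {e : ℝ} (hΦ : HasDerivAt Φ e ξ) :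
    Tendsto (fun r => (Φ (Ξ₁ r) - Φ (Ξ₀ r)) / r) (𝓝[>] 0)
      (𝓝 (2 * (e / ‖chartPoint u β 1 (deriv g ξ)‖))) := by
  have hg : HasDerivAt g (deriv g ξ) ξ := (hC.regular ξ hC.abs_self_sub).1.hasDerivAt
  -- Dividing one slope by the norm of the other measures the increment of `Φ` per unit of Euclidean
  -- distance. Both ends lie at distance exactly `r`, so the limits on the two sides add up to the
  -- factor `2`.
  have hlim : Tendsto (fun x => _root_.slope Φ ξ x / ‖_root_.slope (graphPoint u β g) ξ x‖) (𝓝[≠] ξ)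
      (𝓝 (e / ‖chartPoint u β 1 (deriv g ξ)‖)) :=
    (hasDerivAt_iff_tendsto_slope.1 hΦ).div
      (hasDerivAt_iff_tendsto_slope.1 (hasDerivAt_chartPoint u β hg)).norm
      (norm_chartPoint_pos hC.unit β _).ne'
  have hdist : ∀ Ξ : ℝ → ℝ, (∀ᶠ r in 𝓝[>] 0, Ξ r ≠ ξ ∧
      ‖graphPoint u β g (Ξ r) - graphPoint u β g ξ‖ = r) → Tendsto Ξ (𝓝[>] 0) (𝓝[≠] ξ) := by
    intro Ξ h
    refine tendsto_nhdsWithin_iff.2 ⟨?_, h.mono fun r hr => hr.1⟩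
    rw [tendsto_iff_dist_tendsto_zero]
    have h2 : Tendsto (fun r : ℝ => 2 * r) (𝓝[>] 0) (𝓝 0) := by
      have : Tendsto (fun r : ℝ => 2 * r) (𝓝 0) (𝓝 (2 * 0)) := tendsto_id.const_mul 2
      rw [mul_zero] at this
      exact this.mono_left nhdsWithin_le_nhds
    refine squeeze_zero' (Eventually.of_forall fun r => dist_nonneg) (h.mono fun r hr => ?_) h2
    have := hG.abs_sub_le_norm (Ξ r) ξ
    rwa [hr.2] at this
  have t1 := hlim.comp (hdist Ξ₁ (hΞ.mono fun r hr => ⟨hr.2.1.ne', hr.2.2.2⟩))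
  have t0 := hlim.comp (hdist Ξ₀ (hΞ.mono fun r hr => ⟨hr.1.ne, hr.2.2.1⟩))
  rw [two_mul]
  refine (t1.add t0).congr' ?_
  filter_upwards [hΞ, eventually_mem_nhdsWithin] with r hr hr0
  obtain ⟨h0, h1, h0r, h1r⟩ := hr
  have hr0' : r ≠ 0 := (mem_Ioi.1 hr0).ne'
  have b0 : Ξ₀ r - ξ < 0 := sub_neg.2 h0
  have b1 : 0 < Ξ₁ r - ξ := sub_pos.2 h1
  simp only [Function.comp, slope_def_module, norm_smul, norm_inv, Real.norm_eq_abs, h0r, h1r,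
    abs_of_neg b0, abs_of_pos b1, smul_eq_mul]
  have b0' := b0.ne
  have b1' := b1.ne'
  field_simp
  ring

/-- The charts have determinant one, so the numerator of the curvature is unchanged and the
curvature equals the second derivative of `g` divided by `l³`. It remains that the derivative of
`endFlux` times `l²` is `|cos 2θ|`: both vanish at a diagonal tangent, and otherwise both are `(1 -
m²)/(1 + m²)`. -/
theorem endFlux_curvature (hC : CurveChart γ T t u β g φ ξ ρ) {θ : ℝ} (hθ : IsTangentAngle γ t θ) :
    ∃ e, HasDerivAt (fun x => endFlux β (deriv g x)) e ξ ∧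
      e / ‖chartPoint u β 1 (deriv g ξ)‖ = |Real.cos (2 * θ)| * curvature γ t := by
  obtain ⟨k, hk⟩ := hθ
  set V := deriv γ t with hV
  set V' := deriv (deriv γ) t with hV'
  set m := deriv g ξ with hm
  set a := chartFst u β V with ha
  set b := chartSnd u V with hb
  have hcos := abs_cos_two_mul_mul_sq hC.unit hk
  have hapos : 0 < a := by
    rcases hC.direction with ⟨-, h⟩ | ⟨-, h1, h2⟩
    · exact (abs_nonneg _).trans_lt h
    · rw [ha, hV]; linarith
  have hbm : b = a * m := by
    rw [hm, hC.deriv_eq, mul_div_cancel₀ _ hapos.ne']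
  set l := ‖chartPoint u β 1 m‖ with hl
  have hl0 : 0 < l := norm_chartPoint_pos hC.unit β m
  have hVl : ‖V‖ = a * l := by
    rw [← chartPoint_chart hC.unit β V, ← ha, ← hb, hbm, hl, ← abs_of_pos hapos, ← Real.norm_eq_abs,
      ← norm_smul, chartPoint_smul, Real.norm_eq_abs, abs_of_pos hapos, mul_one]
  have hcurv : curvature γ t = (a * chartSnd u V' - chartFst u β V' * b) / (a * l) ^ 3 := by
    rw [curvature, ← hV, ← hV', ← hVl]
    congr 1
    · have := hC.unit.sq_real
      simp only [ha, hb, chartFst, chartSnd]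
      linear_combination (V'.re * V.im - V.re * V'.im) * this
    · rw [show V.re ^ 2 + V.im ^ 2 = ‖V‖ ^ 2 by
        rw [← Complex.normSq_eq_norm_sq, Complex.normSq_apply]; ring,
        ← Real.rpow_natCast, ← Real.rpow_mul (norm_nonneg _), ← Real.rpow_natCast]
      norm_num
  obtain ⟨e, he, hel⟩ : ∃ e, HasDerivAt (endFlux β) e m ∧ e * l ^ 2 = |Real.cos (2 * θ)| := by
    have hV2 : ‖V‖ ^ 2 ≠ 0 := by rw [hVl]; positivity
    have hl2 := norm_chartPoint_sq hC.unit β 1 m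
    rw [← hl] at hl2
    rcases hC.direction with ⟨h0, h⟩ | ⟨h0, h1, h2⟩
    · subst h0
      refine ⟨_, hasDerivAt_endFlux_zero m, mul_right_cancel₀ hV2 ?_⟩
      rw [hcos, ← ha, ← hb, abs_of_pos, hVl, mul_pow, hl2, hbm]
      · have : 1 + m ^ 2 ≠ 0 := by positivity
        push_cast
        field_simp
        ring
      · rw [sub_pos, sq_lt_sq, abs_of_pos hapos]
        exact h
    · subst h0
      have hm2 : m = 1 / 2 := by
        rw [hm, hC.deriv_eq, h2]
        field_simp
      refine ⟨0, by rw [hm2]; exact hasDerivAt_endFlux_one, mul_right_cancel₀ hV2 ?_⟩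
      have : chartFst u 0 V = chartSnd u V := by
        have e1 : chartFst u 1 V = chartFst u 0 V + chartSnd u V := by
          simp only [chartFst, chartSnd]; push_cast; ring
        rw [← hV] at h2
        linarith
      rw [hcos, this, sub_self, abs_zero, zero_mul, zero_mul]
  have hcomp := HasDerivAt.comp (h₂ := endFlux β) (h := deriv g) ξ he hC.hasDerivAt_deriv
  refine ⟨_, hcomp, ?_⟩
  rw [← hV, ← hV', ← ha, ← hb, hcurv, ← hel]
  field_simp

end CurveChart

/-! ### Conclusion -/

variable {W : Type*} [MeasurableSpace W] {X : ℝ≥0 → W → Config} {P : Config → Measure W}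

theorem IsGlauberDynamics.tendsto_volumeDrift (hX : IsGlauberDynamics X P) {N : ℕ} (hN : 0 < N)
    (σ : Config) {S : Set ℂ} (hS : Bornology.IsBounded S) :
    Tendsto (driftQuotient X P N σ S) (𝓝[>] 0) (𝓝 (volumeDrift X P N σ S)) := by
  set F := (finite_setOf_latticeBox_inter hN hS).toFinset
  have hF : ∀ x, x ∈ F ↔ (latticeBox N x ∩ S).Nonempty := by intro x; simp [F]
  rw [hX.volumeDrift_eq hN σ hF]
  exact hX.tendsto_driftQuotient hN σ hF

theorem GraphChart.exists_ends {D : Set ℂ} {u : ℤ × ℤ} {β : ℤ} {g : ℝ → ℝ} {ξ ρ : ℝ}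
    (hG : GraphChart D u β g ξ ρ (1 / 8)) :
    ∃ Ξ₀ Ξ₁ : ℝ → ℝ, ∀ r, 0 < r → 16 * r ≤ ρ → Ξ₀ r ∈ Ico (ξ - ρ) ξ ∧ Ξ₁ r ∈ Ioc ξ (ξ + ρ) ∧
      ‖graphPoint u β g (Ξ₀ r) - graphPoint u β g ξ‖ = r ∧
      ‖graphPoint u β g (Ξ₁ r) - graphPoint u β g ξ‖ = r := by
  have h : ∀ r, ∃ ξ₀ ξ₁, 0 < r → 16 * r ≤ ρ → ξ₀ ∈ Ico (ξ - ρ) ξ ∧ ξ₁ ∈ Ioc ξ (ξ + ρ) ∧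
      ‖graphPoint u β g ξ₀ - graphPoint u β g ξ‖ = r ∧
      ‖graphPoint u β g ξ₁ - graphPoint u β g ξ‖ = r := by
    intro r
    by_cases hr : 0 < r ∧ 16 * r ≤ ρ
    · obtain ⟨ξ₀, ξ₁, h⟩ := hG.exists_crossing hr.1 (by linarith)
      exact ⟨ξ₀, ξ₁, fun _ _ => h⟩
    · exact ⟨0, 0, fun h1 h2 => absurd ⟨h1, h2⟩ hr⟩
  choose Ξ₀ Ξ₁ h using h
  exact ⟨Ξ₀, Ξ₁, h⟩

end

theorem proposition1 {W : Type*} [MeasurableSpace W]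
    (X : ℝ≥0 → W → Config) (P : Config → Measure W) (hX : IsGlauberDynamics X P)
    (γ : ℝ → ℂ) (T : ℝ) (hγ : IsC2JordanCurve γ T)
    (D : Set ℂ) (hD : EnclosesCounterclockwise γ D)
    (t θ : ℝ) (hθ : IsTangentAngle γ t θ) :
    ∃ x₀ x₁ : ℝ → ℂ,
      -- for small `r` the circle meets the curve in exactly the two points `x₀ r` and `x₁ r`
      (∀ᶠ r in 𝓝[>] (0 : ℝ), IsCrossingPair γ T t r (x₀ r) (x₁ r)) ∧
      -- the limit defining the drift exists, and the drift is integrable in the two radii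
      (∀ᶠ r in 𝓝[>] (0 : ℝ), ∀ N : ℕ, 1 ≤ N →
        (∀ α₁ α₂ : ℝ, 0 ≤ α₁ → 0 ≤ α₂ →
          Tendsto
            (driftQuotient X P N (initialConfig D N) (threeBalls (γ t) (x₀ r) (x₁ r) r α₁ α₂))
            (𝓝[>] 0)
            (𝓝 (volumeDrift X P N (initialConfig D N)
              (threeBalls (γ t) (x₀ r) (x₁ r) r α₁ α₂)))) ∧
        (∀ δ : ℝ, 0 < δ →
          IntegrableOn
            (fun α : ℝ × ℝ => volumeDrift X P N (initialConfig D N)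
              (threeBalls (γ t) (x₀ r) (x₁ r) r α.1 α.2))
            (Icc 0 δ ×ˢ Icc 0 δ))) ∧
      HasIteratedLimit
        (fun r δ => liminf (fun N : ℕ =>
          ((1 / (2 * r) * averagedDrift X P N (initialConfig D N) (γ t) (x₀ r) (x₁ r) r δ : ℝ) :
            EReal)) atTop)
        (-(1 / 2) * |Real.cos (2 * θ)| * curvature γ t) ∧
      HasIteratedLimit
        (fun r δ => limsup (fun N : ℕ =>
          ((1 / (2 * r) * averagedDrift X P N (initialConfig D N) (γ t) (x₀ r) (x₁ r) r δ : ℝ) :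
            EReal)) atTop)
        (-(1 / 2) * |Real.cos (2 * θ)| * curvature γ t) := by
  obtain ⟨u, β, g, φ, ρ, hC⟩ := exists_curveChart hγ t
  have hG := hC.graphChart hD
  obtain ⟨Ξ₀, Ξ₁, hΞ⟩ := hG.exists_ends
  set ξ := chartFst u β (γ t)
  have hρ := hC.radius_pos
  have hsmall : ∀ᶠ r in 𝓝[>] (0 : ℝ), 0 < r ∧ 16 * r ≤ ρ := by
    filter_upwards [Ioo_mem_nhdsGT (show (0 : ℝ) < ρ / 16 by positivity)] with r hr
    exact ⟨hr.1, by linarith [hr.2]⟩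
  obtain ⟨e, he, hel⟩ := hC.endFlux_curvature hθ
  -- The constant `-1/4` is the factor `-1/2` in front of the flux difference times the `1/2` of
  -- `1/(2r)`; the two ends give back a factor `2`.
  have hlimit := (hC.tendsto_crossing_quotient hG (hsmall.mono fun r hr =>
    have h := hΞ r hr.1 hr.2
    ⟨h.1.2, h.2.1.1, h.2.2⟩) he).const_mul (-(1 / 4))
  rw [hel, show -(1 / 4) * (2 * (|Real.cos (2 * θ)| * curvature γ t)) =
    -(1 / 2) * |Real.cos (2 * θ)| * curvature γ t by ring] at hlimit
  have hinner : ∀ᶠ r in 𝓝[>] (0 : ℝ), ∀ ε > 0, ∀ᶠ δ in 𝓝[>] (0 : ℝ), ∀ᶠ N : ℕ in atTop,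
      |1 / (2 * r) * averagedDrift X P N (initialConfig D N) (γ t) (graphPoint u β g (Ξ₀ r))
        (graphPoint u β g (Ξ₁ r)) r δ - -(1 / 4) * ((endFlux β (deriv g (Ξ₁ r)) -
          endFlux β (deriv g (Ξ₀ r))) / r)| ≤ ε := by
    filter_upwards [hsmall] with r hr ε hε
    obtain ⟨h0, h1, h0r, h1r⟩ := hΞ r hr.1 hr.2
    obtain ⟨a1, a2, a3⟩ := hC.regular (Ξ₀ r) (by rw [abs_le]; constructor <;> linarith [h0.1, h0.2])
    obtain ⟨b1, b2, b3⟩ := hC.regular (Ξ₁ r) (by rw [abs_le]; constructor <;> linarith [h1.1, h1.2])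
    have hr0 := hr.1
    -- The tolerance `ε * (2 * r)` becomes `ε` after division by `2r`; `r` is fixed while `N` and
    -- `δ` pass to their limits.
    filter_upwards [hG.averagedDrift_limit hX a2 b2 a3 b3 a1 b1 h0r h1r hr.1 hr.2 h0.2 h1.1
      (show 0 < ε * (2 * r) by positivity)] with δ hδ
    filter_upwards [hδ] with N hN
    rw [hC.graphPoint_base] at hN
    rw [show ∀ A E : ℝ, 1 / (2 * r) * A - -(1 / 4) * (E / r) = (A + 1 / 2 * E) / (2 * r) from
      fun A E => by field_simp; ring, abs_div, abs_of_pos (show 0 < 2 * r by positivity),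
      div_le_iff₀ (by positivity)]
    exact hN
  refine ⟨fun r => graphPoint u β g (Ξ₀ r), fun r => graphPoint u β g (Ξ₁ r), ?_, ?_,
    ⟨_, hinner.mono fun r hr => (tendsto_liminf_limsup_of_eventually hr).1, hlimit⟩,
    ⟨_, hinner.mono fun r hr => (tendsto_liminf_limsup_of_eventually hr).2, hlimit⟩⟩
  · filter_upwards [hsmall] with r hr
    obtain ⟨h0, h1, h0r, h1r⟩ := hΞ r hr.1 hr.2
    exact hC.isCrossingPair hG hr.1 hr.2 h0 h1 h0r h1r
  · refine Eventually.of_forall fun r N hN => ⟨fun α₁ α₂ _ _ => ?_, fun δ _ => ?_⟩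
    · exact hX.tendsto_volumeDrift hN _ (isBounded_threeBalls _ _ _ _ _ _)
    · exact hX.integrableOn_volumeDrift hN _ _ _ _ _ _
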